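/- **Setting.** Let $d\ge 1$ and $\mathbb T^d=\mathbb R^d/\mathbb Z^d$. For $1<p<\infty$, $1\le q\le\infty$, $s\in\mathbb R$, the (real) Besov space $B^s_{p,q}=B^s_{p,q}(\mathbb T^d)$ is normed by $$\|f\|_{B^s_{p,q}}=\Big\|\Big(2^{js}\,\big\|\sum_{z\in\mathbb Z^d:\ \chi_j(2\pi z)=1}\hat f(z)e^{2\pi i z\cdot x}\big\|_{L^p(\mathbb T^d)}\Big)_{j\in\mathbb N_0}\Big\|_{\ell^q},$$ where $\chi_0$ is the characteristic function of $\{|x|_\infty\le 1\}$ and $\chi_j(x)=\chi_0(2^{-j}x)-\chi_0(2^{-j+1}x)$ for $j\geq 1$. Let $\sigma\in\mathbb N$ and let $(\phi_{j,l})_{j\in\mathbb N_0,\,l\in I_j}\subset C^\sigma(\mathbb T^d,\mathbb R)$, with countable $I_j$, be a wavelet system: it is orthonormal in $L^2(\mathbb T^d)$, and for all $1<p<\infty$, $1\le q\le\infty$, $|s|<\sigma$, a distribution $f\in C^\sigma(\mathbb T^d,\mathbb R)'$ lies in $B^s_{p,q}$ if and only if $$\|f\|_{B^s_{p,q},\mathcal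 W}=\Big\|\Big(2^{js}2^{jd(\frac12-\frac1p)}\|(f(\phi_{j,l}))_{l\in I_j}\|_{\ell^p}\Big)_{j\in\mathbb N_0}\Big\|_{\ell^q}$$ is finite, the two norms being equivalent. Let $p\in(1,2]$, $q\in(1,\infty)$, $a>\frac dp-\frac d2$, $s\in(0,\frac a{q-1})$ and $\sigma>\max\{a,s\}$. Let $\mathcal X=B^0_{p,q}$ with the norm $\|\cdot\|_{B^0_{p,q},\mathcal W}$, $\mathcal Y=L^2(\mathbb T^d)$, $r=\max\{2,p,q\}$ and $\mathcal R(f)=\frac1r\|f\|_{B^0_{p,q},\mathcal W}^r$. Let $\mathcal D\subset\mathcal X$ be closed and convex, and let $F_a:\mathcal D\to\mathcal Y$ be $a$-times smoothing: for some $L>0$ and all $f_1,f_2\in\mathcal D$, $$\|F_a(f_1)-F_a(f_2)\|_{B^a_{p,q}}\le L\|f_1-f_2\|_{B^0_{p,q}},\qquad \tfrac1L\|f_1-f_2\|_{B^{-a}_{2,2}}\le\|F_a(f_1)-F_a(f_2)\|_{L^2}\le L\|f_1-f_2\|_{B^{-a}_{2,2}}.$$ Put $$\nu=\begin{cases}\frac{qa}{a+s},&q\ge2\\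 \frac{2a}{a+s(q-1)},&q\le2\end{cases}\qquad \mu=\begin{cases}\frac q2\frac s{a+s},&q\ge2\\ \frac{s(q-1)}{a+s(q-1)},&q\le2.\end{cases}$$ **Theorem.** There are constants $c,c'>0$ such that for every $\varrho>0$ and every $f^\dagger\in\mathcal D\cap B^s_{p,\infty}$ with $\|f^\dagger\|_{B^s_{p,\infty}}\le\varrho$ the following holds. 1. The function $\psi(\tau)=c\varrho^\nu\tau^\mu$ is a concave index function on $[0,\infty)$ (concave, continuous, strictly increasing, $\psi(0)=0$), $\partial\mathcal R(f^\dagger)\ne\emptyset$, and for every $f^*\in\partial\mathcal R(f^\dagger)$ the variational source condition $$\langle f^*,f^\dagger-f\rangle\le\tfrac12\Delta_{\mathcal R}(f,f^\dagger)+\psi\big(\|F_a(f^\dagger)-F_a(f)\|_{L^2}^2\big)\qquad\text{for all }f\in\mathcal D$$ holds, where $\Delta_{\mathcal R}(f,f^\dagger)=\mathcal R(f)-\mathcal R(f^\dagger)-\langle f^*,f-f^\dagger\rangle$. 2. Let $\delta>0$ and $g^{\rm obs}\in L^2(\mathbb T^d)$ with $\|g^{\rm obs}-F_a(f^\dagger)\|_{L^2}\le\delta$.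 For every $\alpha>0$ the Tikhonov functional $\frac12\|F_a(f)\|_{L^2}^2-\langle g^{\rm obs},F_a(f)\rangle+\alpha\mathcal R(f)$ has a minimizer over $\mathcal D$, which is unique if $F_a$ is linear (that is, the restriction to $\mathcal D$ of a linear map on $\mathcal X$). 3. For $\delta$, $g^{\rm obs}$ as in 2 there is an $\alpha>0$ with $-\frac1{4\alpha}\in\partial(-\psi)(4\delta^2)$ (where $-\psi:=+\infty$ on $(-\infty,0)$), and for every such $\alpha$ every minimizer $\hat f_\alpha$ satisfies $$\|\hat f_\alpha-f^\dagger\|_{B^0_{p,q},\mathcal W}\le\begin{cases}c'\,\varrho^{\frac a{a+s}}\delta^{\frac s{a+s}},&q\ge2,\\ c'\,\varrho^{\frac a{a+s(q-1)}}\delta^{\frac{s(q-1)}{a+s(q-1)}},&q\le2.\end{cases}$$ The constants $c,c'$ do not depend on $f^\dagger$, $\varrho$, $\delta$, $g^{\rm obs}$, $\alpha$, $\hat f_\alpha$. -/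

import Mathlib

open MeasureTheory

noncomputable section

namespace BesovTikhonov

/-! ### The sequence norms `ℓ^q` with values in `[0, ∞]` -/

/-- The `ℓ^q` norm of a family of elements of `[0, ∞]` (a supremum if `q = ∞`). -/
def ellNorm {ι : Type*} (q : ENNReal) (a : ι → ENNReal) : ENNReal :=
  if q = ⊤ then ⨆ i, a i else (∑' i, a i ^ q.toReal) ^ (1 / q.toReal)

theorem ellNorm_mono {ι : Type*} (q : ENNReal) {a b : ι → ENNReal} (h : ∀ i, a i ≤ b i) :
    ellNorm q a ≤ ellNorm q b := by
  unfold ellNorm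
  split_ifs
  · exact iSup_mono h
  · gcongr with i
    exact h i

theorem ellNorm_add_le {ι : Type*} {q : ENNReal} (hq : 1 ≤ q) (a b : ι → ENNReal) :
    ellNorm q (fun i => a i + b i) ≤ ellNorm q a + ellNorm q b := by
  unfold ellNorm
  split_ifs with h
  · exact iSup_le fun i => add_le_add (le_iSup a i) (le_iSup b i)
  · have hq' : 1 ≤ q.toReal := by
      have := (ENNReal.toReal_le_toReal ENNReal.one_ne_top h).2 hq
      simpa using this
    let _ : MeasurableSpace ι := ⊤
    have := ENNReal.lintegral_Lp_add_le (μ := Measure.count) (f := a) (g := b)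
      (measurable_from_top.aemeasurable) (measurable_from_top.aemeasurable) hq'
    simpa [lintegral_count] using this

theorem ellNorm_const_mul {ι : Type*} {q : ENNReal} (hq : 1 ≤ q) (c : ENNReal)
    (a : ι → ENNReal) : ellNorm q (fun i => c * a i) = c * ellNorm q a := by
  unfold ellNorm
  split_ifs with h
  · rw [ENNReal.mul_iSup]
  · have hq' : 1 ≤ q.toReal := by
      have := (ENNReal.toReal_le_toReal ENNReal.one_ne_top h).2 hq
      simpa using this
    have h0 : 0 < q.toReal := by linarith
    simp_rw [ENNReal.mul_rpow_of_nonneg _ _ h0.le]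
    rw [ENNReal.tsum_mul_left, ENNReal.mul_rpow_of_nonneg _ _ (by positivity),
      ← ENNReal.rpow_mul, mul_one_div_cancel h0.ne', ENNReal.rpow_one]

/-! ### The torus, test functions and distributions -/

/-- The normalized Haar measure on the torus `𝕋^d = ℝ^d / ℤ^d`. -/
abbrev torusMeasure (d : ℕ) : Measure (UnitAddTorus (Fin d)) :=
  Measure.pi fun _ => AddCircle.haarAddCircle

/-- The `ℤ^d`-periodic function on `ℝ^d` that belongs to a function on the torus. -/
def lift {d : ℕ} (φ : UnitAddTorus (Fin d) → ℝ) : (Fin d → ℝ) → ℝ :=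
  fun x => φ fun i => ((x i : ℝ) : UnitAddCircle)

/-- `C^σ(𝕋^d, ℝ)`. -/
def CSpace (d σ : ℕ) : Submodule ℝ (UnitAddTorus (Fin d) → ℝ) where
  carrier := {φ | ContDiff ℝ σ (lift φ)}
  add_mem' := fun {f g} (hf : ContDiff ℝ σ (lift f)) (hg : ContDiff ℝ σ (lift g)) => hf.add hg
  zero_mem' := (contDiff_const : ContDiff ℝ σ fun _ : Fin d → ℝ => (0 : ℝ))
  smul_mem' := fun c f (hf : ContDiff ℝ σ (lift f)) => hf.const_smul c

/-- `M` bounds the norm of `φ` in `C^σ(𝕋^d)`, i.e. all derivatives of order at most `σ`. -/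
def CBound {d σ : ℕ} (φ : CSpace d σ) (M : ℝ) : Prop :=
  ∀ k ≤ σ, ∀ x, ‖iteratedFDeriv ℝ k (lift φ.1) x‖ ≤ M

/-- The bounded linear functionals on `C^σ(𝕋^d, ℝ)`. -/
def distrSubmodule (d σ : ℕ) : Submodule ℝ (CSpace d σ →ₗ[ℝ] ℝ) where
  carrier := {u | ∃ C : ℝ, ∀ φ M, CBound φ M → |u φ| ≤ C * M}
  add_mem' := by
    rintro u v ⟨C, hC⟩ ⟨C', hC'⟩
    refine ⟨C + C', fun φ M h => ?_⟩
    calc |(u + v) φ| ≤ |u φ| + |v φ| := abs_add_le _ _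
      _ ≤ C * M + C' * M := add_le_add (hC φ M h) (hC' φ M h)
      _ = (C + C') * M := by ring
  zero_mem' := ⟨0, fun φ M _ => by simp⟩
  smul_mem' := by
    rintro c u ⟨C, hC⟩
    refine ⟨|c| * C, fun φ M h => ?_⟩
    calc |(c • u) φ| = |c| * |u φ| := by simp [abs_mul]
      _ ≤ |c| * (C * M) := mul_le_mul_of_nonneg_left (hC φ M h) (abs_nonneg c)
      _ = |c| * C * M := by ring

/-- The space `C^σ(𝕋^d, ℝ)'` of bounded linear functionals on `C^σ(𝕋^d, ℝ)`: the real
distributions on the torus of order at most `σ`. It contains all real elements of `B^s_{p,q}(𝕋^d)`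
with `|s| < σ`. -/
def Distr (d σ : ℕ) : Type := distrSubmodule d σ

instance (d σ : ℕ) : AddCommGroup (Distr d σ) := inferInstanceAs (AddCommGroup (distrSubmodule d σ))

instance (d σ : ℕ) : Module ℝ (Distr d σ) := inferInstanceAs (Module ℝ (distrSubmodule d σ))

/-- The value `u(φ)` of the distribution `u` at the test function `φ`. -/
def Distr.eval {d σ : ℕ} (u : Distr d σ) (φ : CSpace d σ) : ℝ :=
  (distrSubmodule d σ).subtype u φ

theorem Distr.eval_add {d σ : ℕ} (u v : Distr d σ) (φ : CSpace d σ) :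
    (u + v).eval φ = u.eval φ + v.eval φ := rfl

theorem Distr.eval_smul {d σ : ℕ} (c : ℝ) (u : Distr d σ) (φ : CSpace d σ) :
    (c • u).eval φ = c * u.eval φ := rfl

theorem contDiff_lift_mFourier {d : ℕ} (n : WithTop ℕ∞) (z : Fin d → ℤ) :
    ContDiff ℝ n fun x : Fin d → ℝ =>
      UnitAddTorus.mFourier z fun i => ((x i : ℝ) : UnitAddCircle) := by
  simp only [UnitAddTorus.mFourier, ContinuousMap.coe_mk, fourier_coe_apply]
  refine contDiff_prod fun i _ => ContDiff.cexp ?_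
  have h : ContDiff ℝ n fun x : Fin d → ℝ => ((x i : ℝ) : ℂ) :=
    Complex.ofRealCLM.contDiff.comp (contDiff_apply ℝ ℝ i)
  exact (contDiff_const.mul h).div_const _

/-- The function `cos (2π z·x)` on the torus. -/
def cosMode {d : ℕ} (σ : ℕ) (z : Fin d → ℤ) : CSpace d σ :=
  ⟨fun x => (UnitAddTorus.mFourier z x).re,
    Complex.reCLM.contDiff.comp (contDiff_lift_mFourier σ z)⟩

/-- The function `sin (2π z·x)` on the torus. -/
def sinMode {d : ℕ} (σ : ℕ) (z : Fin d → ℤ) : CSpace d σ :=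
  ⟨fun x => (UnitAddTorus.mFourier z x).im,
    Complex.imCLM.contDiff.comp (contDiff_lift_mFourier σ z)⟩

/-- The Fourier coefficient `u(x ↦ exp(-2πi z·x))` of a real distribution `u`. -/
def coeff {d σ : ℕ} (u : Distr d σ) (z : Fin d → ℤ) : ℂ :=
  ⟨u.eval (cosMode σ z), -u.eval (sinMode σ z)⟩

/-! ### Besov norms through Fourier coefficients -/

/-- The dyadic resolution of unity: `χ_0` is the characteristic function of the cube
`{|x|_∞ ≤ 1}` and `χ_j(x) = χ_0(2^{-j} x) - χ_0(2^{-j+1} x)` for `j ≥ 1`. -/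
def chi {d : ℕ} : ℕ → (Fin d → ℝ) → ℝ
  | 0, x => if ‖x‖ ≤ 1 then 1 else 0
  | j + 1, x => (if ‖((2 : ℝ) ^ (j + 1))⁻¹ • x‖ ≤ 1 then 1 else 0)
      - (if ‖((2 : ℝ) ^ j)⁻¹ • x‖ ≤ 1 then 1 else 0)

open scoped Classical in
/-- The set of frequencies `{z ∈ ℤ^d : χ_j(2πz) = 1}`. -/
def freqBlock (d j : ℕ) : Finset (Fin d → ℤ) :=
  (Fintype.piFinset fun _ => Finset.Icc (-(2 : ℤ) ^ j) (2 ^ j)).filter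
    fun z => chi j (fun i => 2 * Real.pi * (z i : ℝ)) = 1

theorem mem_freqBlock {d j : ℕ} {z : Fin d → ℤ} :
    z ∈ freqBlock d j ↔ chi j (fun i => 2 * Real.pi * (z i : ℝ)) = 1 := by
  classical
  simp only [freqBlock, Finset.mem_filter, and_iff_right_iff_imp]
  intro h
  have key : ‖((2 : ℝ) ^ j)⁻¹ • fun i => 2 * Real.pi * (z i : ℝ)‖ ≤ 1 := by
    cases j with
    | zero =>
      by_contra hc
      simp only [pow_zero, inv_one, one_smul] at hc
      simp [chi, hc] at h
    | succ j =>
      by_contra hc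
      simp only [chi, if_neg hc] at h
      split_ifs at h <;> norm_num at h
  rw [Fintype.mem_piFinset]
  intro i
  have h1 := (norm_le_pi_norm _ i).trans key
  have hpos : (0 : ℝ) < 2 ^ j := by positivity
  simp only [Pi.smul_apply, smul_eq_mul, norm_mul, norm_inv, norm_pow, Real.norm_eq_abs,
    abs_of_pos Real.pi_pos, abs_two] at h1
  rw [inv_mul_le_iff₀ hpos, mul_one] at h1
  have h2 : |(z i : ℝ)| ≤ 2 ^ j := by
    nlinarith [abs_nonneg (z i : ℝ), Real.pi_gt_three]
  have h3 : |z i| ≤ 2 ^ j := by exact_mod_cast h2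
  rw [Finset.mem_Icc]
  exact abs_le.1 h3

/-- The norm of `B^s_{p,q}(𝕋^d)`, for `1 < p < ∞` and `1 ≤ q ≤ ∞`, of the distribution with
Fourier coefficients `c`: the `ℓ^q` norm over `j` of
`2^{js} ‖∑_{z : χ_j(2πz) = 1} c_z exp(2πi z·x)‖_{L^p(𝕋^d)}`. -/
def besovNorm {d : ℕ} (s p : ℝ) (q : ENNReal) (c : (Fin d → ℤ) → ℂ) : ENNReal :=
  ellNorm q fun j : ℕ => ENNReal.ofReal ((2 : ℝ) ^ ((j : ℝ) * s)) *
    eLpNorm (fun x => ∑ z ∈ freqBlock d j, c z * UnitAddTorus.mFourier z x)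
      (ENNReal.ofReal p) (torusMeasure d)

/-! ### Wavelet systems -/

/-- The wavelet norm of a double sequence: the `ℓ^q` norm over `j` of
`2^{js} 2^{jd(1/2-1/p)} ‖λ_{j,·}‖_{ℓ^p}`. -/
def waveletSeqNorm (d : ℕ) {I : ℕ → Type} (s p : ℝ) (q : ENNReal) (lam : (j : ℕ) → I j → ℝ) :
    ENNReal :=
  ellNorm q fun j : ℕ =>
    ENNReal.ofReal ((2 : ℝ) ^ ((j : ℝ) * s) * (2 : ℝ) ^ ((j : ℝ) * d * (1 / 2 - 1 / p))) *
      ellNorm (ENNReal.ofReal p) fun l => ‖lam j l‖ₑ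

/-- A wavelet system of smoothness `σ` on `𝕋^d`: an orthonormal system of `C^σ` functions
`φ_{j,l}`, `l ∈ I_j` countable, such that `u` belongs to `B^s_{p,q}` if and only if the wavelet norm
of the coefficients `u(φ_{j,l})` is finite, with equivalent norms, for `|s| < σ`. -/
structure WaveletSystem (d σ : ℕ) where
  /-- the index sets -/
  I : ℕ → Type
  countable_I : ∀ j, Countable (I j)
  /-- the wavelets -/
  φ : (j : ℕ) → I j → CSpace d σ
  norm_one : ∀ j l, ∫ x, (φ j l).1 x ^ 2 ∂(torusMeasure d) = 1
  orthogonal : ∀ j l j' l', (⟨j, l⟩ : Σ j, I j) ≠ ⟨j', l'⟩ →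
    ∫ x, (φ j l).1 x * (φ j' l').1 x ∂(torusMeasure d) = 0
  norm_equiv : ∀ (s p : ℝ) (q : ENNReal), |s| < σ → 1 < p → 1 ≤ q → ∃ C : ℝ, 0 < C ∧
    ∀ u : Distr d σ,
      waveletSeqNorm d s p q (fun j l => u.eval (φ j l)) ≤
        ENNReal.ofReal C * besovNorm s p q (coeff u) ∧
      besovNorm s p q (coeff u) ≤
        ENNReal.ofReal C * waveletSeqNorm d s p q (fun j l => u.eval (φ j l))

/-- The norm `‖u‖_{B^s_{p,q}, 𝒲}` given by the wavelet coefficients. -/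
def WaveletSystem.norm {d σ : ℕ} (W : WaveletSystem d σ) (s p : ℝ) (q : ENNReal)
    (u : Distr d σ) : ENNReal :=
  waveletSeqNorm d s p q fun j l => u.eval (W.φ j l)

theorem WaveletSystem.norm_add_le {d σ : ℕ} (W : WaveletSystem d σ) (s : ℝ) {p : ℝ} {q : ENNReal}
    (hp : 1 ≤ p) (hq : 1 ≤ q) (u v : Distr d σ) :
    W.norm s p q (u + v) ≤ W.norm s p q u + W.norm s p q v := by
  have hp' : 1 ≤ ENNReal.ofReal p := by simpa using hp
  refine le_trans (ellNorm_mono q fun j => ?_) (ellNorm_add_le hq _ _)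
  rw [← mul_add]
  gcongr
  refine le_trans (ellNorm_mono _ fun l => ?_) (ellNorm_add_le hp' _ _)
  simpa [Distr.eval_add] using enorm_add_le (u.eval (W.φ j l)) (v.eval (W.φ j l))

theorem WaveletSystem.norm_smul {d σ : ℕ} (W : WaveletSystem d σ) (s : ℝ) {p : ℝ} {q : ENNReal}
    (hp : 1 ≤ p) (hq : 1 ≤ q) (c : ℝ) (u : Distr d σ) :
    W.norm s p q (c • u) = ‖c‖ₑ * W.norm s p q u := by
  have hp' : 1 ≤ ENNReal.ofReal p := by simpa using hp
  unfold WaveletSystem.norm waveletSeqNorm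
  rw [← ellNorm_const_mul hq]
  congr 1
  funext j
  rw [mul_left_comm]
  congr 1
  rw [← ellNorm_const_mul hp']
  congr 1
  funext l
  simp [Distr.eval_smul, enorm_mul]

/-- The real distributions in `B^0_{p,q}(𝕋^d)`, as a vector space. -/
def besovSubmodule {d σ : ℕ} (W : WaveletSystem d σ) (p q : ℝ) [hp : Fact (1 < p)]
    [hq : Fact (1 < q)] : Submodule ℝ (Distr d σ) where
  carrier := {u | W.norm 0 p (ENNReal.ofReal q) u < ⊤}
  add_mem' := fun {u v} hu hv =>
    (W.norm_add_le 0 hp.out.le (by simpa using hq.out.le) u v).trans_lt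
      (ENNReal.add_lt_top.2 ⟨hu, hv⟩)
  zero_mem' := by
    have h := W.norm_smul 0 hp.out.le (q := ENNReal.ofReal q) (by simpa using hq.out.le) 0 0
    rw [zero_smul, enorm_zero, zero_mul] at h
    simp [h]
  smul_mem' := fun c u hu => by
    change W.norm 0 p (ENNReal.ofReal q) (c • u) < ⊤
    rw [W.norm_smul 0 hp.out.le (by simpa using hq.out.le)]
    exact ENNReal.mul_lt_top enorm_lt_top hu

/-- The space `𝒳 = B^0_{p,q}(𝕋^d)`, normed by `‖·‖_{B^0_{p,q}, 𝒲}`. -/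
def XSpace {d σ : ℕ} (W : WaveletSystem d σ) (p q : ℝ) [Fact (1 < p)] [Fact (1 < q)] : Type :=
  besovSubmodule W p q

section XSpace

variable {d σ : ℕ} (W : WaveletSystem d σ) (p q : ℝ) [hp : Fact (1 < p)] [hq : Fact (1 < q)]

instance : AddCommGroup (XSpace W p q) := inferInstanceAs (AddCommGroup (besovSubmodule W p q))

instance : Module ℝ (XSpace W p q) := inferInstanceAs (Module ℝ (besovSubmodule W p q))

/-- The inclusion of `B^0_{p,q}` into the distributions. -/
def XSpace.toDistr : XSpace W p q →ₗ[ℝ] Distr d σ := (besovSubmodule W p q).subtype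

instance : Norm (XSpace W p q) :=
  ⟨fun f => (W.norm 0 p (ENNReal.ofReal q) (XSpace.toDistr W p q f)).toReal⟩

theorem XSpace.core : SeminormedSpace.Core ℝ (XSpace W p q) where
  norm_nonneg _ := ENNReal.toReal_nonneg
  norm_smul c f := by
    change (W.norm 0 p (ENNReal.ofReal q) (XSpace.toDistr W p q (c • f))).toReal = _
    rw [map_smul, W.norm_smul 0 hp.out.le (by simpa using hq.out.le), ENNReal.toReal_mul]
    simp only [toReal_enorm]
    rfl
  norm_triangle f g := by
    have hf : W.norm 0 p (ENNReal.ofReal q) (XSpace.toDistr W p q f) < ⊤ := f.2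
    have hg : W.norm 0 p (ENNReal.ofReal q) (XSpace.toDistr W p q g) < ⊤ := g.2
    have h := W.norm_add_le 0 hp.out.le (q := ENNReal.ofReal q) (by simpa using hq.out.le)
      (XSpace.toDistr W p q f) (XSpace.toDistr W p q g)
    rw [← map_add] at h
    refine (ENNReal.toReal_mono (ENNReal.add_lt_top.2 ⟨hf, hg⟩).ne h).trans ?_
    rw [ENNReal.toReal_add hf.ne hg.ne]
    exact le_rfl

instance : SeminormedAddCommGroup (XSpace W p q) :=
  SeminormedAddCommGroup.ofCore (XSpace.core W p q)

instance : NormedSpace ℝ (XSpace W p q) := ⟨fun c f => ((XSpace.core W p q).norm_smul c f).le⟩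

end XSpace

/-- The Fourier coefficients of an element of `B^0_{p,q}(𝕋^d)`. -/
def XSpace.coeff {d σ : ℕ} {W : WaveletSystem d σ} {p q : ℝ} [Fact (1 < p)] [Fact (1 < q)]
    (f : XSpace W p q) : (Fin d → ℤ) → ℂ :=
  BesovTikhonov.coeff (XSpace.toDistr W p q f)

/-! ### Forward operators -/

/-- The space `𝒴 = L²(𝕋^d)`. -/
abbrev YSpace (d : ℕ) : Type := Lp ℝ 2 (torusMeasure d)

/-- The Fourier coefficients of an element of `L²(𝕋^d)`. -/
def YSpace.coeff {d : ℕ} (g : YSpace d) (z : Fin d → ℤ) : ℂ :=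
  ∫ x, (g x : ℂ) * UnitAddTorus.mFourier (-z) x ∂(torusMeasure d)

/-- `F` is `a`-times smoothing on `D ⊆ B^0_{p,q}(𝕋^d)` with constant `L`. -/
structure IsSmoothing {d σ : ℕ} {W : WaveletSystem d σ} {p q : ℝ} [Fact (1 < p)] [Fact (1 < q)]
    (a L : ℝ) (D : Set (XSpace W p q)) (F : XSpace W p q → YSpace d) : Prop where
  lipschitz_besov : ∀ f₁ ∈ D, ∀ f₂ ∈ D,
    besovNorm a p (ENNReal.ofReal q) (YSpace.coeff (F f₁ - F f₂)) ≤
      ENNReal.ofReal L * besovNorm 0 p (ENNReal.ofReal q) (XSpace.coeff (f₁ - f₂))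
  lipschitz_L2 : ∀ f₁ ∈ D, ∀ f₂ ∈ D,
    ‖F f₁ - F f₂‖ₑ ≤ ENNReal.ofReal L * besovNorm (-a) 2 2 (XSpace.coeff (f₁ - f₂))
  inverse_lipschitz : ∀ f₁ ∈ D, ∀ f₂ ∈ D,
    besovNorm (-a) 2 2 (XSpace.coeff (f₁ - f₂)) ≤ ENNReal.ofReal L * ‖F f₁ - F f₂‖ₑ

/-! ### Tikhonov regularization and variational source conditions -/

/-- The penalty `R(f) = (1/r) ‖f‖^r`. -/
def penalty {X : Type*} [SeminormedAddCommGroup X] (r : ℝ) (f : X) : ℝ := 1 / r * ‖f‖ ^ r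

/-- The subdifferential of `R` at `f₀`, as a subset of the dual space. -/
def subdiff {X : Type*} [SeminormedAddCommGroup X] [NormedSpace ℝ X] (R : X → ℝ) (f₀ : X) :
    Set (StrongDual ℝ X) :=
  {fs | ∀ f, R f₀ + fs (f - f₀) ≤ R f}

/-- The Bregman distance `Δ_R(f, f₀) = R(f) - R(f₀) - ⟨fs, f - f₀⟩`. -/
def bregman {X : Type*} [SeminormedAddCommGroup X] [NormedSpace ℝ X] (R : X → ℝ)
    (fs : StrongDual ℝ X) (f f₀ : X) : ℝ :=
  R f - R f₀ - fs (f - f₀)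

/-- Concave index functions on `[0, ∞)`. -/
structure IsConcaveIndexFunction (ψ : ℝ → ℝ) : Prop where
  concave : ConcaveOn ℝ (Set.Ici 0) ψ
  continuous : ContinuousOn ψ (Set.Ici 0)
  increasing : StrictMonoOn ψ (Set.Ici 0)
  zero : ψ 0 = 0

/-- The variational source condition (for the quadratic data fidelity term) with index function
`ψ` at `f₀`, with the subgradient `fs`. -/
structure VSC {X Y : Type*} [SeminormedAddCommGroup X] [NormedSpace ℝ X] [NormedAddCommGroup Y]
    (D : Set X) (F : X → Y) (R : X → ℝ) (f₀ : X) (fs : StrongDual ℝ X) (ψ : ℝ → ℝ) : Prop where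
  index : IsConcaveIndexFunction ψ
  bound : ∀ f ∈ D, fs (f₀ - f) ≤ 1 / 2 * bregman R fs f f₀ + ψ (‖F f₀ - F f‖ ^ 2)

/-- The Tikhonov functional `½ ‖F(f)‖² - ⟨g, F(f)⟩ + α R(f)`. -/
def tikhonov {X Y : Type*} [NormedAddCommGroup Y] [InnerProductSpace ℝ Y]
    (F : X → Y) (R : X → ℝ) (g : Y) (α : ℝ) (f : X) : ℝ :=
  1 / 2 * ‖F f‖ ^ 2 - inner ℝ g (F f) + α * R f

/-- `f` is a (global) minimizer over `D` of the Tikhonov functional. -/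
def IsTikhonovMinimizer {X Y : Type*} [NormedAddCommGroup Y] [InnerProductSpace ℝ Y]
    (D : Set X) (F : X → Y) (R : X → ℝ) (g : Y) (α : ℝ) (f : X) : Prop :=
  f ∈ D ∧ IsMinOn (tikhonov F R g α) D f

/-- The a-priori rule `-1/(2 Cerr α) ∈ ∂(-ψ)(2 Cerr err)` for `α > 0`, where `-ψ` is extended by
`+∞` to negative arguments, with `Cerr = 2` and `err = δ²`: the choices for deterministic
noise of level `δ` and the quadratic data fidelity term. -/
def IsAPrioriChoice (ψ : ℝ → ℝ) (δ α : ℝ) : Prop :=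
  0 < α ∧ ∀ u, 0 ≤ u →
    -ψ (2 * 2 * δ ^ 2) + -1 / (2 * 2 * α) * (u - 2 * 2 * δ ^ 2) ≤ -ψ u

/-- The exponent of `ϱ` in the index function. -/
def expNu (a s q : ℝ) : ℝ := if 2 ≤ q then q * a / (a + s) else 2 * a / (a + s * (q - 1))

/-- The exponent of `τ` in the index function. -/
def expMu (a s q : ℝ) : ℝ :=
  if 2 ≤ q then q / 2 * (s / (a + s)) else s * (q - 1) / (a + s * (q - 1))

/-- The index function `ψ(τ) = c ϱ^ν τ^μ`. -/
def indexFun (a s q c ϱ : ℝ) (τ : ℝ) : ℝ := c * ϱ ^ expNu a s q * τ ^ expMu a s q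

/-- The rate `ϱ^{a/(a+s)} δ^{s/(a+s)}` for `q ≥ 2`, and
`ϱ^{a/(a+s(q-1))} δ^{s(q-1)/(a+s(q-1))}` for `q ≤ 2`. -/
def rate (a s q ϱ δ : ℝ) : ℝ :=
  if 2 ≤ q then ϱ ^ (a / (a + s)) * δ ^ (s / (a + s))
  else ϱ ^ (a / (a + s * (q - 1))) * δ ^ (s * (q - 1) / (a + s * (q - 1)))

end BesovTikhonov

end

noncomputable section

open Filter Topology

namespace BesovTikhonov

/-! ### Derivatives of periodic functions as functions on the torus -/

/-! Put h = f† − f and r = max{2, q}, which is max{2, p, q} because p ≤ 2. Let A_j and H_j be the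
weighted ℓ^p norms of the level-j wavelet coefficients of f† and h; the norm of 𝒳 is the ℓ^q norm of
such blocks. One-sided difference quotients of the penalty give ⟨f*, h⟩ ≤ ‖f†‖^(r−q) ∑ A_j^(q−1) H_j
for every subgradient f* at f†, with no differentiability needed;
`IsBlockDecomposition.subgradient_le` states this already split at a level J, with Hölder's
inequality applied to the tail.

Smoothness of f† gives A_j ≲ ϱ 2^(−js), and the inverse Lipschitz bound gives H_j ≲ 2^(ja) G with G
= ‖F(f†) − F(f)‖. Cut at 2^(−J) ≈ ε. Since s(q−1) < a, the low levels form an increasing geometric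
sum dominated by ε^(s(q−1)−a) G, while the high levels contribute ε^(s(q−1)) ‖h‖
(`IsBlockDecomposition.exists_subgradient_le`). Young's inequality splits the second term into a
small multiple of ‖h‖^r and a power of ε, and ε is chosen to balance the rest
(`IsBlockDecomposition.exists_vsc_bound`).

The term ‖h‖^r is absorbed by half the Bregman distance because R is uniformly convex of power type
r (`XSpace.norm_convex`, `IsUniformlyConvex.le_bregman`). This convexity starts from the
parallelogram identity for each coefficient and is carried through the inner ℓ^p and the outer ℓ^q
norm by a two-point inequality. The rate then follows from minimality, the source condition and the
tangent inequality encoded in the parameter rule (`VSC.bregman_le`), again with uniform convexity.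

Minimizers exist since bounded sequences of 𝒳 are precompact in B^{-a}_{2,2}
(`XSpace.exists_subseq_cauchy`), a norm that controls F. Weak compactness is replaced by uniform
convexity: almost minimal elements of the convex hulls of the tails converge in norm
(`IsUniformlyConvex.exists_limit`). This requires 𝒳 to be complete, and uniqueness requires its
seminorm to be definite. Both rest on |u(φ)| ≲ ‖u‖ ‖φ‖_{C^σ} for all test functions φ, although the
norm of 𝒳 sees only the wavelets. That bound holds because ‖·‖ dominates the B^{-a}_{2,2} norm, the
Fourier blocks of φ decay like 2^(−jσ) with a < σ, and trigonometric polynomials are dense in C^σ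
(`exists_abs_eval_le`). -/

/-- The projection `ℝ^d → 𝕋^d`. -/
def proj {d : ℕ} (x : Fin d → ℝ) : UnitAddTorus (Fin d) := fun i => (x i : UnitAddCircle)

theorem isOpenQuotientMap_proj {d : ℕ} : IsOpenQuotientMap (proj (d := d)) :=
  IsOpenQuotientMap.piMap fun _ => QuotientAddGroup.isOpenQuotientMap_mk

theorem proj_add {d : ℕ} (x y : Fin d → ℝ) : proj (x + y) = proj x + proj y := rfl

theorem proj_zero {d : ℕ} : proj (0 : Fin d → ℝ) = 0 := rfl

theorem continuous_proj {d : ℕ} : Continuous (proj (d := d)) := isOpenQuotientMap_proj.continuous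

theorem integrable_torus {d : ℕ} {E : Type*} [NormedAddCommGroup E]
    {f : UnitAddTorus (Fin d) → E} (hf : Continuous f) : Integrable f (torusMeasure d) :=
  hf.integrable_of_hasCompactSupport (HasCompactSupport.of_compactSpace f)

theorem iteratedFDeriv_lift_periodic {d : ℕ} (φ : UnitAddTorus (Fin d) → ℝ) (k : ℕ)
    {x y : Fin d → ℝ} (h : proj x = proj y) :
    iteratedFDeriv ℝ k (lift φ) x = iteratedFDeriv ℝ k (lift φ) y := by
  have h1 : (fun w => lift φ (w + (x - y))) = lift φ := by
    funext w
    have h0 : proj (x - y) = 0 := by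
      have : proj (x - y) + proj y = proj y := by rw [← proj_add, sub_add_cancel, h]
      simpa using this
    change φ (proj (w + (x - y))) = φ (proj w)
    rw [proj_add, h0, add_zero]
  have h2 := iteratedFDeriv_comp_add_right (𝕜 := ℝ) (f := lift φ) k (x - y) y
  rw [h1, add_sub_cancel] at h2
  exact h2.symm

/-- The `k`-th derivative of `φ ∈ C^σ(𝕋^d)` as a continuous function on the torus. -/
def torusDeriv {d σ : ℕ} (φ : CSpace d σ) {k : ℕ} (hk : k ≤ σ) :
    C(UnitAddTorus (Fin d), (Fin d → ℝ) [×k]→L[ℝ] ℝ) where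
  toFun y := iteratedFDeriv ℝ k (lift φ.1) (Function.surjInv isOpenQuotientMap_proj.surjective y)
  continuous_toFun := by
    rw [isOpenQuotientMap_proj.isQuotientMap.continuous_iff]
    have h : Continuous (iteratedFDeriv ℝ k (lift φ.1)) :=
      ContDiff.continuous_iteratedFDeriv (n := σ) (by exact_mod_cast hk)
        (φ.2 : ContDiff ℝ σ (lift φ.1))
    convert! h using 1
    funext x
    exact iteratedFDeriv_lift_periodic _ _
      (Function.surjInv_eq isOpenQuotientMap_proj.surjective _)

theorem torusDeriv_proj {d σ : ℕ} (φ : CSpace d σ) {k : ℕ} (hk : k ≤ σ) (x : Fin d → ℝ) :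
    torusDeriv φ hk (proj x) = iteratedFDeriv ℝ k (lift φ.1) x :=
  iteratedFDeriv_lift_periodic _ _ (Function.surjInv_eq isOpenQuotientMap_proj.surjective _)

theorem norm_torusDeriv_le {d σ : ℕ} {φ : CSpace d σ} {M : ℝ} (hM : CBound φ M) {k : ℕ}
    (hk : k ≤ σ) (y : UnitAddTorus (Fin d)) : ‖torusDeriv φ hk y‖ ≤ M := by
  obtain ⟨x, rfl⟩ := isOpenQuotientMap_proj.surjective y
  rw [torusDeriv_proj]
  exact hM k hk x

theorem hasFDerivAt_torusDeriv {d σ : ℕ} (φ : CSpace d σ) {k : ℕ} (hk : k + 1 ≤ σ)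
    (x : Fin d → ℝ) :
    HasFDerivAt (fun x => torusDeriv φ ((Nat.le_succ k).trans hk) (proj x))
      (torusDeriv φ hk (proj x)).curryLeft x := by
  simp only [torusDeriv_proj]
  have h : ContDiff ℝ σ (lift φ.1) := φ.2
  have h2 := (contDiff_iff_ftaylorSeries (n := (σ : ℕ∞))).1 (by exact_mod_cast h)
  exact h2.fderiv k (by exact_mod_cast hk) x

/-- Differentiation of a convolution on the torus. -/
theorem hasFDerivAt_integral_smul_translate {d : ℕ} {𝕜 V : Type*} [RCLike 𝕜]
    [NormedAddCommGroup V] [NormedSpace ℝ V] [NormedSpace 𝕜 V] [SMulCommClass ℝ 𝕜 V]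
    (K : C(UnitAddTorus (Fin d), 𝕜)) (Q : C(UnitAddTorus (Fin d), V))
    (Q' : C(UnitAddTorus (Fin d), (Fin d → ℝ) →L[ℝ] V))
    (hQ : ∀ x, HasFDerivAt (fun x => Q (proj x)) (Q' (proj x)) x) (x : Fin d → ℝ) :
    HasFDerivAt (fun x => ∫ y, K y • Q (proj x + y) ∂(torusMeasure d))
      (∫ y, K y • Q' (proj x + y) ∂(torusMeasure d)) x := by
  have hc : ∀ x : Fin d → ℝ, Continuous fun y => K y • Q (proj x + y) := fun x => by fun_prop
  have hc' : ∀ x : Fin d → ℝ, Continuous fun y => K y • Q' (proj x + y) := fun x => by fun_prop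
  refine hasFDerivAt_integral_of_dominated_of_fderiv_le (𝕜 := ℝ)
    (F := fun x y => K y • Q (proj x + y)) (F' := fun x y => K y • Q' (proj x + y))
    (bound := fun _ => ‖K‖ * ‖Q'‖) Filter.univ_mem ?_ ?_ ?_ ?_ ?_ ?_
  · exact Filter.Eventually.of_forall fun x => (hc x).aestronglyMeasurable
  · exact integrable_torus (hc x)
  · exact (hc' x).aestronglyMeasurable
  · refine Filter.Eventually.of_forall fun y x _ =>
      ContinuousLinearMap.opNorm_le_bound _ (by positivity) fun v => ?_
    rw [smul_apply, norm_smul, mul_assoc]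
    gcongr
    · exact K.norm_coe_le_norm y
    · exact (Q' (proj x + y)).le_of_opNorm_le (Q'.norm_coe_le_norm _) v
  · exact integrable_const _
  · refine Filter.Eventually.of_forall fun y x _ => ?_
    -- Lifting y to `w` turns the translate into an ordinary shift by `w` on ℝ^d.
    obtain ⟨w, rfl⟩ := isOpenQuotientMap_proj.surjective y
    have := (hQ (x + w)).comp x ((hasFDerivAt_id x).add_const w)
    simpa [proj_add, Function.comp_def] using! this.const_smul (K (proj w))

/-! ### Fourier coefficients of test functions -/

/-- The Fourier coefficient of a continuous complex function on the torus. -/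
def fourierCoef {d : ℕ} (Q : UnitAddTorus (Fin d) → ℂ) (z : Fin d → ℤ) : ℂ :=
  ∫ y, UnitAddTorus.mFourier (-z) y * Q y ∂(torusMeasure d)

/-- Substitute y − x for y, by invariance of Haar measure, and use that characters are
multiplicative. -/
theorem integral_mFourier_mul_translate {d : ℕ} (Q : UnitAddTorus (Fin d) → ℂ) (z : Fin d → ℤ)
    (x : UnitAddTorus (Fin d)) :
    ∫ y, UnitAddTorus.mFourier (-z) y * Q (x + y) ∂(torusMeasure d) =
      UnitAddTorus.mFourier z x * fourierCoef Q z := by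
  rw [← integral_add_left_eq_self _ (-x), fourierCoef, ← integral_const_mul]
  refine integral_congr_ae (Filter.Eventually.of_forall fun y => ?_)
  have h : UnitAddTorus.mFourier (-z) (-x + y) =
      UnitAddTorus.mFourier z x * UnitAddTorus.mFourier (-z) y := by
    simp only [UnitAddTorus.mFourier, ContinuousMap.coe_mk, ← Finset.prod_mul_distrib,
      Pi.add_apply, Pi.neg_apply]
    refine Finset.prod_congr rfl fun i _ => ?_
    simp [fourier_apply, AddCircle.toCircle_add]
  simp only [h, add_neg_cancel_left]
  ring

theorem hasDerivAt_mFourier_proj {d : ℕ} (z : Fin d → ℤ) (i : Fin d) :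
    HasDerivAt (fun t : ℝ => UnitAddTorus.mFourier z (proj (t • Pi.single i (1 : ℝ))))
      (2 * Real.pi * Complex.I * z i) 0 := by
  have h : (fun t : ℝ => UnitAddTorus.mFourier z (proj (t • Pi.single i (1 : ℝ)))) =
      fun t : ℝ => fourier (z i) (t : UnitAddCircle) := by
    funext t
    simp only [UnitAddTorus.mFourier, ContinuousMap.coe_mk, proj]
    rw [Finset.prod_eq_single i]
    · simp
    · intro j _ hj
      simp [hj]
    · simp
  rw [h]
  have := hasDerivAt_fourier 1 (z i) 0
  simpa using this

/-- A substitute for integration by parts: the convolution of Q with a character is differentiated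
along a coordinate in two ways, under the integral sign and through its explicit form as a character
times a Fourier coefficient. -/
theorem fourierCoef_deriv {d : ℕ} (Q : C(UnitAddTorus (Fin d), ℂ))
    (Q' : C(UnitAddTorus (Fin d), (Fin d → ℝ) →L[ℝ] ℂ))
    (hQ : ∀ x, HasFDerivAt (fun x => Q (proj x)) (Q' (proj x)) x) (z : Fin d → ℤ) (i : Fin d) :
    fourierCoef (fun y => Q' y (Pi.single i 1)) z =
      2 * Real.pi * Complex.I * z i * fourierCoef Q z := by
  have h1 := hasFDerivAt_integral_smul_translate (UnitAddTorus.mFourier (-z)) Q Q' hQ 0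
  have h2 : HasDerivAt (fun t : ℝ => t • Pi.single i (1 : ℝ)) (Pi.single i (1 : ℝ) : Fin d → ℝ)
      0 := by
    simpa using (hasDerivAt_id (0 : ℝ)).smul_const (Pi.single i (1 : ℝ) : Fin d → ℝ)
  have h3 := HasFDerivAt.comp_hasDerivAt_of_eq (0 : ℝ) h1 h2 (by simp)
  have h4 := (hasDerivAt_mFourier_proj z i).mul_const (fourierCoef Q z)
  have h5 : (fun t : ℝ => UnitAddTorus.mFourier z (proj (t • Pi.single i (1 : ℝ))) *
      fourierCoef Q z) = (fun x => ∫ y, UnitAddTorus.mFourier (-z) y • Q (proj x + y)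
        ∂(torusMeasure d)) ∘ fun t : ℝ => t • Pi.single i (1 : ℝ) := by
    funext t
    simp only [Function.comp, smul_eq_mul]
    rw [integral_mFourier_mul_translate]
  rw [h5] at h4
  rw [h4.unique h3, ContinuousLinearMap.integral_apply]
  · simp [fourierCoef, proj_zero]
  · exact integrable_torus (by fun_prop)

/-- Iterated partial derivatives of a test function along a coordinate, complex valued. -/
def partialDeriv {d σ : ℕ} (φ : CSpace d σ) (i : Fin d) {k : ℕ} (hk : k ≤ σ) :
    C(UnitAddTorus (Fin d), ℂ) where
  toFun y := (torusDeriv φ hk y (fun _ => Pi.single i 1) : ℝ)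
  continuous_toFun := by
    have h : Continuous fun y => torusDeriv φ hk y := (torusDeriv φ hk).continuous
    exact Complex.continuous_ofReal.comp
      ((ContinuousMultilinearMap.apply ℝ (fun _ : Fin k => Fin d → ℝ) ℝ
        (fun _ => Pi.single i 1)).continuous.comp h)

theorem fourierCoef_partialDeriv {d σ : ℕ} (φ : CSpace d σ) (i : Fin d) (z : Fin d → ℤ) {k : ℕ}
    (hk : k ≤ σ) : fourierCoef (partialDeriv φ i hk) z =
      (2 * Real.pi * Complex.I * z i) ^ k * fourierCoef (fun y => (φ.1 y : ℂ)) z := by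
  induction k with
  | zero =>
    rw [pow_zero, one_mul]
    congr 1
    funext y
    obtain ⟨x, rfl⟩ := isOpenQuotientMap_proj.surjective y
    simp only [partialDeriv, ContinuousMap.coe_mk, torusDeriv_proj, iteratedFDeriv_zero_apply]
    rfl
  | succ k ih =>
    -- Post-composition with evaluation at (e_i, …, e_i): it turns the curried derivative of order k
    -- + 1 into the derivative of the k-th partial derivative.
    set Λ : ((Fin d → ℝ) →L[ℝ] (Fin d → ℝ) [×k]→L[ℝ] ℝ) →L[ℝ] (Fin d → ℝ) →L[ℝ] ℂ :=
      ContinuousLinearMap.compL ℝ (Fin d → ℝ) ((Fin d → ℝ) [×k]→L[ℝ] ℝ) ℂ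
        (Complex.ofRealCLM.comp (ContinuousMultilinearMap.apply ℝ (fun _ : Fin k => Fin d → ℝ) ℝ
          (fun _ => Pi.single i 1))) with hΛ
    have hc : Continuous fun y => Λ (torusDeriv φ hk y).curryLeft :=
      Λ.continuous.comp ((continuousMultilinearCurryLeftEquiv ℝ
        (fun _ : Fin (k + 1) => Fin d → ℝ) ℝ).continuous.comp (torusDeriv φ hk).continuous)
    have h := fourierCoef_deriv (partialDeriv φ i ((Nat.le_succ k).trans hk))
      ⟨fun y => Λ (torusDeriv φ hk y).curryLeft, hc⟩
      (fun x => (Complex.ofRealCLM.comp (ContinuousMultilinearMap.apply ℝ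
        (fun _ : Fin k => Fin d → ℝ) ℝ (fun _ => Pi.single i 1))).hasFDerivAt.comp x
          (hasFDerivAt_torusDeriv φ hk x)) z i
    rw [ih, ← mul_assoc, ← pow_succ'] at h
    rw [← h]
    congr 1

end BesovTikhonov

namespace BesovTikhonov

/-! ### Orthonormality of the characters -/

theorem orthonormal_mFourier_torus (d : ℕ) :
    Orthonormal ℂ fun z : Fin d → ℤ =>
      ContinuousMap.toLp (E := ℂ) 2 (torusMeasure d) ℂ (UnitAddTorus.mFourier z) :=
  UnitAddTorus.orthonormal_mFourier

theorem inner_toLp_mFourier {d : ℕ} (Q : C(UnitAddTorus (Fin d), ℂ)) (z : Fin d → ℤ) :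
    inner ℂ (ContinuousMap.toLp (E := ℂ) 2 (torusMeasure d) ℂ (UnitAddTorus.mFourier z))
      (ContinuousMap.toLp (E := ℂ) 2 (torusMeasure d) ℂ Q) = fourierCoef Q z := by
  rw [ContinuousMap.inner_toLp, fourierCoef]
  simp only [UnitAddTorus.mFourier_neg, mul_comm]

/-- Bessel's inequality; the L² norm is at most the supremum norm because the torus has measure one.
-/
theorem sum_fourierCoef_sq_le {d : ℕ} (Q : C(UnitAddTorus (Fin d), ℂ)) {M : ℝ}
    (hM : ∀ y, ‖Q y‖ ≤ M) (S : Finset (Fin d → ℤ)) : ∑ z ∈ S, ‖fourierCoef Q z‖ ^ 2 ≤ M ^ 2 := by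
  have h := (orthonormal_mFourier_torus d).sum_inner_products_le (s := S)
    (ContinuousMap.toLp (E := ℂ) 2 (torusMeasure d) ℂ Q)
  simp only [inner_toLp_mFourier] at h
  refine h.trans ?_
  have h2 : ‖ContinuousMap.toLp (E := ℂ) 2 (torusMeasure d) ℂ Q‖ ≤ M := by
    have hM0 : 0 ≤ M := (norm_nonneg _).trans (hM 0)
    have h3 := ContinuousMap.toLp_norm_le (p := 2) (𝕜 := ℂ) (E := ℂ) (μ := torusMeasure d)
    have h4 := (ContinuousMap.toLp (E := ℂ) 2 (torusMeasure d) ℂ).le_of_opNorm_le h3 Q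
    refine h4.trans ?_
    have h5 : (measureUnivNNReal (torusMeasure d) : ℝ) = 1 := by simp [measureUnivNNReal]
    simpa [h5] using (ContinuousMap.norm_le _ hM0).2 hM
  gcongr

theorem fourierCoef_sum {d : ℕ} (S : Finset (Fin d → ℤ)) (c : (Fin d → ℤ) → ℂ) {w : Fin d → ℤ}
    (hw : w ∈ S) :
    fourierCoef (fun y => ∑ z ∈ S, c z * UnitAddTorus.mFourier z y) w = c w := by
  have h := (orthonormal_mFourier_torus d).inner_right_sum c hw
  have h2 := inner_toLp_mFourier (∑ z ∈ S, c z • UnitAddTorus.mFourier z) w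
  rw [map_sum] at h2
  simp only [map_smul] at h2
  rw [h] at h2
  rw [h2]
  congr 1
  funext y
  simp

theorem eLpNorm_two_sum {d : ℕ} (S : Finset (Fin d → ℤ)) (c : (Fin d → ℤ) → ℂ) :
    eLpNorm (fun x => ∑ z ∈ S, c z * UnitAddTorus.mFourier z x) 2 (torusMeasure d) =
      ENNReal.ofReal (√(∑ z ∈ S, ‖c z‖ ^ 2)) := by
  set Q : C(UnitAddTorus (Fin d), ℂ) := ∑ z ∈ S, c z • UnitAddTorus.mFourier z with hQ
  have h1 : (fun x => ∑ z ∈ S, c z * UnitAddTorus.mFourier z x) = Q := by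
    funext y
    simp [hQ]
  have h2 : ‖ContinuousMap.toLp (E := ℂ) 2 (torusMeasure d) ℂ Q‖ = √(∑ z ∈ S, ‖c z‖ ^ 2) := by
    rw [eq_comm, Real.sqrt_eq_iff_mul_self_eq (by positivity) (norm_nonneg _), ← sq]
    rw [hQ, map_sum]
    simp only [map_smul]
    have := (orthonormal_mFourier_torus d).inner_sum c c S
    rw [inner_self_eq_norm_sq_to_K] at this
    have h3 : ∀ z, (starRingEnd ℂ) (c z) * c z = ((‖c z‖ ^ 2 : ℝ) : ℂ) := fun z => by
      rw [mul_comm, Complex.mul_conj, Complex.normSq_eq_norm_sq]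
    simp only [h3] at this
    refine (Complex.ofReal_injective ?_).symm
    push_cast at this ⊢
    exact this
  rw [h1, ← h2, Lp.norm_def, ENNReal.ofReal_toReal (Lp.eLpNorm_ne_top _)]
  exact eLpNorm_congr_ae (ContinuousMap.coeFn_toLp (torusMeasure d) (𝕜 := ℂ) Q).symm

/-! ### Dyadic blocks -/

/-- The `ℓ²` norm of a family of Fourier coefficients over a dyadic block. -/
def blockNorm {d : ℕ} (c : (Fin d → ℤ) → ℂ) (j : ℕ) : ℝ := √(∑ z ∈ freqBlock d j, ‖c z‖ ^ 2)

theorem blockNorm_nonneg {d : ℕ} (c : (Fin d → ℤ) → ℂ) (j : ℕ) : 0 ≤ blockNorm c j :=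
  Real.sqrt_nonneg _

/-- The level is the least j with |2πz|_∞ ≤ 2^j. -/
theorem exists_mem_freqBlock {d : ℕ} (z : Fin d → ℤ) : ∃ j, z ∈ freqBlock d j := by
  classical
  set x : Fin d → ℝ := fun i => 2 * Real.pi * (z i : ℝ)
  have hiff : ∀ j : ℕ, ‖((2 : ℝ) ^ j)⁻¹ • x‖ ≤ 1 ↔ ‖x‖ ≤ 2 ^ j := fun j => by
    have hpos : (0 : ℝ) < 2 ^ j := by positivity
    rw [norm_smul, norm_inv, norm_pow, Real.norm_two, inv_mul_le_iff₀ hpos, mul_one]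
  have hex : ∃ j : ℕ, ‖x‖ ≤ 2 ^ j := (pow_unbounded_of_one_lt ‖x‖ one_lt_two).imp fun _ h => h.le
  refine ⟨Nat.find hex, ?_⟩
  rw [mem_freqBlock]
  have h1 := Nat.find_spec hex
  have h2 := fun m => Nat.find_min hex (m := m)
  generalize Nat.find hex = j at h1 h2
  cases j with
  | zero => simpa [chi, x] using h1
  | succ j =>
    have h3 := h2 j (Nat.lt_succ_self j)
    change (if ‖((2 : ℝ) ^ (j + 1))⁻¹ • x‖ ≤ 1 then (1 : ℝ) else 0)
      - (if ‖((2 : ℝ) ^ j)⁻¹ • x‖ ≤ 1 then 1 else 0) = 1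
    rw [if_pos ((hiff _).2 h1), if_neg (mt (hiff _).1 h3), sub_zero]

theorem exists_lt_of_mem_freqBlock_succ {d j : ℕ} {z : Fin d → ℤ} (hz : z ∈ freqBlock d (j + 1)) :
    ∃ i, (2 : ℝ) ^ j < ‖2 * Real.pi * Complex.I * (z i : ℂ)‖ := by
  rw [mem_freqBlock] at hz
  have h1 : ¬ ‖((2 : ℝ) ^ j)⁻¹ • fun i => 2 * Real.pi * (z i : ℝ)‖ ≤ 1 := by
    intro h
    simp only [chi, if_pos h] at hz
    split_ifs at hz <;> norm_num at hz
  by_contra! hc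
  refine h1 ((pi_norm_le_iff_of_nonneg zero_le_one).2 fun i => ?_)
  have hpos : (0 : ℝ) < 2 ^ j := by positivity
  have := hc i
  rw [Pi.smul_apply, smul_eq_mul, norm_mul, norm_inv, norm_pow, Real.norm_two,
    inv_mul_le_iff₀ hpos, mul_one]
  simpa [abs_of_pos Real.pi_pos] using this

/-- A frequency of level j + 1 has a coordinate i in which σ derivatives multiply the coefficient by
at least 2^(jσ). Summing over all i removes the dependence of i on z, and Bessel's inequality bounds
the coefficients of each σ-th partial derivative. The factor 2^σ makes up for the shift from j + 1
to j. -/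
theorem blockNorm_fourierCoef_le {d σ : ℕ} {φ : CSpace d σ} {M : ℝ} (hM : CBound φ M) (j : ℕ) :
    blockNorm (fourierCoef fun y => (φ.1 y : ℂ)) j ≤ 2 ^ σ * (d + 1) * M / (2 : ℝ) ^ (j * σ) := by
  have hM0 : 0 ≤ M := (norm_nonneg _).trans (hM 0 (Nat.zero_le _) 0)
  have hP : ∀ {k : ℕ} (hk : k ≤ σ) i y, ‖partialDeriv φ i hk y‖ ≤ M := fun {k} hk i y => by
    have h1 := (torusDeriv φ hk y).le_opNorm fun _ => Pi.single i 1
    simp only [partialDeriv, ContinuousMap.coe_mk, Complex.norm_real]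
    refine h1.trans ?_
    have h2 : ‖(Pi.single i 1 : Fin d → ℝ)‖ = 1 := by rw [Pi.norm_single, norm_one]
    simpa [h2] using norm_torusDeriv_le hM hk y
  have hφc : Continuous φ.1 := by
    rw [isOpenQuotientMap_proj.isQuotientMap.continuous_iff]
    exact (show ContDiff ℝ σ (lift φ.1) from φ.2).continuous
  set c := fourierCoef fun y => (φ.1 y : ℂ)
  have hsq : ∑ z ∈ freqBlock d j, ‖c z‖ ^ 2 ≤ (2 ^ σ * (d + 1) * M / (2 : ℝ) ^ (j * σ)) ^ 2 := by
    cases j with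
    | zero =>
      have h1 := sum_fourierCoef_sq_le ⟨fun y => (φ.1 y : ℂ), by fun_prop⟩ (M := M)
        (fun y => by
          obtain ⟨x, rfl⟩ := isOpenQuotientMap_proj.surjective y
          have := hM 0 (Nat.zero_le _) x
          rw [norm_iteratedFDeriv_zero] at this
          simpa using! this) (freqBlock d 0)
      refine h1.trans ?_
      gcongr
      simp only [zero_mul, pow_zero, div_one]
      have h3 : (1 : ℝ) ≤ 2 ^ σ * (d + 1) :=
        one_le_mul_of_one_le_of_one_le (one_le_pow₀ one_le_two) (by simp)
      nlinarith
    | succ j =>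
      have hpos : (0 : ℝ) < 2 ^ (j * σ) := by positivity
      have h1 : ∀ z ∈ freqBlock d (j + 1), ((2 : ℝ) ^ (j * σ)) ^ 2 * ‖c z‖ ^ 2 ≤
          ∑ i, ‖fourierCoef (partialDeriv φ i le_rfl) z‖ ^ 2 := fun z hz => by
        obtain ⟨i, hi⟩ := exists_lt_of_mem_freqBlock_succ hz
        refine le_trans ?_ (Finset.single_le_sum (fun _ _ => by positivity) (Finset.mem_univ i))
        rw [fourierCoef_partialDeriv, norm_mul, mul_pow, norm_pow, pow_mul]
        gcongr
      have h2 : ((2 : ℝ) ^ (j * σ)) ^ 2 * ∑ z ∈ freqBlock d (j + 1), ‖c z‖ ^ 2 ≤ d * M ^ 2 := by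
        rw [Finset.mul_sum]
        refine (Finset.sum_le_sum h1).trans ?_
        rw [Finset.sum_comm]
        refine (Finset.sum_le_sum fun i _ => sum_fourierCoef_sq_le _ (hP le_rfl i) _).trans ?_
        simp
      have h3 : 2 ^ σ * (d + 1) * M / (2 : ℝ) ^ ((j + 1) * σ) = (d + 1) * M / 2 ^ (j * σ) := by
        rw [add_mul, one_mul, pow_add]
        field_simp
      rw [h3, div_pow, le_div_iff₀ (by positivity), mul_comm]
      refine h2.trans ?_
      rw [mul_pow]
      gcongr
      nlinarith [(Nat.cast_nonneg d : (0 : ℝ) ≤ d)]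
  rw [blockNorm]
  refine (Real.sqrt_le_sqrt hsq).trans ?_
  rw [Real.sqrt_sq (by positivity)]

/-- Cover the finite set by finitely many blocks and apply Cauchy–Schwarz in each. Disjointness of
the blocks is not needed, as all terms are nonnegative. -/
theorem sum_mul_le_blockNorm {d : ℕ} (c e : (Fin d → ℤ) → ℂ) (S : Finset (Fin d → ℤ)) :
    ∃ J : ℕ, ∑ z ∈ S, ‖c z‖ * ‖e z‖ ≤ ∑ j ∈ Finset.range J, blockNorm c j * blockNorm e j := by
  classical
  choose b hb using exists_mem_freqBlock (d := d)
  refine ⟨S.sup b + 1, ?_⟩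
  have h1 : S ⊆ (Finset.range (S.sup b + 1)).biUnion (freqBlock d) := fun z hz =>
    Finset.mem_biUnion.2 ⟨b z, Finset.mem_range.2 (Nat.lt_succ_of_le (Finset.le_sup hz)), hb z⟩
  refine (Finset.sum_le_sum_of_subset_of_nonneg h1 fun _ _ _ => by positivity).trans ?_
  have h2 : ∀ (T : Finset ℕ), ∑ z ∈ T.biUnion (freqBlock d), ‖c z‖ * ‖e z‖ ≤
      ∑ j ∈ T, ∑ z ∈ freqBlock d j, ‖c z‖ * ‖e z‖ := fun T => by
    induction T using Finset.induction_on with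
    | empty => simp
    | insert a T ha ih =>
      rw [Finset.biUnion_insert, Finset.sum_insert ha]
      have := Finset.sum_union_inter (s₁ := freqBlock d a) (s₂ := T.biUnion (freqBlock d))
        (f := fun z => ‖c z‖ * ‖e z‖)
      have h0 : 0 ≤ ∑ z ∈ freqBlock d a ∩ T.biUnion (freqBlock d), ‖c z‖ * ‖e z‖ := by positivity
      linarith
  refine (h2 _).trans (Finset.sum_le_sum fun j _ => ?_)
  exact Real.sum_mul_le_sqrt_mul_sqrt _ _ _

end BesovTikhonov

namespace BesovTikhonov

/-! ### Density of the trigonometric polynomials in `C^σ` -/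

/-- The real part of a trigonometric polynomial, as a test function. -/
def trigPoly {d : ℕ} (σ : ℕ) (S : Finset (Fin d → ℤ)) (c : (Fin d → ℤ) → ℂ) : CSpace d σ :=
  ∑ z ∈ S, ((c z).re • cosMode σ z - (c z).im • sinMode σ z)

theorem trigPoly_apply {d σ : ℕ} (S : Finset (Fin d → ℤ)) (c : (Fin d → ℤ) → ℂ)
    (x : UnitAddTorus (Fin d)) :
    (trigPoly σ S c).1 x = (∑ z ∈ S, c z * UnitAddTorus.mFourier z x).re := by
  rw [trigPoly, Submodule.coe_sum, Finset.sum_apply, Complex.re_sum]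
  refine Finset.sum_congr rfl fun z _ => ?_
  rw [Complex.mul_re]
  rfl

/-- Evaluation at the real part of ∑ c_z e_z gives ∑ Re(conj(û(z)) c_z). -/
theorem abs_eval_trigPoly_le {d σ : ℕ} (u : Distr d σ) (S : Finset (Fin d → ℤ))
    (c : (Fin d → ℤ) → ℂ) : |u.eval (trigPoly σ S c)| ≤ ∑ z ∈ S, ‖coeff u z‖ * ‖c z‖ := by
  have h : u.eval (trigPoly σ S c) =
      ∑ z ∈ S, ((c z).re * u.eval (cosMode σ z) - (c z).im * u.eval (sinMode σ z)) := by
    simp only [trigPoly, Distr.eval, map_sum, map_sub, map_smul, smul_eq_mul]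
  rw [h]
  refine (Finset.abs_sum_le_sum_abs _ _).trans (Finset.sum_le_sum fun z _ => ?_)
  have h2 : (c z).re * u.eval (cosMode σ z) - (c z).im * u.eval (sinMode σ z) =
      ((starRingEnd ℂ) (coeff u z) * c z).re := by
    rw [Complex.mul_re]
    simp only [coeff, Complex.conj_re, Complex.conj_im]
    ring
  rw [h2, ← Complex.norm_conj, ← norm_mul]
  exact Complex.abs_re_le_norm _

theorem integral_multilinear_apply {d k : ℕ}
    (f : UnitAddTorus (Fin d) → (Fin d → ℝ) [×k]→L[ℝ] ℝ) (hf : Continuous f)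
    (w : Fin k → Fin d → ℝ) :
    (∫ y, f y ∂(torusMeasure d)) w = ∫ y, f y w ∂(torusMeasure d) :=
  (ContinuousLinearMap.integral_comp_comm
    (ContinuousMultilinearMap.apply ℝ (fun _ : Fin k => Fin d → ℝ) ℝ w)
    (integrable_torus hf)).symm

/-- All derivatives of the convolution fall on φ: the resulting integrals form a Taylor series up to
order σ, and Taylor series are unique. -/
theorem iteratedFDeriv_integral_translate {d σ : ℕ} (φ : CSpace d σ)
    (K : C(UnitAddTorus (Fin d), ℝ)) {k : ℕ} (hk : k ≤ σ) (x : Fin d → ℝ) :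
    iteratedFDeriv ℝ k (lift fun x => ∫ y, K y * φ.1 (x + y) ∂(torusMeasure d)) x =
      ∫ y, K y • torusDeriv φ hk (proj x + y) ∂(torusMeasure d) := by
  set p : (Fin d → ℝ) → FormalMultilinearSeries ℝ (Fin d → ℝ) ℝ := fun x k =>
    if hk : k ≤ σ then ∫ y, K y • torusDeriv φ hk (proj x + y) ∂(torusMeasure d) else 0 with hp
  have hps : ∀ {k} (hk : k ≤ σ) (x), p x k =
      ∫ y, K y • torusDeriv φ hk (proj x + y) ∂(torusMeasure d) := fun hk x => dif_pos hk
  have hder : ∀ m : ℕ, m < σ → ∀ x, HasFDerivAt (fun y => p y m) (p x m.succ).curryLeft x := by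
    intro m hm x
    have hm' : m + 1 ≤ σ := hm
    have hc : Continuous fun y => (torusDeriv φ hm' y).curryLeft :=
      (continuousMultilinearCurryLeftEquiv ℝ
        (fun _ : Fin (m + 1) => Fin d → ℝ) ℝ).continuous.comp (torusDeriv φ hm').continuous
    have h := hasFDerivAt_integral_smul_translate K (torusDeriv φ ((Nat.le_succ m).trans hm'))
      ⟨_, hc⟩ (fun x => hasFDerivAt_torusDeriv φ hm' x) x
    simp only [hps hm', hps hm.le]
    convert! h using 1
    ext v w
    rw [ContinuousLinearMap.integral_apply (integrable_torus (by fun_prop)),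
      integral_multilinear_apply _ (by fun_prop), ContinuousMultilinearMap.curryLeft_apply,
      integral_multilinear_apply _ (by fun_prop)]
    rfl
  have htay : HasFTaylorSeriesUpTo (σ : ℕ∞)
      (lift fun x => ∫ y, K y * φ.1 (x + y) ∂(torusMeasure d)) p := by
    refine ⟨fun x => ?_, fun m hm x => hder m (by exact_mod_cast hm) x, fun m hm => ?_⟩
    · rw [hps (Nat.zero_le σ), ContinuousMultilinearMap.curry0_apply]
      rw [integral_multilinear_apply _ (by fun_prop)]
      refine integral_congr_ae (Eventually.of_forall fun y => ?_)
      obtain ⟨w, rfl⟩ := isOpenQuotientMap_proj.surjective y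
      simp only [← proj_add, torusDeriv_proj]
      simp
      left
      rfl
    · have hm' : m ≤ σ := by exact_mod_cast hm
      simp only [hps hm']
      refine continuous_of_dominated (bound := fun _ => ‖K‖ * ‖torusDeriv φ hm'‖) ?_ ?_ ?_ ?_
      · exact fun x => Continuous.aestronglyMeasurable (by fun_prop)
      · refine fun x => Eventually.of_forall fun y =>
          (norm_smul_le (K y) (torusDeriv φ hm' (proj x + y))).trans ?_
        gcongr
        · exact K.norm_coe_le_norm y
        · exact (torusDeriv φ hm').norm_coe_le_norm _
      · exact integrable_const _
      · refine Eventually.of_forall fun y => ?_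
        have := continuous_proj (d := d)
        fun_prop
  rw [← htay.eq_iteratedFDeriv (by exact_mod_cast hk) x, hps hk]

/-! ### Approximate identities from powers of a trigonometric polynomial -/

/-- A positive trigonometric polynomial with a strict maximum at the origin. -/
def peak (d : ℕ) : C(UnitAddTorus (Fin d), ℝ) where
  toFun y := 1 + ∑ i, (1 + (fourier 1 (y i) : ℂ).re)
  continuous_toFun := by fun_prop

theorem neg_one_le_re_fourier (n : ℤ) (y : UnitAddCircle) : -1 ≤ (fourier n y : ℂ).re := by
  have h := Complex.abs_re_le_norm (fourier n y : ℂ)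
  rw [fourier_apply, Circle.norm_coe] at h
  exact (abs_le.1 h).1

theorem re_fourier_le_one (n : ℤ) (y : UnitAddCircle) : (fourier n y : ℂ).re ≤ 1 := by
  have h := Complex.abs_re_le_norm (fourier n y : ℂ)
  rw [fourier_apply, Circle.norm_coe] at h
  exact (abs_le.1 h).2

theorem one_le_peak {d : ℕ} (y : UnitAddTorus (Fin d)) : 1 ≤ peak d y := by
  have : 0 ≤ ∑ i, (1 + (fourier 1 (y i) : ℂ).re) :=
    Finset.sum_nonneg fun i _ => by linarith [neg_one_le_re_fourier 1 (y i)]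
  simpa [peak] using this

/-- A character value with real part 1 is equal to 1, and the circle embedding is injective, so some
cosine is strictly below 1. -/
theorem peak_lt {d : ℕ} {y : UnitAddTorus (Fin d)} (hy : y ≠ 0) : peak d y < peak d 0 := by
  obtain ⟨i, hi⟩ := Function.ne_iff.1 hy
  have h1 : ∀ i, (1 + (fourier 1 (y i) : ℂ).re) ≤
      1 + (fourier 1 ((0 : UnitAddTorus (Fin d)) i)).re := by
    intro i
    have := re_fourier_le_one 1 (y i)
    simpa using this
  have h2 : (fourier 1 (y i) : ℂ).re ≠ 1 := by
    intro h
    have hn : Complex.normSq (fourier 1 (y i) : ℂ) = 1 := by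
      rw [Complex.normSq_eq_norm_sq, fourier_apply, Circle.norm_coe, one_pow]
    rw [Complex.normSq_apply, h] at hn
    have him : (fourier 1 (y i) : ℂ).im = 0 := by nlinarith
    have h3 : (fourier 1 (y i) : ℂ) = 1 := Complex.ext (by simpa using h) (by simpa using him)
    rw [fourier_one] at h3
    have h4 : AddCircle.toCircle (y i) = AddCircle.toCircle (T := 1) 0 := by
      rw [AddCircle.toCircle_zero]
      exact Circle.ext (by simpa using h3)
    exact hi (AddCircle.injective_toCircle one_ne_zero h4)
  have h3 : ∑ i, (1 + (fourier 1 (y i) : ℂ).re) <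
      ∑ i, (1 + (fourier 1 ((0 : UnitAddTorus (Fin d)) i)).re) := by
    refine Finset.sum_lt_sum (fun i _ => h1 i) ⟨i, Finset.mem_univ i, ?_⟩
    have := lt_of_le_of_ne (re_fourier_le_one 1 (y i)) h2
    simpa using this
  simpa [peak] using h3

/-- The function `peak` lies in the star subalgebra generated by the characters, hence so do its
powers, and that subalgebra is the linear span of the characters. The frequencies are negated to
suit convolution. -/
theorem peak_pow_eq_sum (d n : ℕ) (r : ℝ) : ∃ (S : Finset (Fin d → ℤ)) (k : (Fin d → ℤ) → ℂ),
    ∀ y, ((r * peak d y ^ n : ℝ) : ℂ) = ∑ z ∈ S, k z * UnitAddTorus.mFourier (-z) y := by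
  have h1 : ∃ Q ∈ UnitAddTorus.mFourierSubalgebra (Fin d), ∀ y, Q y = (peak d y : ℂ) := by
    refine ⟨1 + ∑ i, (1 + (2⁻¹ : ℂ) • (UnitAddTorus.mFourier (Pi.single i 1) +
      star (UnitAddTorus.mFourier (Pi.single i 1)))), ?_, fun y => ?_⟩
    · have hm : ∀ z, UnitAddTorus.mFourier z ∈ UnitAddTorus.mFourierSubalgebra (Fin d) := fun z =>
        Algebra.subset_adjoin (Set.mem_range_self z)
      refine add_mem (one_mem _) (sum_mem fun i _ => add_mem (one_mem _) ?_)
      exact Submodule.smul_mem (UnitAddTorus.mFourierSubalgebra (Fin d)).toSubalgebra.toSubmodule _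
        (show _ ∈ UnitAddTorus.mFourierSubalgebra (Fin d) from add_mem (hm _) (star_mem (hm _)))
    · simp only [peak, ContinuousMap.add_apply, ContinuousMap.one_apply, ContinuousMap.sum_apply,
        ContinuousMap.smul_apply, ContinuousMap.star_apply, UnitAddTorus.mFourier_single,
        ContinuousMap.coe_mk]
      push_cast
      congr 1
      refine Finset.sum_congr rfl fun i _ => ?_
      rw [Complex.star_def, Complex.add_conj, smul_eq_mul]
      push_cast
      ring
  obtain ⟨Q, hQ, hQp⟩ := h1
  have h2 : (r : ℂ) • Q ^ n ∈ (UnitAddTorus.mFourierSubalgebra (Fin d)).toSubalgebra.toSubmodule :=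
    Submodule.smul_mem _ _ (pow_mem (S := UnitAddTorus.mFourierSubalgebra (Fin d)) hQ n)
  have h3 : Set.range (UnitAddTorus.mFourier (d := Fin d)) =
      Set.range fun z => UnitAddTorus.mFourier (-z : Fin d → ℤ) :=
    ((Equiv.neg (Fin d → ℤ)).surjective.range_comp _).symm
  rw [UnitAddTorus.mFourierSubalgebra_coe, h3, Finsupp.mem_span_range_iff_exists_finsupp] at h2
  obtain ⟨l, hl⟩ := h2
  refine ⟨l.support, l, fun y => ?_⟩
  have := congrArg (fun f => f y) hl
  simp only [Finsupp.sum, ContinuousMap.sum_apply, ContinuousMap.smul_apply, smul_eq_mul,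
    ContinuousMap.pow_apply, hQp] at this
  rw [this]
  push_cast
  rfl

end BesovTikhonov

namespace BesovTikhonov

/-- The convolution of a test function with a trigonometric polynomial. -/
theorem integral_mul_translate_eq_trigPoly {d σ : ℕ} (φ : CSpace d σ)
    (K : C(UnitAddTorus (Fin d), ℝ)) (S : Finset (Fin d → ℤ)) (k : (Fin d → ℤ) → ℂ)
    (hK : ∀ y, (K y : ℂ) = ∑ z ∈ S, k z * UnitAddTorus.mFourier (-z) y) :
    (fun x => ∫ y, K y * φ.1 (x + y) ∂(torusMeasure d)) =
      (trigPoly σ S fun z => k z * fourierCoef (fun y => (φ.1 y : ℂ)) z).1 := by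
  have hφc : Continuous φ.1 := by
    rw [isOpenQuotientMap_proj.isQuotientMap.continuous_iff]
    exact (show ContDiff ℝ σ (lift φ.1) from φ.2).continuous
  funext x
  rw [trigPoly_apply, ← Complex.ofReal_re (∫ y, K y * φ.1 (x + y) ∂(torusMeasure d)),
    ← integral_complex_ofReal]
  congr 1
  simp only [Complex.ofReal_mul, hK, Finset.sum_mul]
  rw [integral_finsetSum _ fun z _ => integrable_torus (by fun_prop)]
  refine Finset.sum_congr rfl fun z _ => ?_
  simp only [mul_assoc]
  rw [integral_const_mul, integral_mFourier_mul_translate (fun y => (φ.1 y : ℂ))]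
  ring

/-- The number k_w is the Fourier coefficient at −w of the probability density K. -/
theorem norm_le_one_of_kernel {d : ℕ} (K : C(UnitAddTorus (Fin d), ℝ)) (hK0 : ∀ y, 0 ≤ K y)
    (hK1 : ∫ y, K y ∂(torusMeasure d) = 1) (S : Finset (Fin d → ℤ)) (k : (Fin d → ℤ) → ℂ)
    (hK : ∀ y, (K y : ℂ) = ∑ z ∈ S, k z * UnitAddTorus.mFourier (-z) y) {w : Fin d → ℤ}
    (hw : w ∈ S) : ‖k w‖ ≤ 1 := by
  have h1 := fourierCoef_sum (S.map (Equiv.neg _).toEmbedding) (fun z => k (-z)) (w := -w)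
    (by simpa using hw)
  simp only [Finset.sum_map, Equiv.coe_toEmbedding, Equiv.neg_apply, neg_neg] at h1
  simp only [← hK] at h1
  rw [← h1, fourierCoef]
  refine le_of_le_of_eq ?_ hK1
  refine norm_integral_le_of_norm_le (integrable_torus K.continuous)
    (Eventually.of_forall fun y => ?_)
  rw [norm_mul, Complex.norm_real, Real.norm_of_nonneg (hK0 y)]
  have := (UnitAddTorus.mFourier (- -w)).norm_coe_le_norm y
  rw [UnitAddTorus.mFourier_norm] at this
  nlinarith [hK0 y]

/-- The modulus of continuity of a vector valued function with respect to a translation. -/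
theorem exists_modulus {d : ℕ} {V : Type*} [NormedAddCommGroup V] (Q : C(UnitAddTorus (Fin d), V)) :
    ∃ ω : C(UnitAddTorus (Fin d), ℝ), ω 0 = 0 ∧ ∀ x y, ‖Q (x + y) - Q x‖ ≤ ω y := by
  -- Currying makes G a continuous map into the continuous functions with the supremum norm, so the
  -- supremum over x depends continuously on the translation.
  set G : C(UnitAddTorus (Fin d) × UnitAddTorus (Fin d), V) :=
    ⟨fun v => Q (v.2 + v.1) - Q v.2, by fun_prop⟩
  refine ⟨⟨fun y => ‖G.curry y‖, G.curry.continuous.norm⟩, ?_, fun x y => ?_⟩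
  · have : G.curry 0 = 0 := by
      ext x
      simp [G]
    simp [this]
  · exact (G.curry y).norm_coe_le_norm x

/-- Trigonometric polynomials are dense in `C^σ`, without increasing the Fourier coefficients. -/
theorem exists_trigPoly_approx {d σ : ℕ} (φ : CSpace d σ) {ε : ℝ} (hε : 0 < ε) :
    ∃ (S : Finset (Fin d → ℤ)) (c : (Fin d → ℤ) → ℂ), CBound (φ - trigPoly σ S c) ε ∧
      ∀ z ∈ S, ‖c z‖ ≤ ‖fourierCoef (fun y => (φ.1 y : ℂ)) z‖ := by
  choose ω hω0 hω using fun k : Fin (σ + 1) =>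
    exists_modulus (torusDeriv φ (Nat.lt_succ_iff.1 k.2))
  set I : ℕ → ℝ := fun n => ∫ y, peak d y ^ n ∂(torusMeasure d) with hI
  have hint : ∀ n, Integrable (fun y => peak d y ^ n) (torusMeasure d) := fun n =>
    integrable_torus (by fun_prop)
  have hIpos : ∀ n, 0 < I n := fun n => by
    have : (1 : ℝ) = ∫ _, 1 ∂(torusMeasure d) := by simp
    refine one_pos.trans_le (this.le.trans ?_)
    exact integral_mono (integrable_const _) (hint n) fun y => one_le_pow₀ (one_le_peak y)
  -- The normalized powers of `peak` concentrate at the origin, where every modulus of continuity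
  -- vanishes.
  have hlim : ∀ k, Tendsto (fun n => (I n)⁻¹ * ∫ y, peak d y ^ n * ω k y ∂(torusMeasure d)) atTop
      (𝓝 0) := fun k => by
    have h := tendsto_setIntegral_pow_smul_of_unique_maximum_of_isCompact_of_continuousOn
      (μ := torusMeasure d) (s := Set.univ) (x₀ := 0) (c := peak d) (g := ω k) isCompact_univ
      (peak d).continuous.continuousOn (fun y _ hy => peak_lt hy)
      (fun y _ => zero_le_one.trans (one_le_peak y)) (zero_lt_one.trans_le (one_le_peak 0))
      (by simp) (ω k).continuous.continuousOn
    simpa [hω0] using h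
  have hev : ∀ᶠ n in atTop, ∀ k,
      (I n)⁻¹ * ∫ y, peak d y ^ n * ω k y ∂(torusMeasure d) ≤ ε :=
    eventually_all.2 fun k => ((hlim k).eventually (gt_mem_nhds hε)).mono fun _ h => h.le
  obtain ⟨n, hn⟩ := hev.exists
  set K : C(UnitAddTorus (Fin d), ℝ) := ⟨fun y => (I n)⁻¹ * peak d y ^ n, by fun_prop⟩ with hKdef
  have hK0 : ∀ y, 0 ≤ K y := fun y =>
    mul_nonneg (inv_nonneg.2 (hIpos n).le) (pow_nonneg (zero_le_one.trans (one_le_peak y)) n)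
  have hK1 : ∫ y, K y ∂(torusMeasure d) = 1 := by
    simp only [hKdef, ContinuousMap.coe_mk]
    rw [integral_const_mul]
    exact inv_mul_cancel₀ (hIpos n).ne'
  obtain ⟨S, k, hk⟩ := peak_pow_eq_sum d n (I n)⁻¹
  refine ⟨S, fun z => k z * fourierCoef (fun y => (φ.1 y : ℂ)) z, ?_, fun z hz => ?_⟩
  · intro m hm x
    have hφs : ContDiff ℝ σ (lift φ.1) := φ.2
    have hT := (trigPoly σ S fun z => k z * fourierCoef (fun y => (φ.1 y : ℂ)) z).2
    have hTs : ContDiff ℝ σ (lift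
      (trigPoly σ S fun z => k z * fourierCoef (fun y => (φ.1 y : ℂ)) z).1) := hT
    have h1 := iteratedFDeriv_integral_translate φ K hm x
    rw [integral_mul_translate_eq_trigPoly φ K S k hk] at h1
    have h2 : lift (φ - trigPoly σ S fun z => k z * fourierCoef (fun y => (φ.1 y : ℂ)) z).1 =
      lift φ.1 - lift (trigPoly σ S fun z => k z * fourierCoef (fun y => (φ.1 y : ℂ)) z).1 := rfl
    have hmσ : (m : WithTop ℕ∞) ≤ σ := by exact_mod_cast hm
    rw [h2, iteratedFDeriv_sub_apply (hφs.of_le hmσ).contDiffAt (hTs.of_le hmσ).contDiffAt, h1,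
      ← torusDeriv_proj φ hm, norm_sub_rev]
    -- The kernel has integral one, so the derivative at x can be moved under the integral and
    -- compared with its translates.
    have h3 : torusDeriv φ hm (proj x) =
        ∫ y, K y • torusDeriv φ hm (proj x) ∂(torusMeasure d) := by
      rw [integral_smul_const, hK1, one_smul]
    rw [h3, ← integral_sub (integrable_torus (by fun_prop)) (integrable_torus (by fun_prop))]
    refine le_trans (norm_integral_le_of_norm_le
      (g := fun y => (I n)⁻¹ * (peak d y ^ n * ω ⟨m, Nat.lt_succ_of_le hm⟩ y))
      (integrable_torus (by fun_prop)) (Eventually.of_forall fun y => ?_)) ?_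
    · rw [← smul_sub, ← mul_assoc]
      refine (norm_smul_le (K y) _).trans ?_
      rw [Real.norm_of_nonneg (hK0 y)]
      exact mul_le_mul_of_nonneg_left (hω ⟨m, Nat.lt_succ_of_le hm⟩ (proj x) y) (hK0 y)
    · rw [integral_const_mul]
      exact hn _
  · rw [norm_mul]
    exact mul_le_of_le_one_left (norm_nonneg _) (norm_le_one_of_kernel K hK0 hK1 S k hk hz)

/-- Distributions with Fourier coefficients of negative order less than `σ` are controlled by their
Fourier coefficients. -/
theorem exists_abs_eval_le {d σ : ℕ} {a : ℝ} (ha : a < σ) : ∃ C : ℝ, 0 ≤ C ∧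
    ∀ (u : Distr d σ) (E : ℝ), (∀ j : ℕ, blockNorm (coeff u) j ≤ (2 : ℝ) ^ ((j : ℝ) * a) * E) →
      ∀ (φ : CSpace d σ) (M : ℝ), CBound φ M → |u.eval φ| ≤ C * E * M := by
  set ρ : ℝ := (2 : ℝ) ^ (a - σ) with hρ
  have hρ0 : 0 ≤ ρ := by positivity
  have hρ1 : ρ < 1 := Real.rpow_lt_one_of_one_lt_of_neg one_lt_two (by linarith)
  refine ⟨2 ^ σ * (d + 1) * (1 - ρ)⁻¹, mul_nonneg (by positivity)
    (inv_nonneg.2 (by linarith)), fun u E hE φ M hM => ?_⟩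
  have hM0 : 0 ≤ M := (norm_nonneg _).trans (hM 0 (Nat.zero_le _) 0)
  have hE0 : 0 ≤ E := by simpa using (blockNorm_nonneg _ _).trans (hE 0)
  set Cu := 2 ^ σ * (d + 1) * (1 - ρ)⁻¹ * E * M
  -- This bound is not uniform in u, but it only enters through the approximation error ε, which
  -- tends to zero.
  obtain ⟨B, hB⟩ : ∃ B : ℝ, ∀ φ M, CBound φ M → |u.eval φ| ≤ B * M := u.2
  have key : ∀ ε > 0, |u.eval φ| ≤ Cu + B * ε := fun ε hε => by
    obtain ⟨S, c, hc1, hc2⟩ := exists_trigPoly_approx φ hε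
    have h1 : u.eval φ = u.eval (φ - trigPoly σ S c) + u.eval (trigPoly σ S c) := by
      simp only [Distr.eval, map_sub, sub_add_cancel]
    have h2 : |u.eval (trigPoly σ S c)| ≤ Cu := by
      refine (abs_eval_trigPoly_le u S c).trans ?_
      set b := fourierCoef (fun y => (φ.1 y : ℂ))
      obtain ⟨J, hJ⟩ := sum_mul_le_blockNorm (coeff u) b S
      -- The approximant has coefficients no larger than those of φ, so the estimate does not depend
      -- on the approximating set S.
      have h3 : ∑ z ∈ S, ‖coeff u z‖ * ‖c z‖ ≤ ∑ z ∈ S, ‖coeff u z‖ * ‖b z‖ :=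
        Finset.sum_le_sum fun z hz => by gcongr; exact hc2 z hz
      refine h3.trans (hJ.trans ?_)
      have h4 : ∀ j : ℕ, blockNorm (coeff u) j * blockNorm b j ≤
          (2 ^ σ * (d + 1) * E * M) * ρ ^ j := fun j => by
        have h5 := mul_le_mul (hE j) (blockNorm_fourierCoef_le hM j) (blockNorm_nonneg _ _)
          (by positivity)
        refine h5.trans (le_of_eq ?_)
        rw [hρ, ← Real.rpow_natCast (2 ^ (a - σ)), ← Real.rpow_mul two_pos.le, sub_mul,
          Real.rpow_sub two_pos, pow_mul', ← pow_mul, ← Real.rpow_natCast 2 (σ * j)]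
        push_cast
        rw [mul_comm a]
        ring
      refine (Finset.sum_le_sum fun j _ => h4 j).trans ?_
      rw [← Finset.mul_sum]
      have h6 : ∑ j ∈ Finset.range J, ρ ^ j ≤ (1 - ρ)⁻¹ :=
        ((summable_geometric_of_lt_one hρ0 hρ1).sum_le_tsum _ fun _ _ => by positivity).trans_eq
          (tsum_geometric_of_lt_one hρ0 hρ1)
      calc _ ≤ (2 ^ σ * (d + 1) * E * M) * (1 - ρ)⁻¹ := by gcongr
        _ = Cu := by ring
    rw [h1]
    exact (abs_add_le _ _).trans (by linarith [hB _ _ hc1])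
  refine ge_of_tendsto (f := fun ε : ℝ => Cu + B * ε) (x := 𝓝[>] 0) (b := |u.eval φ|) ?_
    (eventually_mem_nhdsWithin.mono key)
  have : Tendsto (fun ε : ℝ => Cu + B * ε) (𝓝 0) (𝓝 (Cu + B * 0)) := by
    have : Continuous fun ε : ℝ => Cu + B * ε := by fun_prop
    exact this.tendsto 0
  rw [mul_zero, add_zero] at this
  exact this.mono_left nhdsWithin_le_nhds

end BesovTikhonov

namespace BesovTikhonov

/-! ### Two-point inequalities -/

/-- The difference of the two sides is increasing in x: (1+x)^(t−1) and (1−x)^(t−1) have product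
(1−x²)^(t−1) ≥ 1, so their sum is at least 2. -/
theorem two_mul_le_rpow_sub_rpow {t x : ℝ} (ht0 : 0 ≤ t) (ht1 : t ≤ 1) (hx0 : 0 ≤ x)
    (hx1 : x ≤ 1) : 2 * t * x ≤ (1 + x) ^ t - (1 - x) ^ t := by
  set k : ℝ → ℝ := fun x => (1 + x) ^ t - (1 - x) ^ t - 2 * t * x with hk
  have hd : ∀ x ∈ Set.Ioo (0 : ℝ) 1, HasDerivAt k
      (t * (1 + x) ^ (t - 1) + t * (1 - x) ^ (t - 1) - 2 * t) x := fun x hx => by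
    have h1 : HasDerivAt (fun x : ℝ => (1 + x) ^ t) (1 * t * (1 + x) ^ (t - 1)) x :=
      ((hasDerivAt_id x).const_add 1).rpow_const (Or.inl (by simp; linarith [hx.1]))
    have h2 : HasDerivAt (fun x : ℝ => (1 - x) ^ t) (-1 * t * (1 - x) ^ (t - 1)) x :=
      ((hasDerivAt_id x).const_sub 1).rpow_const (Or.inl (by simp; linarith [hx.2]))
    have h3 := (h1.sub h2).sub ((hasDerivAt_id x).const_mul (2 * t))
    convert! h3 using 1
    ring
  have hm : MonotoneOn k (Set.Icc 0 1) := by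
    refine monotoneOn_of_deriv_nonneg (convex_Icc 0 1) ?_ ?_ ?_
    · refine ContinuousOn.sub (ContinuousOn.sub ?_ ?_) (by fun_prop)
      · exact ContinuousOn.rpow_const (by fun_prop) fun _ _ => Or.inr ht0
      · exact ContinuousOn.rpow_const (by fun_prop) fun _ _ => Or.inr ht0
    · rw [interior_Icc]
      exact fun x hx => (hd x hx).differentiableAt.differentiableWithinAt
    · rw [interior_Icc]
      intro x hx
      rw [(hd x hx).deriv]
      have hp1 : 0 < 1 + x := by linarith [hx.1]
      have hp2 : 0 < 1 - x := by linarith [hx.2]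
      have h1 : 1 ≤ (1 + x) ^ (t - 1) * (1 - x) ^ (t - 1) := by
        rw [← Real.mul_rpow hp1.le hp2.le]
        exact Real.one_le_rpow_of_pos_of_le_one_of_nonpos (by positivity)
          (by nlinarith [hx.1]) (by linarith)
      have h2 : 0 < (1 + x) ^ (t - 1) := by positivity
      have h3 : 0 < (1 - x) ^ (t - 1) := by positivity
      have h4 : 2 ≤ (1 + x) ^ (t - 1) + (1 - x) ^ (t - 1) := by
        nlinarith [sq_nonneg ((1 + x) ^ (t - 1) - (1 - x) ^ (t - 1))]
      nlinarith
  have := hm (Set.left_mem_Icc.2 zero_le_one) ⟨hx0, hx1⟩ hx0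
  simp only [hk, add_zero, sub_zero, mul_zero, Real.one_rpow] at this
  linarith

/-- The derivative of the difference is q times the inequality `two_mul_le_rpow_sub_rpow` at
exponent q − 1. The left side has the form produced by Bernoulli's inequality for the exponent q/2.
-/
theorem one_add_mul_sq_le_rpow {q x : ℝ} (hq1 : 1 < q) (hq2 : q ≤ 2) (hx0 : 0 ≤ x) (hx1 : x ≤ 1) :
    1 + q / 2 * ((q - 1) * x ^ 2) ≤ ((1 + x) ^ q + (1 - x) ^ q) / 2 := by
  set k : ℝ → ℝ := fun x => (1 + x) ^ q + (1 - x) ^ q - q * (q - 1) * x ^ 2 with hk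
  have hd : ∀ x ∈ Set.Ioo (0 : ℝ) 1, HasDerivAt k
      (q * (1 + x) ^ (q - 1) - q * (1 - x) ^ (q - 1) - 2 * q * (q - 1) * x) x := fun x hx => by
    have h1 : HasDerivAt (fun x : ℝ => (1 + x) ^ q) (1 * q * (1 + x) ^ (q - 1)) x :=
      ((hasDerivAt_id x).const_add 1).rpow_const (Or.inl (by simp; linarith [hx.1]))
    have h2 : HasDerivAt (fun x : ℝ => (1 - x) ^ q) (-1 * q * (1 - x) ^ (q - 1)) x :=
      ((hasDerivAt_id x).const_sub 1).rpow_const (Or.inl (by simp; linarith [hx.2]))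
    have h3 := (h1.add h2).sub ((hasDerivAt_pow 2 x).const_mul (q * (q - 1)))
    convert! h3 using 1
    simp
    ring
  have hm : MonotoneOn k (Set.Icc 0 1) := by
    refine monotoneOn_of_deriv_nonneg (convex_Icc 0 1) ?_ ?_ ?_
    · refine ContinuousOn.sub (ContinuousOn.add ?_ ?_) (by fun_prop)
      · exact ContinuousOn.rpow_const (by fun_prop) fun _ _ => Or.inr (by linarith)
      · exact ContinuousOn.rpow_const (by fun_prop) fun _ _ => Or.inr (by linarith)
    · rw [interior_Icc]
      exact fun x hx => (hd x hx).differentiableAt.differentiableWithinAt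
    · rw [interior_Icc]
      intro x hx
      rw [(hd x hx).deriv]
      have := two_mul_le_rpow_sub_rpow (t := q - 1) (by linarith) (by linarith) hx.1.le hx.2.le
      nlinarith
  have := hm (Set.left_mem_Icc.2 zero_le_one) ⟨hx0, hx1⟩ hx0
  simp only [hk, add_zero, sub_zero, ne_eq, OfNat.ofNat_ne_zero, not_false_eq_true, zero_pow,
    mul_zero, Real.one_rpow] at this
  linarith

/-- The two-point inequality for real numbers. -/
theorem two_point_real {q A B : ℝ} (hq1 : 1 < q) (hq2 : q ≤ 2) (hA : 0 ≤ A) (hB : 0 ≤ B) :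
    (((A + B) / 2) ^ 2 + (q - 1) * ((A - B) / 2) ^ 2) ^ (q / 2) ≤ (A ^ q + B ^ q) / 2 := by
  wlog hAB : B ≤ A generalizing A B
  · have := this hB hA (by linarith)
    rw [add_comm B A, add_comm (B ^ q)] at this
    convert! this using 3
    ring
  rcases hA.eq_or_lt with hA0 | hA0
  · subst hA0
    have hB0 : B = 0 := le_antisymm hAB hB
    subst hB0
    have h1 : q / 2 ≠ 0 := by linarith
    have h2 : q ≠ 0 := by linarith
    simp [h1, h2]
  -- Normalization by the mean: A = S(1 + x) and B = S(1 − x) with 0 ≤ x ≤ 1.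
  set S := (A + B) / 2 with hS
  have hSpos : 0 < S := by positivity
  set x := (A - B) / 2 / S with hx
  have hx0 : 0 ≤ x := div_nonneg (by linarith) hSpos.le
  have hx1 : x ≤ 1 := (div_le_one hSpos).2 (by linarith)
  have hT : (A - B) / 2 = S * x := by rw [hx]; field_simp
  have hA' : A = S * (1 + x) := by linear_combination hS + hT
  have hB' : B = S * (1 - x) := by linear_combination hS - hT
  have h1 := one_add_mul_sq_le_rpow hq1 hq2 hx0 hx1
  have h2 := rpow_one_add_le_one_add_mul_self (s := (q - 1) * x ^ 2) (p := q / 2)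
    (by nlinarith [sq_nonneg x]) (by linarith) (by linarith)
  have h3 : S ^ 2 + (q - 1) * ((A - B) / 2) ^ 2 = S ^ 2 * (1 + (q - 1) * x ^ 2) := by
    rw [hT]; ring
  have h4 : (S ^ 2) ^ (q / 2) = S ^ q := by
    rw [← Real.rpow_natCast S 2, ← Real.rpow_mul hSpos.le]
    congr 1
    push_cast
    ring
  rw [h3, Real.mul_rpow (by positivity) (by nlinarith [sq_nonneg x]), h4]
  calc S ^ q * (1 + (q - 1) * x ^ 2) ^ (q / 2)
      ≤ S ^ q * (((1 + x) ^ q + (1 - x) ^ q) / 2) := by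
        gcongr
        exact h2.trans h1
    _ = (A ^ q + B ^ q) / 2 := by
        conv_rhs => rw [hA', hB']
        rw [Real.mul_rpow hSpos.le (by linarith), Real.mul_rpow hSpos.le (by linarith)]
        ring

/-- Since M² + (q−1)D² = (2−q)M² + (q−1)(M² + D²) has nonnegative weights, both hypotheses bound it
by the expression in `two_point_real`. This is where the midpoint bound on M is needed. -/
theorem two_point_norms {q A B M D : ℝ} (hq1 : 1 < q) (hq2 : q ≤ 2) (hA : 0 ≤ A) (hB : 0 ≤ B)
    (hM : 0 ≤ M) (h : M ^ 2 + D ^ 2 ≤ (A ^ 2 + B ^ 2) / 2) (hMAB : M ≤ (A + B) / 2) :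
    (M ^ 2 + (q - 1) * D ^ 2) ^ (q / 2) ≤ (A ^ q + B ^ q) / 2 := by
  refine le_trans ?_ (two_point_real hq1 hq2 hA hB)
  have h1 : M ^ 2 ≤ ((A + B) / 2) ^ 2 := by gcongr
  have h2 : (A ^ 2 + B ^ 2) / 2 = ((A + B) / 2) ^ 2 + ((A - B) / 2) ^ 2 := by ring
  refine Real.rpow_le_rpow (by nlinarith [sq_nonneg D, sq_nonneg M]) ?_ (by linarith)
  nlinarith

theorem two_point_ennreal {q : ℝ} {A B M D : ENNReal} (hq1 : 1 < q) (hq2 : q ≤ 2)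
    (h : M ^ 2 + D ^ 2 ≤ (A ^ 2 + B ^ 2) / 2) (hMAB : M ≤ (A + B) / 2) :
    (M ^ 2 + (ENNReal.ofReal √(q - 1) * D) ^ 2) ^ (q / 2) ≤ (A ^ q + B ^ q) / 2 := by
  have hq0 : 0 < q := by linarith
  by_cases hA : A = ⊤
  · simp [hA, hq0, ENNReal.top_div]
  by_cases hB : B = ⊤
  · simp [hB, hq0, ENNReal.top_div]
  have hfin : M ^ 2 + D ^ 2 < ⊤ := h.trans_lt (ENNReal.div_lt_top
    (ENNReal.add_lt_top.2 ⟨ENNReal.pow_lt_top (lt_top_iff_ne_top.2 hA),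
      ENNReal.pow_lt_top (lt_top_iff_ne_top.2 hB)⟩).ne two_ne_zero)
  have hM : M ≠ ⊤ := by rintro rfl; simp at hfin
  have hD : D ≠ ⊤ := by rintro rfl; simp at hfin
  lift A to NNReal using hA
  lift B to NNReal using hB
  lift M to NNReal using hM
  lift D to NNReal using hD
  have h' : ((M : ℝ) ^ 2 + (D : ℝ) ^ 2) ≤ ((A : ℝ) ^ 2 + (B : ℝ) ^ 2) / 2 := by
    have : ((M ^ 2 + D ^ 2 : NNReal) : ENNReal) ≤ ((A ^ 2 + B ^ 2) / 2 : NNReal) := by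
      rw [ENNReal.coe_div two_ne_zero]; push_cast; exact h
    exact_mod_cast this
  have hM' : (M : ℝ) ≤ ((A : ℝ) + B) / 2 := by
    have : (M : ENNReal) ≤ ((A + B) / 2 : NNReal) := by
      rw [ENNReal.coe_div two_ne_zero]; push_cast; exact hMAB
    exact_mod_cast this
  have h3 := two_point_norms hq1 hq2 A.2 B.2 M.2 h' hM'
  have h4 : (M ^ 2 + (Real.toNNReal √(q - 1) * D) ^ 2) ^ (q / 2) ≤ (A ^ q + B ^ q) / 2 := by
    rw [← NNReal.coe_le_coe]
    push_cast
    rw [Real.coe_toNNReal _ (Real.sqrt_nonneg _), mul_pow, Real.sq_sqrt (by linarith)]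
    exact h3
  have h5 := ENNReal.coe_le_coe.2 h4
  rw [ENNReal.coe_div two_ne_zero, ENNReal.coe_add, ENNReal.coe_rpow_of_nonneg _ hq0.le,
    ENNReal.coe_rpow_of_nonneg _ hq0.le, ENNReal.coe_rpow_of_nonneg _ (by linarith)] at h5
  push_cast at h5
  exact h5

/-! ### Uniform convexity of `ℓ^q` norms -/

/-- The triangle inequality for the ℓ^θ norm of the pairs (m_i, e_i), first for finite sums and then
in the limit. -/
theorem tsum_Lp_le {ι : Type*} {θ : ℝ} (hθ : 1 ≤ θ) (m e : ι → ENNReal) :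
    ((∑' i, m i) ^ θ + (∑' i, e i) ^ θ) ^ (1 / θ) ≤ ∑' i, (m i ^ θ + e i ^ θ) ^ (1 / θ) := by
  have hθ0 : 0 < θ := by linarith
  have hfin : ∀ s : Finset ι, ((∑ i ∈ s, m i) ^ θ + (∑ i ∈ s, e i) ^ θ) ^ (1 / θ) ≤
      ∑ i ∈ s, (m i ^ θ + e i ^ θ) ^ (1 / θ) := fun s => by
    classical
    induction s using Finset.induction_on with
    | empty => simp [hθ0]
    | insert i s hi ih =>
      simp only [Finset.sum_insert hi]
      have := ENNReal.Lp_add_le Finset.univ ![m i, e i] ![∑ i ∈ s, m i, ∑ i ∈ s, e i] hθ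
      simp only [Fin.sum_univ_two, Matrix.cons_val_zero, Matrix.cons_val_one] at this
      exact this.trans (by gcongr)
  have h1 : Tendsto (fun s : Finset ι => ((∑ i ∈ s, m i) ^ θ + (∑ i ∈ s, e i) ^ θ) ^ (1 / θ)) atTop
      (𝓝 (((∑' i, m i) ^ θ + (∑' i, e i) ^ θ) ^ (1 / θ))) := by
    have hm := ENNReal.summable (f := m) |>.hasSum
    have he := ENNReal.summable (f := e) |>.hasSum
    exact ((ENNReal.continuous_rpow_const.tendsto _).comp
      (((ENNReal.continuous_rpow_const.tendsto _).comp hm).add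
        ((ENNReal.continuous_rpow_const.tendsto _).comp he)))
  exact le_of_tendsto' h1 fun s => (hfin s).trans (ENNReal.sum_le_tsum s)

theorem ellNorm_ofReal {ι : Type*} {q : ℝ} (hq : 0 < q) (a : ι → ENNReal) :
    ellNorm (ENNReal.ofReal q) a = (∑' i, a i ^ q) ^ (1 / q) := by
  rw [ellNorm, if_neg ENNReal.ofReal_ne_top, ENNReal.toReal_ofReal hq.le]

theorem ellNorm_rpow {ι : Type*} {q : ℝ} (hq : 0 < q) (a : ι → ENNReal) (θ : ℝ) :
    ellNorm (ENNReal.ofReal q) a ^ θ = (∑' i, a i ^ q) ^ (θ / q) := by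
  rw [ellNorm_ofReal hq, ← ENNReal.rpow_mul]
  congr 1
  ring

/-- Passes 2-convexity from the entries to the ℓ^q norm for q ≤ 2: sum the two-point inequality,
bound the left side below by `tsum_Lp_le` with θ = 2/q, and finish with convexity of t^(2/q). It
serves for the inner ℓ^p norm, and for the outer one if q ≤ 2. -/
theorem two_convex_ellNorm {ι : Type*} {q : ℝ} (hq1 : 1 < q) (hq2 : q ≤ 2)
    {A B M D : ι → ENNReal} (h : ∀ i, M i ^ 2 + D i ^ 2 ≤ (A i ^ 2 + B i ^ 2) / 2)
    (hM : ∀ i, M i ≤ (A i + B i) / 2) :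
    ellNorm (ENNReal.ofReal q) M ^ 2 +
        (ENNReal.ofReal √(q - 1) * ellNorm (ENNReal.ofReal q) D) ^ 2 ≤
      (ellNorm (ENNReal.ofReal q) A ^ 2 + ellNorm (ENNReal.ofReal q) B ^ 2) / 2 := by
  have hq0 : 0 < q := by linarith
  have hθ : 1 ≤ 2 / q := (one_le_div hq0).2 hq2
  rw [← ellNorm_const_mul (by simpa using hq1.le)]
  set D' : ι → ENNReal := fun i => ENNReal.ofReal √(q - 1) * D i with hD'
  have hpt : ∀ i, (M i ^ 2 + D' i ^ 2) ^ (q / 2) ≤ (A i ^ q + B i ^ q) / 2 := fun i =>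
    two_point_ennreal hq1 hq2 (h i) (hM i)
  have hpow : ∀ x : ENNReal, (x ^ q) ^ (2 / q) = x ^ 2 := fun x => by
    rw [← ENNReal.rpow_mul, mul_div_cancel₀ _ hq0.ne']
    exact_mod_cast ENNReal.rpow_natCast x 2
  have h1 := tsum_Lp_le hθ (fun i => M i ^ q) fun i => D' i ^ q
  simp only [hpow, one_div_div] at h1
  have h2 : ∑' i, (M i ^ 2 + D' i ^ 2) ^ (q / 2) ≤ (∑' i, A i ^ q + ∑' i, B i ^ q) / 2 := by
    refine (ENNReal.tsum_le_tsum hpt).trans (le_of_eq ?_)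
    simp only [div_eq_mul_inv]
    rw [ENNReal.tsum_mul_right, ENNReal.tsum_add]
  have h3 := ENNReal.rpow_le_rpow (h1.trans h2) (zero_le_one.trans hθ)
  rw [← ENNReal.rpow_mul, div_mul_div_cancel₀ two_ne_zero, div_self hq0.ne', ENNReal.rpow_one] at h3
  have hsq : ∀ a : ι → ENNReal, ellNorm (ENNReal.ofReal q) a ^ 2 = (∑' i, a i ^ q) ^ (2 / q) :=
    fun a => by
      rw [← ellNorm_rpow hq0]
      exact_mod_cast (ENNReal.rpow_natCast _ 2).symm
  rw [hsq, hsq, hsq, hsq]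
  refine h3.trans ?_
  have h4 := ENNReal.rpow_arith_mean_le_arith_mean2_rpow 2⁻¹ 2⁻¹ (∑' i, A i ^ q) (∑' i, B i ^ q)
    ENNReal.inv_two_add_inv_two hθ
  simp only [div_eq_mul_inv] at h4 ⊢
  rw [mul_comm, mul_add, mul_comm _ (2⁻¹ : ENNReal), mul_add]
  exact h4

/-- For q ≥ 2 the power t^(q/2) is superadditive and convex, so the inequality holds entry by entry
and can be summed without loss of constants. -/
theorem rpow_convex_ellNorm {ι : Type*} {q : ℝ} (hq2 : 2 ≤ q)
    {A B M D : ι → ENNReal} (h : ∀ i, M i ^ 2 + D i ^ 2 ≤ (A i ^ 2 + B i ^ 2) / 2) :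
    ellNorm (ENNReal.ofReal q) M ^ q + ellNorm (ENNReal.ofReal q) D ^ q ≤
      (ellNorm (ENNReal.ofReal q) A ^ q + ellNorm (ENNReal.ofReal q) B ^ q) / 2 := by
  have hq0 : 0 < q := by linarith
  have hθ : 1 ≤ q / 2 := by linarith
  have hpow : ∀ x : ENNReal, (x ^ 2) ^ (q / 2) = x ^ q := fun x => by
    rw [← ENNReal.rpow_natCast, ← ENNReal.rpow_mul]
    congr 1
    push_cast
    ring
  have hpt : ∀ i, M i ^ q + D i ^ q ≤ (A i ^ q + B i ^ q) / 2 := fun i => by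
    have h1 := ENNReal.add_rpow_le_rpow_add (M i ^ 2) (D i ^ 2) hθ
    have h2 := ENNReal.rpow_le_rpow (h i) (zero_le_one.trans hθ)
    have h4 := ENNReal.rpow_arith_mean_le_arith_mean2_rpow 2⁻¹ 2⁻¹ (A i ^ 2) (B i ^ 2)
      ENNReal.inv_two_add_inv_two hθ
    rw [hpow, hpow] at h1 h4
    refine h1.trans (h2.trans ?_)
    simp only [div_eq_mul_inv] at h4 ⊢
    rw [mul_comm, mul_add, mul_comm _ (2⁻¹ : ENNReal), mul_add]
    exact h4
  simp only [ellNorm_rpow hq0, div_self hq0.ne', ENNReal.rpow_one]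
  rw [← ENNReal.tsum_add, ← ENNReal.tsum_add]
  refine (ENNReal.tsum_le_tsum hpt).trans (le_of_eq ?_)
  simp only [div_eq_mul_inv]
  rw [ENNReal.tsum_mul_right]

end BesovTikhonov

namespace BesovTikhonov

/-! ### Sequence norms: comparison and lower semicontinuity -/

theorem ellNorm_two {ι : Type*} (a : ι → ENNReal) :
    ellNorm 2 a = (∑' i, a i ^ 2) ^ (1 / 2 : ℝ) := by
  rw [ellNorm, if_neg (by simp)]
  simp

theorem ellNorm_two_sq {ι : Type*} (a : ι → ENNReal) : ellNorm 2 a ^ 2 = ∑' i, a i ^ 2 := by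
  rw [ellNorm_two, ← ENNReal.rpow_natCast, ← ENNReal.rpow_mul]
  simp

theorem le_ellNorm {ι : Type*} {q : ENNReal} (hq : 1 ≤ q) (a : ι → ENNReal) (i : ι) :
    a i ≤ ellNorm q a := by
  unfold ellNorm
  split_ifs with h
  · exact le_iSup a i
  · have h0 : 0 < q.toReal := ENNReal.toReal_pos (zero_lt_one.trans_le hq).ne' h
    calc a i = (a i ^ q.toReal) ^ (1 / q.toReal) := by
          rw [← ENNReal.rpow_mul, mul_one_div_cancel h0.ne', ENNReal.rpow_one]
      _ ≤ _ := ENNReal.rpow_le_rpow (ENNReal.le_tsum i) (by positivity)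

/-- Every entry is at most the ℓ^p norm N, so a_i² ≤ a_i^p N^(2−p). -/
theorem ellNorm_two_le {ι : Type*} {p : ℝ} (hp1 : 1 ≤ p) (hp2 : p ≤ 2) (a : ι → ENNReal) :
    ellNorm 2 a ≤ ellNorm (ENNReal.ofReal p) a := by
  have hp0 : 0 < p := by linarith
  set N := ellNorm (ENNReal.ofReal p) a
  have h1 : ∀ i, a i ^ 2 ≤ a i ^ p * N ^ (2 - p) := fun i => by
    have : a i ^ 2 = a i ^ p * a i ^ (2 - p) := by
      rw [← ENNReal.rpow_add_of_nonneg _ _ hp0.le (by linarith), add_sub_cancel]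
      exact_mod_cast (ENNReal.rpow_natCast _ 2).symm
    rw [this]
    exact mul_le_mul_right (ENNReal.rpow_le_rpow
      (le_ellNorm (q := ENNReal.ofReal p) (by simpa using hp1) a i) (by linarith)) _
  have h2 : ∑' i, a i ^ p = N ^ p := by
    simp only [N, ellNorm_rpow hp0, div_self hp0.ne', ENNReal.rpow_one]
  rw [← ENNReal.pow_le_pow_left_iff two_ne_zero, ellNorm_two_sq]
  refine (ENNReal.tsum_le_tsum h1).trans (le_of_eq ?_)
  rw [ENNReal.tsum_mul_right, h2, ← ENNReal.rpow_add_of_nonneg _ _ hp0.le (by linarith),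
    add_sub_cancel]
  exact_mod_cast ENNReal.rpow_natCast _ 2

theorem rpow_le_liminf {q : ℝ} (hq : 0 ≤ q) {a : ENNReal} {b : ℕ → ENNReal}
    (h : a ≤ liminf b atTop) : a ^ q ≤ liminf (fun m => b m ^ q) atTop := by
  refine (ENNReal.rpow_le_rpow h hq).trans (le_of_eq ?_)
  exact (ENNReal.monotone_rpow_of_nonneg hq).map_liminf_of_continuousAt b
    ENNReal.continuous_rpow_const.continuousAt

/-- Fatou's lemma for `ℓ^q` norms. -/
theorem ellNorm_le_liminf {ι : Type*} {q : ℝ} (hq : 0 < q) {a : ι → ENNReal}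
    {b : ℕ → ι → ENNReal} (h : ∀ i, a i ≤ liminf (fun m => b m i) atTop) :
    ellNorm (ENNReal.ofReal q) a ≤ liminf (fun m => ellNorm (ENNReal.ofReal q) (b m)) atTop := by
  simp only [ellNorm_ofReal hq]
  refine rpow_le_liminf (by positivity) ?_
  refine (ENNReal.tsum_le_tsum fun i => rpow_le_liminf hq.le (h i)).trans ?_
  let _ : MeasurableSpace ι := ⊤
  have := lintegral_liminf_le (u := atTop) (μ := Measure.count) (f := fun m i => b m i ^ q)
    fun _ => measurable_from_top
  simpa [lintegral_count] using this

/-! ### Blocks of wavelet coefficients -/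

/-- The norm of the wavelet coefficients of level `j`. -/
def WaveletSystem.block {d σ : ℕ} (W : WaveletSystem d σ) (p : ℝ) (u : Distr d σ) (j : ℕ) :
    ENNReal :=
  ENNReal.ofReal ((2 : ℝ) ^ ((j : ℝ) * d * (1 / 2 - 1 / p))) *
    ellNorm (ENNReal.ofReal p) fun l => ‖u.eval (W.φ j l)‖ₑ

variable {d σ : ℕ} (W : WaveletSystem d σ)

theorem WaveletSystem.norm_eq_block (s p : ℝ) (q : ENNReal) (u : Distr d σ) :
    W.norm s p q u =
      ellNorm q fun j : ℕ => ENNReal.ofReal ((2 : ℝ) ^ ((j : ℝ) * s)) * W.block p u j := by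
  unfold WaveletSystem.norm waveletSeqNorm WaveletSystem.block
  congr 1
  funext j
  rw [ENNReal.ofReal_mul (by positivity), mul_assoc]

theorem WaveletSystem.norm_zero_eq_block (p : ℝ) (q : ENNReal) (u : Distr d σ) :
    W.norm 0 p q u = ellNorm q (W.block p u) := by
  rw [W.norm_eq_block]
  simp

theorem WaveletSystem.block_add_le {p : ℝ} (hp : 1 ≤ p) (u v : Distr d σ) (j : ℕ) :
    W.block p (u + v) j ≤ W.block p u j + W.block p v j := by
  have hp' : 1 ≤ ENNReal.ofReal p := by simpa using hp
  unfold WaveletSystem.block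
  rw [← mul_add]
  gcongr
  refine le_trans (ellNorm_mono _ fun l => ?_) (ellNorm_add_le hp' _ _)
  simpa [Distr.eval_add] using enorm_add_le (u.eval (W.φ j l)) (v.eval (W.φ j l))

theorem WaveletSystem.block_smul {p : ℝ} (hp : 1 ≤ p) (c : ℝ) (u : Distr d σ) (j : ℕ) :
    W.block p (c • u) j = ‖c‖ₑ * W.block p u j := by
  have hp' : 1 ≤ ENNReal.ofReal p := by simpa using hp
  have h : (ellNorm (ENNReal.ofReal p) fun l => ‖(c • u).eval (W.φ j l)‖ₑ) =
      ‖c‖ₑ * ellNorm (ENNReal.ofReal p) fun l => ‖u.eval (W.φ j l)‖ₑ := by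
    rw [← ellNorm_const_mul hp']
    congr 1
    funext l
    simp [Distr.eval_smul, enorm_mul]
  unfold WaveletSystem.block
  rw [h, mul_left_comm]

theorem enorm_half : ‖(1 / 2 : ℝ)‖ₑ = (2 : ENNReal)⁻¹ := by
  rw [← ofReal_norm, Real.norm_of_nonneg (by norm_num), one_div,
    ENNReal.ofReal_inv_of_pos two_pos]
  simp

theorem WaveletSystem.block_midpoint_le {p : ℝ} (hp : 1 ≤ p) (u v : Distr d σ) (j : ℕ) :
    W.block p ((1 / 2 : ℝ) • (u + v)) j ≤ (W.block p u j + W.block p v j) / 2 := by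
  rw [W.block_smul hp, enorm_half, mul_comm, ← div_eq_mul_inv]
  gcongr
  exact W.block_add_le hp u v j

theorem enorm_parallelogram (x y : ℝ) :
    ‖1 / 2 * (x + y)‖ₑ ^ 2 + ‖1 / 2 * (x - y)‖ₑ ^ 2 = (‖x‖ₑ ^ 2 + ‖y‖ₑ ^ 2) / 2 := by
  have h : ∀ t : ℝ, ‖t‖ₑ ^ 2 = ENNReal.ofReal (t ^ 2) := fun t => by
    rw [← ofReal_norm, ← ENNReal.ofReal_pow (norm_nonneg _), Real.norm_eq_abs, sq_abs]
  have h2 : (2 : ENNReal) = ENNReal.ofReal 2 := by simp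
  rw [h, h, h, h, ← ENNReal.ofReal_add (by positivity) (by positivity),
    ← ENNReal.ofReal_add (by positivity) (by positivity), h2,
    ← ENNReal.ofReal_div_of_pos two_pos]
  congr 1
  ring

/-- The scalar parallelogram identity supplies the entrywise hypothesis of `two_convex_ellNorm`. -/
theorem WaveletSystem.block_two_convex {p : ℝ} (hp1 : 1 < p) (hp2 : p ≤ 2) (u v : Distr d σ)
    (j : ℕ) : W.block p ((1 / 2 : ℝ) • (u + v)) j ^ 2 +
      (ENNReal.ofReal √(p - 1) * W.block p ((1 / 2 : ℝ) • (u - v)) j) ^ 2 ≤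
        (W.block p u j ^ 2 + W.block p v j ^ 2) / 2 := by
  have h := two_convex_ellNorm hp1 hp2 (A := fun l => ‖u.eval (W.φ j l)‖ₑ)
    (B := fun l => ‖v.eval (W.φ j l)‖ₑ)
    (M := fun l => ‖((1 / 2 : ℝ) • (u + v)).eval (W.φ j l)‖ₑ)
    (D := fun l => ‖((1 / 2 : ℝ) • (u - v)).eval (W.φ j l)‖ₑ)
    (fun l => (enorm_parallelogram (u.eval (W.φ j l)) (v.eval (W.φ j l))).le)
    (fun l => by
      rw [Distr.eval_smul, enorm_mul, enorm_half, mul_comm, ← div_eq_mul_inv, Distr.eval_add]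
      gcongr
      exact enorm_add_le _ _)
  unfold WaveletSystem.block
  set w := ENNReal.ofReal ((2 : ℝ) ^ ((j : ℝ) * d * (1 / 2 - 1 / p)))
  have h2 := mul_le_mul_right h (w ^ 2)
  rw [mul_left_comm, mul_pow w, mul_pow w, mul_pow w, mul_pow w]
  simp only [div_eq_mul_inv] at h2 ⊢
  rw [mul_add, ← mul_assoc, mul_add] at h2
  exact h2

/-- The blocks are 2-convex because p ≤ 2. The outer norm preserves power type 2 if q ≤ 2 and turns
it into power type q if q ≥ 2, which explains the exponent. -/
theorem WaveletSystem.norm_convex {p q : ℝ} (hp1 : 1 < p) (hp2 : p ≤ 2) (hq1 : 1 < q) :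
    ∃ κ : ℝ, 0 < κ ∧ ∀ u v : Distr d σ,
      W.norm 0 p (ENNReal.ofReal q) ((1 / 2 : ℝ) • (u + v)) ^ max 2 (max p q) +
        (ENNReal.ofReal κ * W.norm 0 p (ENNReal.ofReal q) ((1 / 2 : ℝ) • (u - v))) ^
          max 2 (max p q) ≤
        (W.norm 0 p (ENNReal.ofReal q) u ^ max 2 (max p q) +
          W.norm 0 p (ENNReal.ofReal q) v ^ max 2 (max p q)) / 2 := by
  have hqe : 1 ≤ ENNReal.ofReal q := by simpa using hq1.le
  have hκp : 0 < √(p - 1) := Real.sqrt_pos.2 (by linarith)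
  rcases le_total q 2 with hq2 | hq2
  · have hr : max 2 (max p q) = 2 := max_eq_left (max_le hp2 hq2)
    refine ⟨√(q - 1) * √(p - 1), mul_pos (Real.sqrt_pos.2 (by linarith)) hκp, fun u v => ?_⟩
    have h := two_convex_ellNorm hq1 hq2 (fun j => W.block_two_convex hp1 hp2 u v j)
      (fun j => W.block_midpoint_le hp1.le u v j)
    rw [ellNorm_const_mul hqe] at h
    simp only [hr, W.norm_zero_eq_block]
    rw [ENNReal.ofReal_mul (Real.sqrt_nonneg _), mul_assoc]
    have h2 : ∀ x : ENNReal, x ^ (2 : ℝ) = x ^ 2 := fun x => by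
      exact_mod_cast ENNReal.rpow_natCast x 2
    simp only [h2]
    exact h
  · have hr : max 2 (max p q) = q := by
      rw [max_eq_right (hp2.trans hq2), max_eq_right hq2]
    refine ⟨√(p - 1), hκp, fun u v => ?_⟩
    have h := rpow_convex_ellNorm hq2 (fun j => W.block_two_convex hp1 hp2 u v j)
    rw [ellNorm_const_mul hqe] at h
    simp only [hr, W.norm_zero_eq_block]
    exact h

/-- Uniform convexity of the norm of `B^0_{p,q}`. -/
theorem XSpace.norm_convex (p q : ℝ) [hp : Fact (1 < p)] [hq : Fact (1 < q)] (hp2 : p ≤ 2) :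
    ∃ κ : ℝ, 0 < κ ∧ ∀ f g : XSpace W p q,
      ‖(1 / 2 : ℝ) • (f + g)‖ ^ max 2 (max p q) + κ * ‖f - g‖ ^ max 2 (max p q) ≤
        (‖f‖ ^ max 2 (max p q) + ‖g‖ ^ max 2 (max p q)) / 2 := by
  obtain ⟨κ, hκ, h⟩ := W.norm_convex hp.out hp2 hq.out
  set r := max 2 (max p q)
  have hr : 0 < r := two_pos.trans_le (le_max_left _ _)
  refine ⟨(κ * (1 / 2)) ^ r, by positivity, fun f g => ?_⟩
  have hfin : ∀ f : XSpace W p q,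
      W.norm 0 p (ENNReal.ofReal q) (XSpace.toDistr W p q f) ≠ ⊤ := fun f =>
    (show W.norm 0 p (ENNReal.ofReal q) (XSpace.toDistr W p q f) < ⊤ from f.2).ne
  have hn : ∀ f : XSpace W p q, W.norm 0 p (ENNReal.ofReal q) (XSpace.toDistr W p q f) =
      ENNReal.ofReal ‖f‖ := fun f => (ENNReal.ofReal_toReal (hfin f)).symm
  have h1 := h (XSpace.toDistr W p q f) (XSpace.toDistr W p q g)
  rw [← map_add, ← map_sub, ← map_smul, ← map_smul, hn, hn, hn, hn,
    ← ENNReal.ofReal_mul hκ.le, ENNReal.ofReal_rpow_of_nonneg (norm_nonneg _) hr.le,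
    ENNReal.ofReal_rpow_of_nonneg (norm_nonneg _) hr.le,
    ENNReal.ofReal_rpow_of_nonneg (norm_nonneg _) hr.le,
    ENNReal.ofReal_rpow_of_nonneg (by positivity) hr.le,
    ← ENNReal.ofReal_add (by positivity) (by positivity),
    ← ENNReal.ofReal_add (by positivity) (by positivity),
    show (2 : ENNReal) = ENNReal.ofReal 2 by simp, ← ENNReal.ofReal_div_of_pos two_pos,
    ENNReal.ofReal_le_ofReal_iff (by positivity)] at h1
  have h2 : ‖(1 / 2 : ℝ) • (f - g)‖ = 1 / 2 * ‖f - g‖ := by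
    rw [_root_.norm_smul, Real.norm_of_nonneg (by norm_num)]
  rw [h2, ← mul_assoc, Real.mul_rpow (by positivity) (norm_nonneg _)] at h1
  exact h1

end BesovTikhonov

namespace BesovTikhonov

/-! ### Sobolev norms through Fourier coefficients -/

theorem besovNorm_two_two {d : ℕ} (s : ℝ) (c : (Fin d → ℤ) → ℂ) :
    besovNorm s 2 2 c =
      ellNorm 2 fun j : ℕ => ENNReal.ofReal ((2 : ℝ) ^ ((j : ℝ) * s) * blockNorm c j) := by
  unfold besovNorm
  congr 1
  funext j
  rw [show ENNReal.ofReal 2 = 2 by simp, eLpNorm_two_sum, ENNReal.ofReal_mul (by positivity)]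
  rfl

theorem besovNorm_two_two_sq {d : ℕ} (s : ℝ) (c : (Fin d → ℤ) → ℂ) :
    besovNorm s 2 2 c ^ 2 =
      ∑' j : ℕ, ENNReal.ofReal (((2 : ℝ) ^ ((j : ℝ) * s) * blockNorm c j) ^ 2) := by
  rw [besovNorm_two_two, ellNorm_two_sq]
  simp only [ENNReal.ofReal_pow (mul_nonneg (Real.rpow_nonneg two_pos.le _) (blockNorm_nonneg _ _))]

theorem blockNorm_le_of_besovNorm_le {d : ℕ} {b E : ℝ} (hE : 0 ≤ E) {c : (Fin d → ℤ) → ℂ}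
    (h : besovNorm (-b) 2 2 c ≤ ENNReal.ofReal E) (j : ℕ) :
    blockNorm c j ≤ (2 : ℝ) ^ ((j : ℝ) * b) * E := by
  rw [besovNorm_two_two] at h
  have h1 := (le_ellNorm (by norm_num) _ j).trans h
  rw [ENNReal.ofReal_le_ofReal_iff hE, mul_neg, Real.rpow_neg two_pos.le,
    inv_mul_le_iff₀ (by positivity)] at h1
  exact h1

theorem coeff_add {d σ : ℕ} (u v : Distr d σ) : coeff (u + v) = coeff u + coeff v := by
  funext z
  apply Complex.ext
  · rfl
  · simp only [coeff, Distr.eval_add, Pi.add_apply, Complex.add_im]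
    ring

theorem coeff_smul {d σ : ℕ} (t : ℝ) (u : Distr d σ) : coeff (t • u) = (t : ℂ) • coeff u := by
  funext z
  apply Complex.ext <;> simp [coeff, Distr.eval_smul]

theorem besovNorm_add_le {d : ℕ} (s : ℝ) (c e : (Fin d → ℤ) → ℂ) :
    besovNorm s 2 2 (c + e) ≤ besovNorm s 2 2 c + besovNorm s 2 2 e := by
  refine le_trans (ellNorm_mono _ fun j => ?_) (ellNorm_add_le (by norm_num) _ _)
  rw [← mul_add]
  gcongr
  refine le_trans (le_of_eq ?_) (eLpNorm_add_le (Continuous.aestronglyMeasurable (by fun_prop))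
    (Continuous.aestronglyMeasurable (by fun_prop)) (by simp))
  congr 1
  funext x
  simp [add_mul, Finset.sum_add_distrib]

theorem besovNorm_smul {d : ℕ} (s : ℝ) (t : ℂ) (c : (Fin d → ℤ) → ℂ) :
    besovNorm s 2 2 (t • c) = ‖t‖ₑ * besovNorm s 2 2 c := by
  unfold besovNorm
  rw [← ellNorm_const_mul (by norm_num)]
  congr 1
  funext j
  rw [mul_left_comm, ← eLpNorm_const_smul]
  congr 2
  funext x
  simp [Finset.mul_sum, mul_assoc]

/-! ### Embeddings of `B^0_{p,q}` -/

theorem exists_cBound {d σ : ℕ} (φ : CSpace d σ) : ∃ M, CBound φ M := by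
  have h : ∀ k : ℕ, ∃ M : ℝ, k ≤ σ → ∀ x, ‖iteratedFDeriv ℝ k (lift φ.1) x‖ ≤ M := fun k => by
    by_cases hk : k ≤ σ
    · refine ⟨‖torusDeriv φ hk‖, fun _ x => ?_⟩
      rw [← torusDeriv_proj φ hk]
      exact (torusDeriv φ hk).norm_coe_le_norm _
    · exact ⟨0, fun h => absurd h hk⟩
  choose g hg using h
  refine ⟨∑ k ∈ Finset.range (σ + 1), |g k|, fun k hk x => (hg k hk x).trans ?_⟩
  exact (le_abs_self _).trans (Finset.single_le_sum (f := fun k => |g k|)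
    (fun _ _ => abs_nonneg _) (Finset.mem_range.2 (Nat.lt_succ_of_le hk)))

variable {d σ : ℕ} (W : WaveletSystem d σ)

theorem WaveletSystem.block_two_le {p : ℝ} (hp1 : 1 ≤ p) (hp2 : p ≤ 2) (u : Distr d σ) (j : ℕ) :
    W.block 2 u j ≤ ENNReal.ofReal ((2 : ℝ) ^ ((j : ℝ) * (d / p - d / 2))) * W.block p u j := by
  unfold WaveletSystem.block
  rw [← mul_assoc, ← ENNReal.ofReal_mul (by positivity), ← Real.rpow_add two_pos]
  have h1 : (j : ℝ) * (d / p - d / 2) + (j : ℝ) * d * (1 / 2 - 1 / p) = 0 := by ring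
  have h2 : (j : ℝ) * d * (1 / 2 - 1 / 2) = 0 := by ring
  rw [h1, h2, Real.rpow_zero, ENNReal.ofReal_one, one_mul, one_mul,
    show ENNReal.ofReal 2 = 2 by simp]
  exact ellNorm_two_le hp1 hp2 _

/-- A Sobolev-type embedding: replacing ℓ^p by ℓ² at level j costs 2^(j(d/p − d/2)), and the gap to
b leaves a convergent geometric series. -/
theorem exists_besovNorm_le_norm {p q b : ℝ} (hp1 : 1 < p) (hp2 : p ≤ 2) (hq1 : 1 < q)
    (hb : d / p - d / 2 < b) (hbσ : b < σ) : ∃ C : ℝ, 0 ≤ C ∧ ∀ u : Distr d σ,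
      besovNorm (-b) 2 2 (coeff u) ≤ ENNReal.ofReal C * W.norm 0 p (ENNReal.ofReal q) u := by
  have hp0 : 0 < p := by linarith
  have ha : 0 ≤ (d : ℝ) / p - d / 2 := sub_nonneg.2 (by gcongr)
  obtain ⟨C, hC, h⟩ := W.norm_equiv (-b) 2 2 (by rw [abs_neg, abs_of_pos] <;> linarith)
    (by norm_num) (by norm_num)
  set ρ : ℝ := (2 : ℝ) ^ (2 * (d / p - d / 2 - b)) with hρ
  have hρ0 : 0 ≤ ρ := by positivity
  have hρ1 : ρ < 1 := Real.rpow_lt_one_of_one_lt_of_neg one_lt_two (by linarith)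
  refine ⟨C * √(1 - ρ)⁻¹, by positivity, fun u => (h u).2.trans ?_⟩
  rw [ENNReal.ofReal_mul hC.le, mul_assoc]
  gcongr
  change W.norm (-b) 2 2 u ≤ _
  set N := W.norm 0 p (ENNReal.ofReal q) u with hN
  rw [← ENNReal.pow_le_pow_left_iff two_ne_zero, W.norm_eq_block, ellNorm_two_sq, mul_pow,
    ← ENNReal.ofReal_pow (Real.sqrt_nonneg _),
    Real.sq_sqrt (inv_nonneg.2 (by linarith)), ← tsum_geometric_of_lt_one hρ0 hρ1,
    ENNReal.ofReal_tsum_of_nonneg (fun _ => by positivity)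
      (summable_geometric_of_lt_one hρ0 hρ1), ← ENNReal.tsum_mul_right]
  refine ENNReal.tsum_le_tsum fun j => ?_
  have h1 : W.block p u j ≤ N := by
    rw [hN, W.norm_zero_eq_block]
    exact le_ellNorm (by simpa using hq1.le) _ j
  have h2 : ENNReal.ofReal (ρ ^ j) =
      (ENNReal.ofReal ((2 : ℝ) ^ ((j : ℝ) * -b)) *
        ENNReal.ofReal ((2 : ℝ) ^ ((j : ℝ) * (d / p - d / 2)))) ^ 2 := by
    rw [← ENNReal.ofReal_mul (by positivity), ← ENNReal.ofReal_pow (by positivity),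
      ← Real.rpow_add two_pos, hρ, ← Real.rpow_natCast, ← Real.rpow_natCast,
      ← Real.rpow_mul two_pos.le, ← Real.rpow_mul two_pos.le]
    congr 2
    push_cast
    ring
  rw [h2, ← mul_pow, mul_assoc]
  exact pow_le_pow_left' (mul_le_mul_right
    ((W.block_two_le hp1.le hp2 u j).trans (mul_le_mul_right h1 _)) _) 2

section

variable (p q : ℝ) [hp : Fact (1 < p)] [hq : Fact (1 < q)]

theorem XSpace.norm_lt_top (f : XSpace W p q) :
    W.norm 0 p (ENNReal.ofReal q) (XSpace.toDistr W p q f) < ⊤ := f.2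

theorem XSpace.ofReal_norm_eq (f : XSpace W p q) :
    ENNReal.ofReal ‖f‖ = W.norm 0 p (ENNReal.ofReal q) (XSpace.toDistr W p q f) :=
  ENNReal.ofReal_toReal (XSpace.norm_lt_top W p q f).ne

theorem XSpace.coeff_add (f g : XSpace W p q) :
    XSpace.coeff (f + g) = XSpace.coeff f + XSpace.coeff g := by
  rw [XSpace.coeff, map_add, BesovTikhonov.coeff_add]
  rfl

theorem XSpace.coeff_smul (t : ℝ) (f : XSpace W p q) :
    XSpace.coeff (t • f) = (t : ℂ) • XSpace.coeff f := by
  rw [XSpace.coeff, map_smul, BesovTikhonov.coeff_smul]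
  rfl

theorem XSpace.exists_besovNorm_le (hp2 : p ≤ 2) {b : ℝ} (hb : d / p - d / 2 < b) (hbσ : b < σ) :
    ∃ C : ℝ, 0 ≤ C ∧ ∀ f : XSpace W p q,
      besovNorm (-b) 2 2 (XSpace.coeff f) ≤ ENNReal.ofReal (C * ‖f‖) := by
  obtain ⟨C, hC, h⟩ := exists_besovNorm_le_norm W hp.out hp2 hq.out hb hbσ
  refine ⟨C, hC, fun f => ?_⟩
  rw [ENNReal.ofReal_mul hC, XSpace.ofReal_norm_eq]
  exact h _

/-- The norm tests a distribution only against wavelets; this bound covers all test functions, so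
that norm convergence implies convergence as distributions. -/
theorem XSpace.exists_abs_eval_le (hp2 : p ≤ 2) {a : ℝ} (ha : d / p - d / 2 < a) (haσ : a < σ) :
    ∃ C : ℝ, 0 ≤ C ∧ ∀ (f : XSpace W p q) (φ : CSpace d σ) (M : ℝ), CBound φ M →
      |(XSpace.toDistr W p q f).eval φ| ≤ C * ‖f‖ * M := by
  obtain ⟨C, hC, h⟩ := XSpace.exists_besovNorm_le W p q hp2 ha haσ
  obtain ⟨C', hC', h'⟩ := BesovTikhonov.exists_abs_eval_le (d := d) haσ
  refine ⟨C' * C, by positivity, fun f φ M hM => ?_⟩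
  rw [mul_assoc C']
  exact h' _ _ (blockNorm_le_of_besovNorm_le (by positivity) (h f)) φ M hM

/-- The instance on `XSpace` is only a seminorm; definiteness turns zero distance between two
minimizers into equality. -/
theorem XSpace.eq_zero_of_norm_eq_zero (hp2 : p ≤ 2) {a : ℝ} (ha : d / p - d / 2 < a) (haσ : a < σ)
    {f : XSpace W p q} (hf : ‖f‖ = 0) : f = 0 := by
  obtain ⟨C, -, h⟩ := XSpace.exists_abs_eval_le W p q hp2 ha haσ
  refine Subtype.ext (Subtype.ext (LinearMap.ext fun φ => ?_))
  obtain ⟨M, hM⟩ := exists_cBound φ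
  have := h f φ M hM
  rw [hf, mul_zero, zero_mul] at this
  exact abs_eq_zero.1 (le_antisymm this (abs_nonneg _))

/-- Fatou's lemma, once within each level and once over the levels. -/
theorem WaveletSystem.norm_le_of_tendsto {u : ℕ → Distr d σ} {v : Distr d σ}
    (h : ∀ φ, Tendsto (fun n => (u n).eval φ) atTop (𝓝 (v.eval φ))) {K : ENNReal}
    (hK : ∀ᶠ n in atTop, W.norm 0 p (ENNReal.ofReal q) (u n) ≤ K) :
    W.norm 0 p (ENNReal.ofReal q) v ≤ K := by
  have hp0 : 0 < p := by linarith [hp.out]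
  have hq0 : 0 < q := by linarith [hq.out]
  simp only [W.norm_zero_eq_block] at hK ⊢
  have h1 : ∀ j, W.block p v j ≤ liminf (fun n => W.block p (u n) j) atTop := fun j => by
    unfold WaveletSystem.block
    have h2 : ellNorm (ENNReal.ofReal p) (fun l => ‖v.eval (W.φ j l)‖ₑ) ≤
        liminf (fun n => ellNorm (ENNReal.ofReal p) fun l => ‖(u n).eval (W.φ j l)‖ₑ) atTop :=
      ellNorm_le_liminf hp0 fun l => ((h (W.φ j l)).enorm.liminf_eq).ge
    refine (mul_le_mul_right h2 _).trans (le_of_eq ?_)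
    exact Monotone.map_liminf_of_continuousAt (fun x y hxy => mul_le_mul_right hxy _) _
      (ENNReal.continuous_const_mul ENNReal.ofReal_ne_top).continuousAt
  refine (ellNorm_le_liminf hq0 h1).trans ?_
  exact liminf_le_of_frequently_le' hK.frequently

/-- A Cauchy sequence converges on every test function; the uniform bound makes the limit a
distribution, and lower semicontinuity, applied to the sequence and to its differences, gives finite
norm and norm convergence. -/
theorem XSpace.completeSpace (hp2 : p ≤ 2) {a : ℝ} (ha : d / p - d / 2 < a) (haσ : a < σ) :
    CompleteSpace (XSpace W p q) := by
  obtain ⟨C, hC, h⟩ := XSpace.exists_abs_eval_le W p q hp2 ha haσ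
  refine Metric.complete_of_cauchySeq_tendsto fun f hf => ?_
  have hcau : ∀ φ, CauchySeq fun n => (XSpace.toDistr W p q (f n)).eval φ := fun φ => by
    obtain ⟨M, hM⟩ := exists_cBound φ
    have hM0 : 0 ≤ M := (norm_nonneg _).trans (hM 0 (Nat.zero_le _) 0)
    refine Metric.cauchySeq_iff'.2 fun ε hε => ?_
    obtain ⟨N, hN⟩ := Metric.cauchySeq_iff'.1 hf (ε / (C * M + 1)) (by positivity)
    refine ⟨N, fun n hn => ?_⟩
    have h1 := h (f n - f N) φ M hM
    have h2 := hN n hn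
    rw [dist_eq_norm, lt_div_iff₀ (by positivity)] at h2
    have h3 : (XSpace.toDistr W p q (f n - f N)).eval φ =
        (XSpace.toDistr W p q (f n)).eval φ - (XSpace.toDistr W p q (f N)).eval φ := by
      rw [map_sub]; rfl
    rw [Real.dist_eq, ← h3]
    nlinarith [norm_nonneg (f n - f N)]
  choose v hv using fun φ => cauchySeq_tendsto_of_complete (hcau φ)
  set v' : CSpace d σ →ₗ[ℝ] ℝ := linearMapOfTendsto v
    (fun n => (distrSubmodule d σ).subtype (XSpace.toDistr W p q (f n))) (tendsto_pi_nhds.2 hv)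
  obtain ⟨B, hB⟩ : ∃ B, ∀ n, ‖f n‖ ≤ B := by
    obtain ⟨B, hB⟩ := hf.isBounded_range.exists_norm_le
    exact ⟨B, fun n => hB _ (Set.mem_range_self n)⟩
  let w : Distr d σ := ⟨v', C * B, fun φ M hM => by
    have hM0 : 0 ≤ M := (norm_nonneg _).trans (hM 0 (Nat.zero_le _) 0)
    refine le_of_tendsto' (hv φ).abs fun n => (h (f n) φ M hM).trans ?_
    gcongr
    exact hB n⟩
  have hw : ∀ φ, Tendsto (fun n => (XSpace.toDistr W p q (f n)).eval φ) atTop (𝓝 (w.eval φ)) := hv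
  have hwn : W.norm 0 p (ENNReal.ofReal q) w < ⊤ := by
    refine (W.norm_le_of_tendsto p q hw (K := ENNReal.ofReal B)
      (Eventually.of_forall fun n => ?_)).trans_lt ENNReal.ofReal_lt_top
    rw [← XSpace.ofReal_norm_eq]
    exact ENNReal.ofReal_le_ofReal (hB n)
  let g : XSpace W p q := ⟨w, hwn⟩
  refine ⟨g, Metric.tendsto_atTop.2 fun ε hε => ?_⟩
  obtain ⟨N, hN⟩ := Metric.cauchySeq_iff.1 hf (ε / 2) (by positivity)
  refine ⟨N, fun n hn => ?_⟩
  have h1 : W.norm 0 p (ENNReal.ofReal q) (XSpace.toDistr W p q (f n - g)) ≤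
      ENNReal.ofReal (ε / 2) := by
    refine W.norm_le_of_tendsto p q (u := fun m => XSpace.toDistr W p q (f n - f m)) (fun φ => ?_)
      (eventually_atTop.2 ⟨N, fun m hm => ?_⟩)
    · have h3 : ∀ g', (XSpace.toDistr W p q (f n - g')).eval φ =
          (XSpace.toDistr W p q (f n)).eval φ - (XSpace.toDistr W p q g').eval φ := fun g' => by
        rw [map_sub]; rfl
      simp only [h3]
      exact tendsto_const_nhds.sub (hw φ)
    · rw [← XSpace.ofReal_norm_eq, ← dist_eq_norm]
      exact ENNReal.ofReal_le_ofReal (hN n hn m hm).le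
  rw [← XSpace.ofReal_norm_eq, ENNReal.ofReal_le_ofReal_iff (by positivity)] at h1
  rw [dist_eq_norm]
  linarith

/-- The embedding of `B^0_{p,q}` into `B^{-a}_{2,2}` is compact. -/
theorem XSpace.exists_subseq_cauchy (hp2 : p ≤ 2) {a : ℝ} (ha : d / p - d / 2 < a) (haσ : a < σ)
    {B : ℝ} (f : ℕ → XSpace W p q) (hf : ∀ n, ‖f n‖ ≤ B) :
    ∃ φ : ℕ → ℕ, StrictMono φ ∧ ∀ ε > 0, ∃ N, ∀ m ≥ N, ∀ n ≥ N,
      besovNorm (-a) 2 2 (XSpace.coeff (f (φ m) - f (φ n))) ≤ ENNReal.ofReal ε := by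
  -- Boundedness in the stronger space of order −b makes the levels of the order −a norm decay
  -- geometrically and uniformly along the sequence.
  obtain ⟨b, hb, hba⟩ := exists_between ha
  obtain ⟨C, hC, h⟩ := XSpace.exists_besovNorm_le W p q hp2 hb (hba.trans haσ)
  have hB0 : 0 ≤ B := (norm_nonneg _).trans (hf 0)
  have hblock : ∀ f : XSpace W p q, ∀ j : ℕ,
      blockNorm (XSpace.coeff f) j ≤ (2 : ℝ) ^ ((j : ℝ) * b) * (C * ‖f‖) := fun f j =>
    blockNorm_le_of_besovNorm_le (by positivity) (h f) j
  choose jz hjz using exists_mem_freqBlock (d := d)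
  have hcoef : ∀ n z, XSpace.coeff (f n) z ∈
      Metric.closedBall (0 : ℂ) ((2 : ℝ) ^ ((jz z : ℝ) * b) * (C * B)) := fun n z => by
    rw [mem_closedBall_zero_iff]
    refine le_trans ?_ ((hblock (f n) (jz z)).trans ?_)
    · rw [blockNorm]
      refine Real.le_sqrt_of_sq_le ?_
      exact Finset.single_le_sum (f := fun z => ‖XSpace.coeff (f n) z‖ ^ 2)
        (fun _ _ => by positivity) (hjz z)
    · gcongr
      exact hf n
  -- A subsequence along which every Fourier coefficient converges, by compactness of a countable
  -- product of balls.
  obtain ⟨c, -, φ, hφ, hlim⟩ := (isCompact_univ_pi fun z => isCompact_closedBall (0 : ℂ)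
    ((2 : ℝ) ^ ((jz z : ℝ) * b) * (C * B))).tendsto_subseq
      (x := fun n => XSpace.coeff (f n)) fun n z _ => hcoef n z
  refine ⟨φ, hφ, ?_⟩
  set e : ℕ × ℕ → (Fin d → ℤ) → ℂ := fun m => XSpace.coeff (f (φ m.1) - f (φ m.2)) with he
  have hez : ∀ z, Tendsto (fun m => e m z) atTop (𝓝 0) := fun z => by
    have h1 : Tendsto (fun n => XSpace.coeff (f (φ n)) z) atTop (𝓝 (c z)) :=
      (tendsto_pi_nhds.1 hlim) z
    have h2 : ∀ m, e m z = XSpace.coeff (f (φ m.1)) z - XSpace.coeff (f (φ m.2)) z := fun m => by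
      have h3 := XSpace.coeff_add W p q (f (φ m.1) - f (φ m.2)) (f (φ m.2))
      rw [sub_add_cancel] at h3
      rw [h3, Pi.add_apply, add_sub_cancel_right]
    simp only [h2]
    rw [← prod_atTop_atTop_eq, ← sub_self (c z)]
    exact (h1.comp tendsto_fst).sub (h1.comp tendsto_snd)
  have hbd : ∀ m j, blockNorm (e m) j ≤ (2 : ℝ) ^ ((j : ℝ) * b) * (C * (2 * B)) := fun m j => by
    refine (hblock _ j).trans ?_
    gcongr
    refine (norm_sub_le _ _).trans ?_
    linarith [hf (φ m.1), hf (φ m.2)]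
  set ρ : ℝ := (2 : ℝ) ^ (2 * (b - a)) with hρ
  have hρ0 : 0 ≤ ρ := by positivity
  have hρ1 : ρ < 1 := Real.rpow_lt_one_of_one_lt_of_neg one_lt_two (by linarith)
  set bound : ℕ → ℝ := fun j => ρ ^ j * (C * (2 * B)) ^ 2
  have hsum : Summable bound := (summable_geometric_of_lt_one hρ0 hρ1).mul_right _
  have hle : ∀ m (j : ℕ), ((2 : ℝ) ^ ((j : ℝ) * -a) * blockNorm (e m) j) ^ 2 ≤ bound j :=
    fun m j => by
      have h1 : ρ ^ j = ((2 : ℝ) ^ ((j : ℝ) * -a) * (2 : ℝ) ^ ((j : ℝ) * b)) ^ 2 := by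
        rw [← Real.rpow_add two_pos, hρ, ← Real.rpow_natCast, ← Real.rpow_natCast,
          ← Real.rpow_mul two_pos.le, ← Real.rpow_mul two_pos.le]
        congr 1
        push_cast
        ring
      simp only [bound, h1, ← mul_pow]
      rw [mul_assoc]
      have := blockNorm_nonneg (e m) j
      gcongr
      exact hbd m j
  -- Each block is a finite sum and tends to zero, so dominated convergence over the levels applies.
  have ht : Tendsto (fun m => ∑' j : ℕ, ((2 : ℝ) ^ ((j : ℝ) * -a) * blockNorm (e m) j) ^ 2)
      atTop (𝓝 (∑' _ : ℕ, 0)) := by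
    refine tendsto_tsum_of_dominated_convergence hsum (fun j => ?_)
      (Eventually.of_forall fun m j => ?_)
    · have h1 : Tendsto (fun m => ∑ z ∈ freqBlock d j, ‖e m z‖ ^ 2) atTop
          (𝓝 (∑ z ∈ freqBlock d j, ‖(0 : ℂ)‖ ^ 2)) :=
        tendsto_finsetSum _ fun z _ => ((hez z).norm).pow 2
      have h2 : Tendsto (fun m => blockNorm (e m) j) atTop (𝓝 0) := by
        have := h1.sqrt
        simpa [blockNorm] using this
      simpa using (h2.const_mul ((2 : ℝ) ^ ((j : ℝ) * -a))).pow 2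
    · rw [Real.norm_of_nonneg (sq_nonneg _)]
      exact hle m j
  rw [tsum_zero] at ht
  intro ε hε
  have hev := ht.eventually (gt_mem_nhds (show 0 < ε ^ 2 by positivity))
  obtain ⟨N, hN⟩ := eventually_atTop.1 hev
  refine ⟨max N.1 N.2, fun m hm n hn => ?_⟩
  have h1 := hN (m, n) ⟨(le_max_left _ _).trans hm, (le_max_right _ _).trans hn⟩
  rw [← ENNReal.pow_le_pow_left_iff two_ne_zero, besovNorm_two_two_sq,
    ← ENNReal.ofReal_pow hε.le, ← ENNReal.ofReal_tsum_of_nonneg (fun _ => sq_nonneg _)]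
  · exact ENNReal.ofReal_le_ofReal h1.le
  · exact Summable.of_nonneg_of_le (fun _ => sq_nonneg _) (hle (m, n)) hsum

end

end BesovTikhonov

namespace BesovTikhonov

/-! ### Tikhonov regularization with uniformly convex penalty -/

theorem continuous_penalty {X : Type*} [SeminormedAddCommGroup X] {r : ℝ} (hr : 0 ≤ r) :
    Continuous (penalty r : X → ℝ) :=
  continuous_const.mul (continuous_norm.rpow_const fun _ => Or.inr hr)

theorem tikhonov_eq {X Y : Type*} [NormedAddCommGroup Y] [InnerProductSpace ℝ Y]
    (F : X → Y) (R : X → ℝ) (g : Y) (α : ℝ) (f : X) :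
    tikhonov F R g α f = 1 / 2 * ‖F f - g‖ ^ 2 - 1 / 2 * ‖g‖ ^ 2 + α * R f := by
  rw [tikhonov, norm_sub_sq_real, real_inner_comm g]
  ring

section Abstract

variable {X Y : Type*} [SeminormedAddCommGroup X] [NormedSpace ℝ X]
  [NormedAddCommGroup Y] [InnerProductSpace ℝ Y]

/-- Midpoint form of uniform convexity of power type `r` with constant `c`. -/
def IsUniformlyConvex (c r : ℝ) (R : X → ℝ) : Prop :=
  ∀ f g : X, R ((1 / 2 : ℝ) • (f + g)) + c * ‖f - g‖ ^ r ≤ (R f + R g) / 2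

/-- Insert the subgradient inequality at the midpoint into midpoint convexity. -/
theorem IsUniformlyConvex.le_bregman {c r : ℝ} {R : X → ℝ} (hR : IsUniformlyConvex c r R)
    {f₀ : X} {fs : StrongDual ℝ X} (hfs : fs ∈ subdiff R f₀) (f : X) :
    2 * c * ‖f - f₀‖ ^ r ≤ bregman R fs f f₀ := by
  have h1 := hfs ((1 / 2 : ℝ) • (f + f₀))
  have h2 := hR f f₀
  have h3 : (1 / 2 : ℝ) • (f + f₀) - f₀ = (1 / 2 : ℝ) • (f - f₀) := by module
  rw [h3, map_smul, smul_eq_mul] at h1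
  unfold bregman
  linarith

/-- With a norming functional g of f₀ from Hahn–Banach, ‖f₀‖^(r−1) g is a subgradient by Young's
inequality. -/
theorem subdiff_penalty_nonempty {r : ℝ} (hr : 1 < r) (f₀ : X) :
    (subdiff (penalty r) f₀).Nonempty := by
  obtain ⟨g, hg1, hg2⟩ := exists_dual_vector'' ℝ f₀
  refine ⟨‖f₀‖ ^ (r - 1) • g, fun f => ?_⟩
  have hr0 : 0 < r := by linarith
  simp only [penalty, smul_apply, smul_eq_mul, map_sub]
  have hg2' : g f₀ = ‖f₀‖ := hg2
  have hgf : g f ≤ ‖f‖ := (le_abs_self _).trans ((g.le_of_opNorm_le hg1 f).trans (by rw [one_mul]))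
  have hy := Real.young_inequality_of_nonneg (norm_nonneg f)
    (Real.rpow_nonneg (norm_nonneg f₀) (r - 1)) (Real.HolderConjugate.conjExponent hr)
  rw [← Real.rpow_mul (norm_nonneg _)] at hy
  have h1 : (r - 1) * r.conjExponent = r := by
    rw [Real.conjExponent]; field_simp [sub_ne_zero.2 hr.ne']
  have h2 : ‖f₀‖ ^ r = ‖f₀‖ ^ (r - 1) * ‖f₀‖ := by
    rw [← Real.rpow_add_one' (norm_nonneg _) (by linarith), sub_add_cancel]
  have h3 : ‖f₀‖ ^ r / r.conjExponent = (1 - 1 / r) * ‖f₀‖ ^ r := by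
    rw [Real.conjExponent]; field_simp [sub_ne_zero.2 hr.ne']
  rw [h1, h3] at hy
  rw [hg2', ← h2]
  have h4 : ‖f₀‖ ^ (r - 1) * g f ≤ ‖f₀‖ ^ (r - 1) * ‖f‖ := by gcongr
  have h5 : ‖f‖ ^ r / r = 1 / r * ‖f‖ ^ r := by ring
  linarith

/-- Bounded sequences in a uniformly convex space that are Cauchy in a weaker norm. -/
theorem IsUniformlyConvex.exists_limit [CompleteSpace X] {c r : ℝ} (hc : 0 < c) (hr : 0 < r)
    {R : X → ℝ} (hR : IsUniformlyConvex c r R) (hRc : Continuous R) (hR0 : ∀ f, 0 ≤ R f)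
    {D : Set X} (hDclosed : IsClosed D) (hDconvex : Convex ℝ D) (E : Seminorm ℝ X) {C : ℝ}
    (hE : ∀ f, E f ≤ C * ‖f‖) {x : ℕ → X} (hxD : ∀ n, x n ∈ D) {β : ℝ}
    (hβ : Tendsto (fun n => R (x n)) atTop (𝓝 β))
    (hcau : ∀ ε > 0, ∃ N, ∀ m ≥ N, ∀ n ≥ N, E (x m - x n) ≤ ε) :
    ∃ h ∈ D, R h ≤ β ∧ Tendsto (fun n => E (h - x n)) atTop (𝓝 0) := by
  -- Convex hulls of the tails take over the role of weak closures.
  set K : ℕ → Set X := fun n => convexHull ℝ (x '' Set.Ici n) with hK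
  have hKanti : Antitone K := fun m n hmn =>
    convexHull_mono (Set.image_mono (Set.Ici_subset_Ici.2 hmn))
  have hKconv : ∀ n, Convex ℝ (K n) := fun n => convex_convexHull ℝ _
  have hxK : ∀ n, x n ∈ K n := fun n => subset_convexHull ℝ _ ⟨n, Set.self_mem_Ici, rfl⟩
  have hKD : ∀ n, K n ⊆ D := fun n => convexHull_min (by rintro _ ⟨m, -, rfl⟩; exact hxD m) hDconvex
  have hbdd : ∀ n, BddBelow (R '' K n) := fun n => ⟨0, by rintro _ ⟨f, -, rfl⟩; exact hR0 f⟩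
  have hne : ∀ n, (R '' K n).Nonempty := fun n => ⟨_, x n, hxK n, rfl⟩
  set ρ : ℕ → ℝ := fun n => sInf (R '' K n) with hρ
  have hρle : ∀ n, ∀ f ∈ K n, ρ n ≤ R f := fun n f hf => csInf_le (hbdd n) ⟨f, hf, rfl⟩
  have hρmono : Monotone ρ := fun m n hmn =>
    csInf_le_csInf (hbdd m) (hne n) (Set.image_mono (hKanti hmn))
  obtain ⟨B, hB⟩ := hβ.bddAbove_range
  have hρbdd : BddAbove (Set.range ρ) := ⟨B, by
    rintro _ ⟨n, rfl⟩
    exact (hρle n _ (hxK n)).trans (hB ⟨n, rfl⟩)⟩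
  have hρlim := tendsto_atTop_ciSup hρmono hρbdd
  set ρs := ⨆ n, ρ n
  have hρs : ∀ n, ρ n ≤ ρs := fun n => le_ciSup hρbdd n
  have hρβ : ρs ≤ β := le_of_tendsto_of_tendsto' hρlim hβ fun n => hρle n _ (hxK n)
  have hex : ∀ n : ℕ, ∃ f ∈ K n, R f < ρ n + 1 / ((n : ℝ) + 1) := fun n => by
    obtain ⟨_, ⟨f, hf, rfl⟩, h⟩ := exists_lt_of_csInf_lt (hne n)
      (show sInf (R '' K n) < ρ n + 1 / ((n : ℝ) + 1) from lt_add_of_pos_right _ (by positivity))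
    exact ⟨f, hf, h⟩
  choose h hhK hhR using hex
  have hone : Tendsto (fun n : ℕ => 1 / ((n : ℝ) + 1)) atTop (𝓝 0) :=
    tendsto_one_div_add_atTop_nhds_zero_nat
  have hcauchy : CauchySeq h := by
    refine cauchySeq_of_le_tendsto_0
      (fun N => ((ρs + 1 / ((N : ℝ) + 1) - ρ N) / c) ^ (1 / r)) (fun n m N hn hm => ?_) ?_
    · have h1 := hR (h n) (h m)
      -- The midpoint stays in `K N`, so R is at least `ρ N` there, while both endpoints are almost
      -- minimal; uniform convexity then bounds their distance.
      have hmid : (1 / 2 : ℝ) • (h n + h m) ∈ K N := by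
        rw [smul_add]
        exact hKconv N (hKanti hn (hhK n)) (hKanti hm (hhK m)) (by norm_num) (by norm_num)
          (by norm_num)
      have h2 := hρle N _ hmid
      have h3 : ∀ k : ℕ, N ≤ k → R (h k) ≤ ρs + 1 / ((N : ℝ) + 1) := fun k hk => by
        have : 1 / ((k : ℝ) + 1) ≤ 1 / ((N : ℝ) + 1) := by gcongr
        linarith [hhR k, hρs k]
      have h4 : ‖h n - h m‖ ^ r ≤ (ρs + 1 / ((N : ℝ) + 1) - ρ N) / c := by
        rw [le_div_iff₀ hc]
        linarith [h3 n hn, h3 m hm]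
      rw [dist_eq_norm]
      calc ‖h n - h m‖ = (‖h n - h m‖ ^ r) ^ (1 / r) := by
            rw [← Real.rpow_mul (norm_nonneg _), mul_one_div_cancel hr.ne', Real.rpow_one]
        _ ≤ _ := Real.rpow_le_rpow (by positivity) h4 (by positivity)
    · have h1 := (((hone.const_add ρs).sub hρlim).div_const c).rpow_const (p := 1 / r)
        (Or.inr (by positivity))
      simpa [hr.ne'] using h1
  obtain ⟨f, hf⟩ := cauchySeq_tendsto_of_complete hcauchy
  refine ⟨f, hDclosed.mem_of_tendsto hf (Eventually.of_forall fun n => hKD n (hhK n)), ?_, ?_⟩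
  · refine le_trans ?_ hρβ
    have h1 : Tendsto (fun n : ℕ => ρs + 1 / ((n : ℝ) + 1)) atTop (𝓝 (ρs + 0)) :=
      hone.const_add ρs
    rw [add_zero] at h1
    exact le_of_tendsto_of_tendsto' ((hRc.tendsto f).comp hf) h1
      fun n => (hhR n).le.trans (by gcongr; exact hρs n)
  · refine Metric.tendsto_atTop.2 fun ε hε => ?_
    obtain ⟨N, hN⟩ := hcau (ε / 2) (by positivity)
    refine ⟨N, fun n hn => ?_⟩
    have hball : ∀ m ≥ n, E (h m - x n) ≤ ε / 2 := fun m hm => by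
      -- A ball of the seminorm is convex, so it contains the hull of the tail once it contains the
      -- tail.
      have h1 : K n ⊆ E.closedBall (x n) (ε / 2) := convexHull_min (by
        rintro _ ⟨k, hk, rfl⟩
        exact E.mem_closedBall.2 (hN k (hn.trans hk) n hn)) (E.convex_closedBall _ _)
      exact E.mem_closedBall.1 (h1 (hKanti hm (hhK m)))
    have h2 : E (f - x n) ≤ C * 0 + ε / 2 := by
      have h3 : Tendsto (fun m => C * ‖f - h m‖ + ε / 2) atTop (𝓝 (C * 0 + ε / 2)) := by
        refine Tendsto.add_const _ (Tendsto.const_mul _ ?_)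
        have := (tendsto_const_nhds (x := f)).sub hf
        simpa using this.norm
      refine ge_of_tendsto h3 (eventually_atTop.2 ⟨n, fun m hm => ?_⟩)
      have h4 := map_add_le_add E (f - h m) (h m - x n)
      rw [sub_add_sub_cancel] at h4
      linarith [hball m hm, hE (f - h m)]
    rw [Real.dist_eq, sub_zero, abs_of_nonneg (apply_nonneg E _)]
    linarith

/-- Existence of Tikhonov minimizers. -/
theorem exists_isTikhonovMinimizer [CompleteSpace X] [CompleteSpace Y] {c r : ℝ} (hc : 0 < c)
    (hr : 0 < r) (hR : IsUniformlyConvex c r (penalty r : X → ℝ))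
    {D : Set X} (hDclosed : IsClosed D) (hDconvex : Convex ℝ D) (hDne : D.Nonempty)
    (E : Seminorm ℝ X) {C : ℝ} (hE : ∀ f, E f ≤ C * ‖f‖)
    (hcomp : ∀ (B : ℝ) (f : ℕ → X), (∀ n, ‖f n‖ ≤ B) → ∃ φ : ℕ → ℕ, StrictMono φ ∧
      ∀ ε > 0, ∃ N, ∀ m ≥ N, ∀ n ≥ N, E (f (φ m) - f (φ n)) ≤ ε)
    {F : X → Y} {L : ℝ} (hL : 0 < L)
    (hF : ∀ f₁ ∈ D, ∀ f₂ ∈ D, ‖F f₁ - F f₂‖ ≤ L * E (f₁ - f₂)) (g : Y) {α : ℝ} (hα : 0 < α) :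
    ∃ f, IsTikhonovMinimizer D F (penalty r) g α f := by
  set T := tikhonov F (penalty r) g α with hT
  have hpen0 : ∀ f : X, 0 ≤ penalty r f := fun f => by unfold penalty; positivity
  have hTle : ∀ f, α * penalty r f ≤ T f + 1 / 2 * ‖g‖ ^ 2 := fun f => by
    rw [hT, tikhonov_eq]
    nlinarith [sq_nonneg ‖F f - g‖]
  have hbdd : BddBelow (T '' D) := ⟨-(1 / 2 * ‖g‖ ^ 2), by
    rintro _ ⟨f, -, rfl⟩
    linarith [hTle f, mul_nonneg hα.le (hpen0 f)]⟩
  obtain ⟨u, -, hulim, hu⟩ := exists_seq_tendsto_sInf (hDne.image T) hbdd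
  choose f hfD hfu using hu
  obtain ⟨M, hM⟩ := hulim.bddAbove_range
  have hfb : ∀ n, ‖f n‖ ≤ ((M + 1 / 2 * ‖g‖ ^ 2) / α * r) ^ (1 / r) := fun n => by
    have h1 := hTle (f n)
    rw [hfu] at h1
    have h2 : u n ≤ M := hM ⟨n, rfl⟩
    have h3 : ‖f n‖ ^ r ≤ (M + 1 / 2 * ‖g‖ ^ 2) / α * r := by
      rw [div_mul_eq_mul_div, le_div_iff₀ hα]
      have h4 : ‖f n‖ ^ r * α = α * penalty r (f n) * r := by
        unfold penalty
        field_simp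
      rw [h4]
      gcongr
      linarith
    calc ‖f n‖ = (‖f n‖ ^ r) ^ (1 / r) := by
          rw [← Real.rpow_mul (norm_nonneg _), mul_one_div_cancel hr.ne', Real.rpow_one]
      _ ≤ _ := Real.rpow_le_rpow (by positivity) h3 (by positivity)
  obtain ⟨φ, hφ, hcau⟩ := hcomp _ f hfb
  have hFcau : CauchySeq fun n => F (f (φ n)) := by
    refine Metric.cauchySeq_iff.2 fun ε hε => ?_
    obtain ⟨N, hN⟩ := hcau (ε / 2 / L) (by positivity)
    refine ⟨N, fun m hm n hn => ?_⟩
    rw [dist_eq_norm]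
    refine (hF _ (hfD _) _ (hfD _)).trans_lt ?_
    have := mul_le_mul_of_nonneg_left (hN m hm n hn) hL.le
    rw [mul_div_cancel₀ _ hL.ne'] at this
    linarith
  obtain ⟨y, hy⟩ := cauchySeq_tendsto_of_complete hFcau
  set m := sInf (T '' D)
  have hTlim : Tendsto (fun n => T (f (φ n))) atTop (𝓝 m) := by
    simp only [hfu]
    exact hulim.comp hφ.tendsto_atTop
  -- Both the functional and F converge along the subsequence, hence so does the penalty.
  have hRlim : Tendsto (fun n => penalty r (f (φ n))) atTop
      (𝓝 ((m - 1 / 2 * ‖y‖ ^ 2 + inner ℝ g y) / α)) := by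
    have h1 : ∀ n, penalty r (f (φ n)) = (T (f (φ n)) - 1 / 2 * ‖F (f (φ n))‖ ^ 2 +
        inner ℝ g (F (f (φ n)))) / α := fun n => by
      rw [eq_div_iff hα.ne', hT, tikhonov]
      ring
    simp only [h1]
    exact ((hTlim.sub ((hy.norm.pow 2).const_mul _)).add (tendsto_const_nhds.inner hy)).div_const _
  obtain ⟨h, hhD, hhR, hhE⟩ := hR.exists_limit hc hr (continuous_penalty hr.le) hpen0 hDclosed
    hDconvex E hE (fun n => hfD (φ n)) hRlim hcau
  have hFh : F h = y := by
    refine tendsto_nhds_unique ?_ hy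
    rw [tendsto_iff_norm_sub_tendsto_zero]
    have h1 : Tendsto (fun n => L * E (h - f (φ n))) atTop (𝓝 0) := by
      simpa using hhE.const_mul L
    refine squeeze_zero (fun _ => norm_nonneg _) (fun n => ?_) h1
    rw [norm_sub_rev]
    exact hF _ hhD _ (hfD _)
  refine ⟨h, hhD, fun f' hf' => ?_⟩
  have h1 : m ≤ T f' := csInf_le hbdd ⟨f', hf', rfl⟩
  refine le_trans ?_ h1
  change T h ≤ m
  rw [hT, tikhonov, hFh]
  rw [le_div_iff₀ hα] at hhR
  linarith

/-- Uniqueness of Tikhonov minimizers for linear operators. -/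
theorem IsUniformlyConvex.norm_sub_eq_zero {c r : ℝ} (hc : 0 < c) (hr : 0 < r)
    {R : X → ℝ} (hR : IsUniformlyConvex c r R) {D : Set X} (hDconvex : Convex ℝ D)
    {F : X → Y} {A : X →ₗ[ℝ] Y} (hA : ∀ f ∈ D, F f = A f) {g : Y} {α : ℝ} (hα : 0 < α)
    {f₁ f₂ : X} (h₁ : IsTikhonovMinimizer D F R g α f₁) (h₂ : IsTikhonovMinimizer D F R g α f₂) :
    ‖f₁ - f₂‖ = 0 := by
  have hmid : (1 / 2 : ℝ) • (f₁ + f₂) ∈ D := by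
    rw [smul_add]
    exact hDconvex h₁.1 h₂.1 (by norm_num) (by norm_num) (by norm_num)
  have h1 : tikhonov F R g α f₁ ≤ tikhonov F R g α ((1 / 2 : ℝ) • (f₁ + f₂)) := h₁.2 hmid
  have h2 : tikhonov F R g α f₂ ≤ tikhonov F R g α ((1 / 2 : ℝ) • (f₁ + f₂)) := h₂.2 hmid
  have h3 := mul_le_mul_of_nonneg_left (hR f₁ f₂) hα.le
  have hAm : A ((1 / 2 : ℝ) • (f₁ + f₂)) - g =
      (1 / 2 : ℝ) • ((A f₁ - g) + (A f₂ - g)) := by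
    rw [map_smul, map_add]
    module
  rw [tikhonov_eq, tikhonov_eq, hA _ hmid, hA _ h₁.1, hAm, norm_smul,
    Real.norm_of_nonneg (by norm_num)] at h1
  rw [tikhonov_eq, tikhonov_eq, hA _ hmid, hA _ h₂.1, hAm, norm_smul,
    Real.norm_of_nonneg (by norm_num)] at h2
  have h4 := parallelogram_law_with_norm ℝ (A f₁ - g) (A f₂ - g)
  have h5 : 0 ≤ ‖f₁ - f₂‖ ^ r := by positivity
  have h6 : α * c * ‖f₁ - f₂‖ ^ r ≤ 0 := by
    nlinarith [mul_self_nonneg ‖A f₁ - g - (A f₂ - g)‖]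
  have h7 : ‖f₁ - f₂‖ ^ r = 0 := le_antisymm (by
    by_contra! h
    have : 0 < α * c * ‖f₁ - f₂‖ ^ r := by positivity
    linarith) h5
  exact (Real.rpow_eq_zero (norm_nonneg _) hr.ne').1 h7

/-- The error bound of Tikhonov regularization under a variational source condition. -/
theorem VSC.bregman_le {D : Set X} {F : X → Y} {R : X → ℝ} {f₀ : X} {fs : StrongDual ℝ X}
    {ψ : ℝ → ℝ} (h : VSC D F R f₀ fs ψ) (hf₀ : f₀ ∈ D) {g : Y} {δ : ℝ} (hg : ‖g - F f₀‖ ≤ δ)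
    {α : ℝ} (hα : IsAPrioriChoice ψ δ α) {f : X} (hf : IsTikhonovMinimizer D F R g α f) :
    bregman R fs f f₀ ≤ 2 * ψ (2 * 2 * δ ^ 2) := by
  obtain ⟨hα0, hα⟩ := hα
  set T := ‖F f₀ - F f‖ ^ 2
  have h1 : tikhonov F R g α f ≤ tikhonov F R g α f₀ := hf.2 hf₀
  rw [tikhonov_eq, tikhonov_eq] at h1
  -- Together with minimality this gives α(R f − R f₀) ≤ δ² − T/4.
  have h2 : T ≤ 2 * δ ^ 2 + 2 * ‖F f - g‖ ^ 2 := by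
    have h3 : ‖F f₀ - F f‖ ≤ δ + ‖F f - g‖ := by
      calc ‖F f₀ - F f‖ = ‖-(g - F f₀) + -(F f - g)‖ := by congr 1; abel
        _ ≤ ‖-(g - F f₀)‖ + ‖-(F f - g)‖ := norm_add_le _ _
        _ ≤ δ + ‖F f - g‖ := by rw [norm_neg, norm_neg]; gcongr
    have h4 : T ≤ (δ + ‖F f - g‖) ^ 2 := pow_le_pow_left₀ (norm_nonneg _) h3 2
    nlinarith [sq_nonneg (δ - ‖F f - g‖)]
  have h3 : ‖F f₀ - g‖ ^ 2 ≤ δ ^ 2 := by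
    rw [norm_sub_rev]
    gcongr
  have h4 : fs (f₀ - f) ≤ 1 / 2 * bregman R fs f f₀ + ψ T := h.bound f hf.1
  -- The tangent inequality of −ψ at 4δ², taken at T, yields δ²/α − T/(4α) ≤ ψ(4δ²) − ψ(T), which
  -- cancels the ψ(T) of the source condition.
  have h5 := hα T (sq_nonneg _)
  have h6 : α * (R f - R f₀) ≤ δ ^ 2 - T / 4 := by linarith
  have h7 : R f - R f₀ ≤ δ ^ 2 / α - T / (4 * α) := by
    have : δ ^ 2 / α - T / (4 * α) = (δ ^ 2 - T / 4) / α := by field_simp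
    rw [this, le_div_iff₀ hα0]
    linarith
  have h8 : -1 / (2 * 2 * α) * (T - 2 * 2 * δ ^ 2) = δ ^ 2 / α - T / (4 * α) := by
    field_simp
    ring
  rw [h8] at h5
  have h9 : fs (f₀ - f) = -fs (f - f₀) := by rw [← map_neg, neg_sub]
  have h10 : bregman R fs f f₀ = R f - R f₀ + fs (f₀ - f) := by
    rw [h9, ← sub_eq_add_neg]
    rfl
  generalize fs (f₀ - f) = x at h4 h10
  generalize δ ^ 2 / α - T / (4 * α) = y at h5 h7
  linarith

end Abstract

end BesovTikhonov

namespace BesovTikhonov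

/-! ### Subgradients of powers of mixed norms -/

/-- The tangent inequality of the convex function t^θ at x, a form of Bernoulli's inequality. -/
theorem rpow_sub_rpow_le {θ x y : ℝ} (hθ : 1 ≤ θ) (hx : 0 ≤ x) (hy : 0 ≤ y) :
    x ^ θ - y ^ θ ≤ θ * x ^ (θ - 1) * (x - y) := by
  rcases hx.eq_or_lt with rfl | hx
  · rcases hθ.eq_or_lt with rfl | hθ
    · simp
    · rw [Real.zero_rpow (by linarith), Real.zero_rpow (by linarith)]
      have := Real.rpow_nonneg hy θ
      linarith
  · have h1 := one_add_mul_self_le_rpow_one_add (s := y / x - 1)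
      (by have := div_nonneg hy hx.le; linarith) hθ
    rw [add_sub_cancel, Real.div_rpow hy hx.le, le_div_iff₀ (by positivity)] at h1
    have h2 : x ^ θ = x ^ (θ - 1) * x := by
      rw [← Real.rpow_add_one hx.ne', sub_add_cancel]
    have h3 : (1 + θ * (y / x - 1)) * x ^ θ = x ^ θ - θ * x ^ (θ - 1) * (x - y) := by
      rw [h2]
      field_simp
      ring
    linarith

/-- Bound for the difference quotients of powers of `ℓ^q` norms. -/
theorem tsum_rpow_sub_le {q θ : ℝ} (hq : 1 < q) (hθ : 1 ≤ θ) {A B : ℕ → ℝ} (hA : ∀ j, 0 ≤ A j)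
    (hB : ∀ j, 0 ≤ B j) (hAs : Summable fun j => A j ^ q) (hBs : Summable fun j => B j ^ q)
    (hs : Summable fun j => B j ^ (q - 1) * (B j - A j)) :
    (∑' j, B j ^ q) ^ θ - (∑' j, A j ^ q) ^ θ ≤
      θ * (∑' j, B j ^ q) ^ (θ - 1) * (q * ∑' j, B j ^ (q - 1) * (B j - A j)) := by
  have hB0 : 0 ≤ ∑' j, B j ^ q := tsum_nonneg fun j => Real.rpow_nonneg (hB j) q
  have hA0 : 0 ≤ ∑' j, A j ^ q := tsum_nonneg fun j => Real.rpow_nonneg (hA j) q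
  refine (rpow_sub_rpow_le hθ hB0 hA0).trans ?_
  gcongr
  rw [← hBs.tsum_sub hAs, ← tsum_mul_left]
  refine (hBs.sub hAs).tsum_le_tsum (fun j => ?_) (hs.mul_left q)
  rw [← mul_assoc]
  exact rpow_sub_rpow_le hq.le (hB j) (hA j)

section Subgradient

variable {X : Type*} [SeminormedAddCommGroup X] [NormedSpace ℝ X]

/-- `blk` decomposes the norm of `X` into an `ℓ^q` norm of seminorms. -/
structure IsBlockDecomposition (q : ℝ) (blk : X → ℕ → ℝ) : Prop where
  nonneg : ∀ f j, 0 ≤ blk f j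
  add_smul_le : ∀ f h (t : ℝ), 0 ≤ t → ∀ j, blk (f + t • h) j ≤ blk f j + t * blk h j
  hasSum : ∀ f, HasSum (fun j => blk f j ^ q) (‖f‖ ^ q)

variable {q r : ℝ} {blk : X → ℕ → ℝ}

/-- Compare R(f + th) with R(f). The blocks of f + th are at most B_j = A_j + tH_j, so
`tsum_rpow_sub_le` with θ = r/q bounds the difference quotient by a norm power times ∑ B_j^(q−1)
H_j. Hölder's inequality is used only from level J on, which keeps the low levels explicit. -/
theorem IsBlockDecomposition.subgradient_le_of_pos (hb : IsBlockDecomposition q blk) (hq : 1 < q)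
    (hqr : q ≤ r) {f : X} {fs : StrongDual ℝ X} (hfs : fs ∈ subdiff (penalty r) f) (h : X) (J : ℕ)
    {t : ℝ} (ht : 0 < t) :
    fs h ≤ (‖f‖ + t * ‖h‖) ^ (r - q) *
      (∑ j ∈ Finset.range J, (blk f j + t * blk h j) ^ (q - 1) * blk h j +
        ((∑' j, blk f (j + J) ^ q) ^ (1 / q) + t * ‖h‖) ^ (q - 1) * ‖h‖) := by
  have hq0 : 0 < q := by linarith
  have hr0 : 0 < r := by linarith
  set A := blk f with hAdef
  set H := blk h with hHdef
  set B : ℕ → ℝ := fun j => A j + t * H j with hBdef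
  have hA : ∀ j, 0 ≤ A j := hb.nonneg f
  have hH : ∀ j, 0 ≤ H j := hb.nonneg h
  have htH : ∀ j, 0 ≤ t * H j := fun j => mul_nonneg ht.le (hH j)
  have hB : ∀ j, 0 ≤ B j := fun j => add_nonneg (hA j) (htH j)
  have hAs := hb.hasSum f
  have hHs := hb.hasSum h
  have htHpow : ∀ j, (t * H j) ^ q = t ^ q * H j ^ q := fun j => Real.mul_rpow ht.le (hH j)
  have hnorm : ∀ x : X, (‖x‖ ^ q) ^ (1 / q) = ‖x‖ := fun x => by
    rw [← Real.rpow_mul (norm_nonneg _), mul_one_div_cancel hq0.ne', Real.rpow_one]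
  -- Minkowski's inequality, for tails
  have hmink : ∀ J : ℕ, (Summable fun j => B (j + J) ^ q) ∧
      (∑' j, B (j + J) ^ q) ^ (1 / q) ≤ (∑' j, A (j + J) ^ q) ^ (1 / q) + t * ‖h‖ := fun J => by
    have hHJ : Summable fun j => (t * H (j + J)) ^ q := by
      simp only [htHpow]
      exact ((summable_nat_add_iff J).2 hHs.summable).mul_left _
    have h1 := Real.Lp_add_le_tsum_of_nonneg hq.le (fun j => hA (j + J)) (fun j => htH (j + J))
      ((summable_nat_add_iff J).2 hAs.summable) hHJ
    refine ⟨h1.1, h1.2.trans ?_⟩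
    gcongr
    simp only [htHpow]
    rw [tsum_mul_left, Real.mul_rpow (by positivity)
      (tsum_nonneg fun j => Real.rpow_nonneg (hH _) q), ← Real.rpow_mul ht.le,
      mul_one_div_cancel hq0.ne', Real.rpow_one]
    gcongr
    rw [← hnorm h, ← hHs.tsum_eq]
    have h2 := hHs.summable.sum_add_tsum_nat_add J
    have h3 : 0 ≤ ∑ j ∈ Finset.range J, H j ^ q :=
      Finset.sum_nonneg fun j _ => Real.rpow_nonneg (hH j) q
    refine Real.rpow_le_rpow (tsum_nonneg fun j => Real.rpow_nonneg (hH _) q) ?_ (by positivity)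
    linarith
  have hBs : Summable fun j => B j ^ q := by simpa using (hmink 0).1
  have hBH : (Summable fun j => B j ^ (q - 1) * H j) ∧ ∑' j, B j ^ (q - 1) * H j ≤
      ∑ j ∈ Finset.range J, B j ^ (q - 1) * H j +
        ((∑' j, A (j + J) ^ q) ^ (1 / q) + t * ‖h‖) ^ (q - 1) * ‖h‖ := by
    have hconj : q.conjExponent.HolderConjugate q :=
      (Real.HolderConjugate.conjExponent hq).symm
    have hq' : (q - 1) * q.conjExponent = q := by
      rw [Real.conjExponent]; field_simp [sub_ne_zero.2 hq.ne']
    have hpow : ∀ j, (B j ^ (q - 1)) ^ q.conjExponent = B j ^ q := fun j => by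
      rw [← Real.rpow_mul (hB j), hq']
    have h1 := Real.summable_and_inner_le_Lp_mul_Lq_tsum_of_nonneg hconj
      (f := fun j => B (j + J) ^ (q - 1)) (g := fun j => H (j + J))
      (fun j => Real.rpow_nonneg (hB _) _) (fun j => hH _)
      (by simp only [hpow]; exact (hmink J).1) ((summable_nat_add_iff J).2 hHs.summable)
    simp only [hpow] at h1
    have hsum : Summable fun j => B j ^ (q - 1) * H j := (summable_nat_add_iff J).1 h1.1
    refine ⟨hsum, ?_⟩
    rw [← hsum.sum_add_tsum_nat_add J]
    gcongr
    refine h1.2.trans ?_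
    have h0 : 0 ≤ ∑' j, B (j + J) ^ q := tsum_nonneg fun j => Real.rpow_nonneg (hB _) q
    have h2 : (∑' j, B (j + J) ^ q) ^ (1 / q.conjExponent) =
        ((∑' j, B (j + J) ^ q) ^ (1 / q)) ^ (q - 1) := by
      rw [← Real.rpow_mul h0]
      congr 1
      rw [Real.conjExponent]
      field_simp [sub_ne_zero.2 hq.ne']
    rw [h2]
    have h3 : (∑' j, H (j + J) ^ q) ^ (1 / q) ≤ ‖h‖ := by
      rw [← hnorm h, ← hHs.tsum_eq]
      have h2 := hHs.summable.sum_add_tsum_nat_add J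
      have h3 : 0 ≤ ∑ j ∈ Finset.range J, H j ^ q :=
        Finset.sum_nonneg fun j _ => Real.rpow_nonneg (hH j) q
      refine Real.rpow_le_rpow (tsum_nonneg fun j => Real.rpow_nonneg (hH _) q) ?_ (by positivity)
      linarith
    have h4 := Real.rpow_le_rpow (by positivity) (hmink J).2 (sub_nonneg.2 hq.le)
    exact mul_le_mul h4 h3 (Real.rpow_nonneg (tsum_nonneg fun j => Real.rpow_nonneg (hH _) q) _)
      ((Real.rpow_nonneg (by positivity) _).trans h4)
  set θ := r / q with hθ
  have hθ1 : 1 ≤ θ := (one_le_div hq0).2 hqr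
  have hpowr : ∀ x : X, ‖x‖ ^ r = (‖x‖ ^ q) ^ θ := fun x => by
    rw [← Real.rpow_mul (norm_nonneg _), hθ, mul_div_cancel₀ _ hq0.ne']
  have h1 : penalty r f + fs (t • h) ≤ penalty r (f + t • h) := by
    have := hfs (f + t • h)
    rwa [add_sub_cancel_left] at this
  have h2 : ‖f + t • h‖ ^ r ≤ (∑' j, B j ^ q) ^ θ := by
    rw [hpowr, ← (hb.hasSum (f + t • h)).tsum_eq]
    refine Real.rpow_le_rpow (tsum_nonneg fun j => Real.rpow_nonneg (hb.nonneg _ _) q) ?_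
      (by linarith)
    exact (hb.hasSum _).summable.tsum_le_tsum (fun j => Real.rpow_le_rpow (hb.nonneg _ _)
      (hb.add_smul_le f h t ht.le j) hq0.le) hBs
  have hBA : ∀ j, B j ^ (q - 1) * (B j - A j) = t * (B j ^ (q - 1) * H j) := fun j => by
    simp only [hBdef, add_sub_cancel_left]
    ring
  have h3 := tsum_rpow_sub_le hq hθ1 hA hB hAs.summable hBs
    (by simp only [hBA]; exact hBH.1.mul_left t)
  simp only [hBA] at h3
  rw [hAs.tsum_eq, ← hpowr, tsum_mul_left] at h3
  set S := ∑' j, B j ^ (q - 1) * H j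
  set V := ∑' j, B j ^ q
  have hV0 : 0 ≤ V := tsum_nonneg fun j => Real.rpow_nonneg (hB j) q
  have hS0 : 0 ≤ S := tsum_nonneg fun j => mul_nonneg (Real.rpow_nonneg (hB j) _) (hH j)
  have h4 : fs h ≤ V ^ (θ - 1) * S := by
    simp only [penalty, map_smul, smul_eq_mul] at h1
    have h5 : r * t * fs h ≤ r * t * (V ^ (θ - 1) * S) := by
      calc r * t * fs h = r * (t * fs h) := by ring
        _ ≤ r * (1 / r * ‖f + t • h‖ ^ r - 1 / r * ‖f‖ ^ r) := by gcongr; linarith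
        _ = ‖f + t • h‖ ^ r - ‖f‖ ^ r := by field_simp
        _ ≤ V ^ θ - ‖f‖ ^ r := by gcongr
        _ ≤ θ * V ^ (θ - 1) * (q * (t * S)) := h3
        _ = r * t * (V ^ (θ - 1) * S) := by rw [hθ]; field_simp
    exact le_of_mul_le_mul_left h5 (by positivity)
  refine h4.trans (mul_le_mul ?_ hBH.2 hS0 (by positivity))
  have h5 : V ^ (θ - 1) = (V ^ (1 / q)) ^ (r - q) := by
    rw [← Real.rpow_mul hV0, hθ]
    congr 1
    field_simp
  rw [h5]
  refine Real.rpow_le_rpow (by positivity) ?_ (by linarith)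
  have h6 := (hmink 0).2
  simp only [add_zero] at h6
  rwa [hAs.tsum_eq, hnorm] at h6

/-- Let t decrease to 0; the exponents q − 1 and r − q are nonnegative, so the bound is continuous
there. -/
theorem IsBlockDecomposition.subgradient_le (hb : IsBlockDecomposition q blk) (hq : 1 < q)
    (hqr : q ≤ r) {f : X} {fs : StrongDual ℝ X} (hfs : fs ∈ subdiff (penalty r) f) (h : X)
    (J : ℕ) :
    fs h ≤ ‖f‖ ^ (r - q) * (∑ j ∈ Finset.range J, blk f j ^ (q - 1) * blk h j +
      ((∑' j, blk f (j + J) ^ q) ^ (1 / q)) ^ (q - 1) * ‖h‖) := by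
  have hc : Continuous fun t : ℝ => (‖f‖ + t * ‖h‖) ^ (r - q) *
      (∑ j ∈ Finset.range J, (blk f j + t * blk h j) ^ (q - 1) * blk h j +
        ((∑' j, blk f (j + J) ^ q) ^ (1 / q) + t * ‖h‖) ^ (q - 1) * ‖h‖) := by
    have hq1 : 0 ≤ q - 1 := by linarith
    have hr1 : 0 ≤ r - q := by linarith
    refine Continuous.mul (Continuous.rpow_const (by fun_prop) fun _ => Or.inr hr1)
      (Continuous.add (continuous_finsetSum _ fun j _ => Continuous.mul
        (Continuous.rpow_const (by fun_prop) fun _ => Or.inr hq1) (by fun_prop))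
        (Continuous.mul (Continuous.rpow_const (by fun_prop) fun _ => Or.inr hq1) (by fun_prop)))
  have h1 := (hc.tendsto 0).mono_left (nhdsWithin_le_nhds (s := Set.Ioi 0))
  simp only [zero_mul, add_zero] at h1
  exact ge_of_tendsto h1 (eventually_mem_nhdsWithin.mono fun t ht =>
    hb.subgradient_le_of_pos hq hqr hfs h J ht)

end Subgradient

end BesovTikhonov

namespace BesovTikhonov

/-! ### Subgradient bounds under smoothness and the variational source condition -/

section Subgradient

variable {X : Type*} [SeminormedAddCommGroup X] [NormedSpace ℝ X] {q r : ℝ} {blk : X → ℕ → ℝ}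

theorem half_pow_rpow (j : ℕ) (s : ℝ) : ((1 / 2 : ℝ) ^ j) ^ s = ((1 / 2 : ℝ) ^ s) ^ j := by
  rw [← Real.rpow_natCast, ← Real.rpow_natCast, ← Real.rpow_mul (by norm_num),
    ← Real.rpow_mul (by norm_num), mul_comm]

theorem IsBlockDecomposition.tail_le {s : ℝ} (hq : 1 < q)
    (hs : 0 < s) : ∃ c : ℝ, 0 < c ∧ ∀ (A : ℕ → ℝ) (K : ℝ), 0 ≤ K → (∀ j, 0 ≤ A j) →
      (∀ j : ℕ, A j ≤ K * ((1 / 2 : ℝ) ^ j) ^ s) → ∀ J : ℕ,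
        (∑' j, A (j + J) ^ q) ^ (1 / q) ≤ K * c * ((1 / 2 : ℝ) ^ J) ^ s := by
  have hq0 : 0 < q := by linarith
  set ρ : ℝ := (1 / 2 : ℝ) ^ (s * q) with hρ
  have hρ0 : 0 ≤ ρ := by positivity
  have hρ1 : ρ < 1 := Real.rpow_lt_one (by norm_num) (by norm_num) (by positivity)
  have hρi : 0 < (1 - ρ)⁻¹ := inv_pos.2 (by linarith)
  refine ⟨((1 - ρ)⁻¹) ^ (1 / q), by positivity, fun A K hK hA0 hA J => ?_⟩
  have h1 : ∀ j, A (j + J) ^ q ≤ (K * ((1 / 2 : ℝ) ^ J) ^ s) ^ q * ρ ^ j := fun j => by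
    refine (Real.rpow_le_rpow (hA0 _) (hA (j + J)) hq0.le).trans (le_of_eq ?_)
    have h2 : (((1 / 2 : ℝ) ^ j) ^ s) ^ q = ρ ^ j := by
      rw [← Real.rpow_mul (by positivity), half_pow_rpow]
    have h3 : ((1 / 2 : ℝ) ^ (j + J)) ^ s = ((1 / 2 : ℝ) ^ j) ^ s * ((1 / 2 : ℝ) ^ J) ^ s := by
      rw [pow_add, Real.mul_rpow (by positivity) (by positivity)]
    rw [← h2, ← Real.mul_rpow (by positivity) (by positivity), h3]
    congr 1
    ring
  have hg := summable_geometric_of_lt_one hρ0 hρ1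
  have h2 : ∑' j, A (j + J) ^ q ≤ (K * ((1 / 2 : ℝ) ^ J) ^ s) ^ q * (1 - ρ)⁻¹ := by
    rw [← tsum_geometric_of_lt_one hρ0 hρ1, ← tsum_mul_left]
    exact (Summable.of_nonneg_of_le (fun j => Real.rpow_nonneg (hA0 _) q) h1
      (hg.mul_left _)).tsum_le_tsum h1 (hg.mul_left _)
  refine (Real.rpow_le_rpow (tsum_nonneg fun j => Real.rpow_nonneg (hA0 _) q) h2
    (by positivity)).trans (le_of_eq ?_)
  rw [Real.mul_rpow (by positivity) hρi.le, ← Real.rpow_mul (by positivity),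
    mul_one_div_cancel hq0.ne', Real.rpow_one]
  ring

/-- Low levels are estimated through the weak bound on h, high levels through the decay of the
blocks of f. As κ = s(q−1) < a, the low-level terms grow with ratio β > 1 and their sum is
comparable to the last one. -/
theorem IsBlockDecomposition.exists_subgradient_le (hb : IsBlockDecomposition q blk) (hq : 1 < q)
    (hqr : q ≤ r) {a s : ℝ} (hs : 0 < s) (hsa : s * (q - 1) < a) : ∃ C : ℝ, 0 < C ∧
      ∀ (f h : X) (fs : StrongDual ℝ X) (K G : ℝ), fs ∈ subdiff (penalty r) f → 0 ≤ K → 0 ≤ G →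
        (∀ j : ℕ, blk f j ≤ K * ((1 / 2 : ℝ) ^ j) ^ s) →
        (∀ j : ℕ, blk h j ≤ ((1 / 2 : ℝ) ^ j) ^ (-a) * G) → ∀ ε : ℝ, 0 < ε →
          fs h ≤ C * K ^ (r - 1) *
            (ε ^ (s * (q - 1)) * ‖h‖ + ε ^ (s * (q - 1) - a) * G) := by
  have hq0 : 0 < q := by linarith
  have hq1 : 0 < q - 1 := by linarith
  obtain ⟨c, hc, htail⟩ := IsBlockDecomposition.tail_le hq hs
  set κ := s * (q - 1) with hκ
  have hκ0 : 0 < κ := by positivity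
  set β : ℝ := (1 / 2 : ℝ) ^ (κ - a) with hβ
  have hβ1 : 1 < β := Real.one_lt_rpow_of_pos_of_lt_one_of_neg (by norm_num) (by norm_num)
    (by linarith)
  have hβ' : 0 < β - 1 := by linarith
  refine ⟨c ^ (r - q) * (c ^ (q - 1) + β / (β - 1)), by positivity,
    fun f h fs K G hfs hK hG hf hh ε hε => ?_⟩
  have hf0 := hb.nonneg f
  have hh0 := hb.nonneg h
  have hnf : ‖f‖ ≤ K * c := by
    have h1 := htail _ K hK hf0 hf 0
    simp only [add_zero, pow_zero, Real.one_rpow, mul_one] at h1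
    rwa [(hb.hasSum f).tsum_eq, ← Real.rpow_mul (norm_nonneg _), mul_one_div_cancel hq0.ne',
      Real.rpow_one] at h1
  have hKpow : K ^ (r - 1) = K ^ (r - q) * K ^ (q - 1) := by
    rw [← Real.rpow_add_of_nonneg hK (by linarith) (by linarith)]
    congr 1
    ring
  -- the estimate for a given cut-off level
  have hJ : ∀ J : ℕ, fs h ≤ c ^ (r - q) * K ^ (r - 1) *
      (c ^ (q - 1) * ((1 / 2 : ℝ) ^ J) ^ κ * ‖h‖ + (∑ j ∈ Finset.range J, β ^ j) * G) := by
    intro J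
    have h1 := hb.subgradient_le hq hqr hfs h J
    have h2 : ‖f‖ ^ (r - q) ≤ (K * c) ^ (r - q) :=
      Real.rpow_le_rpow (norm_nonneg _) hnf (by linarith)
    have h3 : ((∑' j, blk f (j + J) ^ q) ^ (1 / q)) ^ (q - 1) ≤
        (K * c) ^ (q - 1) * ((1 / 2 : ℝ) ^ J) ^ κ := by
      rw [hκ, Real.rpow_mul (by positivity), ← Real.mul_rpow (by positivity) (by positivity)]
      exact Real.rpow_le_rpow (Real.rpow_nonneg
        (tsum_nonneg fun j => Real.rpow_nonneg (hf0 _) q) _) (htail _ K hK hf0 hf J) hq1.le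
    have h4 : ∀ j, blk f j ^ (q - 1) * blk h j ≤ K ^ (q - 1) * (β ^ j * G) := fun j => by
      have h5 : blk f j ^ (q - 1) ≤ K ^ (q - 1) * ((1 / 2 : ℝ) ^ j) ^ κ := by
        rw [hκ, Real.rpow_mul (by positivity), ← Real.mul_rpow (by positivity) (by positivity)]
        exact Real.rpow_le_rpow (hf0 j) (hf j) hq1.le
      have h6 : β ^ j = ((1 / 2 : ℝ) ^ j) ^ κ * ((1 / 2 : ℝ) ^ j) ^ (-a) := by
        rw [← Real.rpow_add (by positivity), half_pow_rpow, hβ, sub_eq_add_neg]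
      refine (mul_le_mul h5 (hh j) (hh0 j) (by positivity)).trans (le_of_eq ?_)
      rw [h6]
      ring
    have h5 : ∑ j ∈ Finset.range J, blk f j ^ (q - 1) * blk h j ≤
        K ^ (q - 1) * ((∑ j ∈ Finset.range J, β ^ j) * G) := by
      rw [Finset.sum_mul, Finset.mul_sum]
      exact Finset.sum_le_sum fun j _ => h4 j
    have h6 : 0 ≤ ∑ j ∈ Finset.range J, blk f j ^ (q - 1) * blk h j :=
      Finset.sum_nonneg fun j _ => mul_nonneg (Real.rpow_nonneg (hf0 j) _) (hh0 j)
    have h7 : 0 ≤ ((∑' j, blk f (j + J) ^ q) ^ (1 / q)) ^ (q - 1) := Real.rpow_nonneg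
      (Real.rpow_nonneg (tsum_nonneg fun j => Real.rpow_nonneg (hf0 _) q) _) _
    calc fs h ≤ _ := h1
      _ ≤ (K * c) ^ (r - q) * (K ^ (q - 1) * ((∑ j ∈ Finset.range J, β ^ j) * G) +
          (K * c) ^ (q - 1) * ((1 / 2 : ℝ) ^ J) ^ κ * ‖h‖) := by gcongr
      _ = _ := by
          rw [hKpow, Real.mul_rpow hK hc.le, Real.mul_rpow hK hc.le]
          ring
  have hKr : 0 ≤ c ^ (r - q) * K ^ (r - 1) := by positivity
  suffices hsuff : ∃ J : ℕ, ((1 / 2 : ℝ) ^ J) ^ κ ≤ ε ^ κ ∧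
      ∑ j ∈ Finset.range J, β ^ j ≤ β / (β - 1) * ε ^ (κ - a) by
    obtain ⟨J, h1, h2⟩ := hsuff
    calc fs h ≤ _ := hJ J
      _ ≤ c ^ (r - q) * K ^ (r - 1) *
          (c ^ (q - 1) * ε ^ κ * ‖h‖ + (β / (β - 1) * ε ^ (κ - a)) * G) := by gcongr
      _ ≤ c ^ (r - q) * K ^ (r - 1) *
          ((c ^ (q - 1) + β / (β - 1)) * (ε ^ κ * ‖h‖ + ε ^ (κ - a) * G)) := by
          refine mul_le_mul_of_nonneg_left ?_ hKr
          have h3 : 0 ≤ c ^ (q - 1) * (ε ^ (κ - a) * G) := by positivity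
          have h4 : 0 ≤ β / (β - 1) * (ε ^ κ * ‖h‖) := by positivity
          linarith
      _ = _ := by ring
  -- For ε ≥ 1 no low levels are kept. Otherwise the cut-off J = n + 1 satisfies 2^(−J) < ε ≤
  -- 2^(−n); the first bound serves the tail, the second the geometric sum.
  rcases le_or_gt 1 ε with hε1 | hε1
  · refine ⟨0, ?_, ?_⟩
    · simpa using Real.one_le_rpow hε1 hκ0.le
    · simp only [Finset.range_zero, Finset.sum_empty]
      positivity
  · obtain ⟨n, hn1, hn2⟩ := exists_nat_pow_near_of_lt_one hε hε1.le
      (show (0 : ℝ) < 1 / 2 by norm_num) (by norm_num)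
    refine ⟨n + 1, Real.rpow_le_rpow (by positivity) hn1.le hκ0.le, ?_⟩
    rw [geom_sum_eq hβ1.ne', div_mul_eq_mul_div]
    gcongr
    have h1 : β ^ (n + 1) = β * ((1 / 2 : ℝ) ^ n) ^ (κ - a) := by
      rw [half_pow_rpow, pow_succ']
    have h2 : ((1 / 2 : ℝ) ^ n) ^ (κ - a) ≤ ε ^ (κ - a) :=
      Real.rpow_le_rpow_of_nonpos hε hn2 (by linarith)
    have h3 : β * ((1 / 2 : ℝ) ^ n) ^ (κ - a) ≤ β * ε ^ (κ - a) := by gcongr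
    linarith

theorem exists_young {η r : ℝ} (hη : 0 < η) (hr : 1 < r) : ∃ C : ℝ, 0 < C ∧
    ∀ x y : ℝ, 0 ≤ x → 0 ≤ y → x * y ≤ η * y ^ r + C * x ^ (r / (r - 1)) := by
  have hr0 : 0 < r := by linarith
  have hr1 : 0 < r - 1 := by linarith
  -- Scaling y by l and x by 1/l makes Young's coefficient l^r / r equal to η.
  set l := (η * r) ^ (1 / r) with hl
  have hl0 : 0 < l := by positivity
  have hlr : l ^ r = η * r := by
    rw [hl, ← Real.rpow_mul (by positivity), one_div_mul_cancel hr0.ne', Real.rpow_one]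
  refine ⟨(l⁻¹) ^ (r / (r - 1)) / (r / (r - 1)), by positivity, fun x y hx hy => ?_⟩
  have h := Real.young_inequality_of_nonneg (mul_nonneg hl0.le hy)
    (mul_nonneg (inv_nonneg.2 hl0.le) hx) (Real.HolderConjugate.conjExponent hr)
  rw [Real.mul_rpow hl0.le hy, hlr, Real.mul_rpow (inv_nonneg.2 hl0.le) hx,
    Real.conjExponent] at h
  have h1 : l * y * (l⁻¹ * x) = x * y := by field_simp
  have h2 : η * r * y ^ r / r = η * y ^ r := by field_simp
  rw [h1, h2] at h
  rw [div_mul_eq_mul_div]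
  exact h

/-- The variational source condition in terms of the blocks. -/
theorem IsBlockDecomposition.exists_vsc_bound (hb : IsBlockDecomposition q blk) (hq : 1 < q)
    (hqr : q ≤ r) {a s c : ℝ} (hs : 0 < s) (hsa : s * (q - 1) < a) (hc : 0 < c) :
    ∃ C : ℝ, 0 < C ∧
      ∀ (f h : X) (fs : StrongDual ℝ X) (K G : ℝ), fs ∈ subdiff (penalty r) f → 0 < K → 0 ≤ G →
        (∀ j : ℕ, blk f j ≤ K * ((1 / 2 : ℝ) ^ j) ^ s) →
        (∀ j : ℕ, blk h j ≤ ((1 / 2 : ℝ) ^ j) ^ (-a) * G) →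
          fs h ≤ c * ‖h‖ ^ r + C * (K ^ (r * a / (a + s * (q - 1) / (r - 1))) *
            G ^ (r * (s * (q - 1) / (r - 1)) / (a + s * (q - 1) / (r - 1)))) := by
  have hq0 : 0 < q := by linarith
  have hr : 1 < r := by linarith
  have hr1 : 0 < r - 1 := by linarith
  have hκ0 : 0 < s * (q - 1) := mul_pos hs (by linarith)
  obtain ⟨C, hC, hsub⟩ := hb.exists_subgradient_le hq hqr hs hsa
  obtain ⟨C', hC', hyoung⟩ := exists_young (η := c / C) (by positivity) hr
  set κ := s * (q - 1) with hκ
  set s' := κ / (r - 1) with hs'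
  have hs'0 : 0 < s' := by positivity
  have ha0 : 0 < a := by linarith
  have has : 0 < a + s' := by linarith
  refine ⟨C * C' + C, by positivity, fun f h fs K G hfs hK hG hf hh => ?_⟩
  -- For G = 0 the balancing ε would vanish; here every block of h is zero, so h has norm zero.
  rcases hG.eq_or_lt with rfl | hG
  · have h1 : ∀ j, blk h j = 0 := fun j => le_antisymm (by simpa using hh j) (hb.nonneg h j)
    have h2 := hb.hasSum h
    simp only [h1, Real.zero_rpow hq0.ne'] at h2
    have h3 : ‖h‖ = 0 := (Real.rpow_eq_zero (norm_nonneg _) hq0.ne').1 (h2.unique hasSum_zero)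
    have h4 : fs h ≤ 0 := by
      have := (le_abs_self _).trans (fs.le_opNorm h)
      rwa [h3, mul_zero] at this
    exact h4.trans (by positivity)
  -- This ε balances the two remainders: the power of K^(r−1) ε^κ left by Young and the low-level
  -- term K^(r−1) ε^(κ−a) G both equal K^r ε^(rs').
  set ε := (G / K) ^ (1 / (a + s')) with hε
  have hε0 : 0 < ε := by positivity
  have hεG : G = K * ε ^ (a + s') := by
    rw [hε, ← Real.rpow_mul (by positivity), one_div_mul_cancel has.ne', Real.rpow_one]
    field_simp
  have h1 := hsub f h fs K G hfs hK.le hG.le hf hh ε hε0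
  have h2 := hyoung (K ^ (r - 1) * ε ^ κ) ‖h‖ (by positivity) (norm_nonneg _)
  have hκs : κ = s' * (r - 1) := by rw [hs']; field_simp
  have hKr : (K ^ (r - 1)) ^ (r / (r - 1)) = K ^ r := by
    rw [← Real.rpow_mul hK.le]
    congr 1
    field_simp
  have hεr : (ε ^ κ) ^ (r / (r - 1)) = ε ^ (r * s') := by
    rw [← Real.rpow_mul hε0.le, hκs]
    congr 1
    field_simp
  rw [Real.mul_rpow (by positivity) (by positivity), hKr, hεr] at h2
  have h3 : K ^ (r - 1) * (ε ^ (κ - a) * G) = K ^ r * ε ^ (r * s') := by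
    have h4 : K ^ r = K ^ (r - 1) * K := by rw [← Real.rpow_add_one hK.ne', sub_add_cancel]
    have h5 : ε ^ (r * s') = ε ^ (κ - a) * ε ^ (a + s') := by
      rw [← Real.rpow_add hε0, hκs]
      congr 1
      ring
    rw [h4, h5]
    conv_lhs => rw [hεG]
    ring
  have h4 : K ^ r * ε ^ (r * s') = K ^ (r * a / (a + s')) * G ^ (r * s' / (a + s')) := by
    have h5 : K ^ r = K ^ (r * a / (a + s')) * K ^ (r * s' / (a + s')) := by
      rw [← Real.rpow_add hK]
      congr 1
      field_simp
    have h6 : ε ^ (r * s') = (G / K) ^ (r * s' / (a + s')) := by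
      rw [hε, ← Real.rpow_mul (by positivity)]
      congr 1
      ring
    rw [h6, Real.div_rpow hG.le hK.le, h5]
    field_simp
  rw [← h4]
  calc fs h ≤ C * K ^ (r - 1) * (ε ^ κ * ‖h‖ + ε ^ (κ - a) * G) := h1
    _ = C * (K ^ (r - 1) * ε ^ κ * ‖h‖) + C * (K ^ (r - 1) * (ε ^ (κ - a) * G)) := by ring
    _ ≤ C * (c / C * ‖h‖ ^ r + C' * (K ^ r * ε ^ (r * s'))) + C * (K ^ r * ε ^ (r * s')) := by
        rw [h3]
        gcongr
    _ = _ := by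
        field_simp
        ring

end Subgradient

end BesovTikhonov

namespace BesovTikhonov

/-! ### Power type index functions -/

theorem isConcaveIndexFunction_rpow {k μ : ℝ} (hk : 0 < k) (hμ0 : 0 < μ) (hμ1 : μ ≤ 1) :
    IsConcaveIndexFunction fun τ => k * τ ^ μ where
  concave := (Real.concaveOn_rpow hμ0.le hμ1).smul hk.le
  continuous := (continuous_const.mul
    (continuous_id.rpow_const fun _ => Or.inr hμ0.le)).continuousOn
  increasing := fun _ hx _ _ hxy =>
    mul_lt_mul_of_pos_left (Real.rpow_lt_rpow hx hxy hμ0) hk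
  zero := by rw [Real.zero_rpow hμ0.ne', mul_zero]

theorem exists_isAPrioriChoice_rpow {k μ δ : ℝ} (hk : 0 < k) (hμ0 : 0 < μ) (hμ1 : μ ≤ 1)
    (hδ : 0 < δ) : ∃ α, IsAPrioriChoice (fun τ => k * τ ^ μ) δ α := by
  set x : ℝ := 2 * 2 * δ ^ 2 with hx
  have hx0 : 0 < x := by positivity
  -- The derivative of the index function at 4δ²; the rule becomes its tangent inequality there,
  -- which is Bernoulli's inequality for an exponent at most 1.
  set D : ℝ := k * (μ * x ^ (μ - 1)) with hD
  have hD0 : 0 < D := by positivity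
  refine ⟨1 / (2 * 2 * D), by positivity, fun u hu => ?_⟩
  have h1 : -1 / (2 * 2 * (1 / (2 * 2 * D))) = -D := by field_simp
  rw [h1, ← hx]
  have h2 := rpow_one_add_le_one_add_mul_self (s := u / x - 1) (p := μ)
    (by have := div_nonneg hu hx0.le; linarith) hμ0.le hμ1
  rw [add_sub_cancel, Real.div_rpow hu hx0.le, div_le_iff₀ (by positivity)] at h2
  have h3 : x ^ μ = x ^ (μ - 1) * x := by rw [← Real.rpow_add_one hx0.ne', sub_add_cancel]
  have h4 : (1 + μ * (u / x - 1)) * x ^ μ = x ^ μ + μ * x ^ (μ - 1) * (u - x) := by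
    rw [h3]
    field_simp
  rw [h4] at h2
  have h5 := mul_le_mul_of_nonneg_left h2 hk.le
  rw [hD]
  linarith

/-! ### The exponents of the convergence rate -/

section Exponents

variable {a s q : ℝ}

/-- Both cases have a single form in s' = s(q−1)/(r−1), which is s for q ≥ 2 and s(q−1) for q ≤ 2.
-/
theorem exponents_eq (hq : 1 < q) (hs : 0 < s) (ha : 0 < a) {r : ℝ} (hr : r = max 2 q) :
    expNu a s q = r * a / (a + s * (q - 1) / (r - 1)) ∧
    expMu a s q = r * (s * (q - 1) / (r - 1)) / (a + s * (q - 1) / (r - 1)) / 2 ∧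
    ∀ ϱ δ : ℝ, rate a s q ϱ δ = ϱ ^ (a / (a + s * (q - 1) / (r - 1))) *
      δ ^ (s * (q - 1) / (r - 1) / (a + s * (q - 1) / (r - 1))) := by
  have hq1 : 0 < q - 1 := by linarith
  unfold expNu expMu rate
  split_ifs with h
  · rw [max_eq_right h] at hr
    have h1 : s * (q - 1) / (r - 1) = s := by rw [hr]; field_simp
    rw [h1, hr]
    refine ⟨rfl, by field_simp, fun _ _ => rfl⟩
  · rw [max_eq_left (not_le.1 h).le] at hr
    have h1 : s * (q - 1) / (r - 1) = s * (q - 1) := by rw [hr]; norm_num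
    rw [h1, hr]
    exact ⟨rfl, by field_simp, fun _ _ => rfl⟩

end Exponents

/-! ### The blocks of elements of `B^0_{p,q}` -/

variable {d σ : ℕ} (W : WaveletSystem d σ)

theorem besovNorm_exponent_mono {d : ℕ} (s : ℝ) {p : ℝ} (hp2 : p ≤ 2) (q : ENNReal)
    (c : (Fin d → ℤ) → ℂ) : besovNorm s p q c ≤ besovNorm s 2 q c := by
  refine ellNorm_mono _ fun j => ?_
  gcongr
  exact eLpNorm_le_eLpNorm_of_exponent_le (ENNReal.ofReal_le_ofReal hp2)
    (Continuous.aestronglyMeasurable (by fun_prop))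

theorem two_rpow_mul_eq (j : ℕ) (s : ℝ) : (2 : ℝ) ^ ((j : ℝ) * s) = (((1 / 2 : ℝ) ^ j) ^ s)⁻¹ := by
  rw [← Real.rpow_natCast, ← Real.rpow_mul (by norm_num), one_div,
    Real.inv_rpow two_pos.le, inv_inv]

theorem WaveletSystem.toReal_block_le {s p : ℝ} {q : ENNReal} (hq : 1 ≤ q) {u : Distr d σ} {K : ℝ}
    (hK : 0 ≤ K) (h : W.norm s p q u ≤ ENNReal.ofReal K) (j : ℕ) :
    (W.block p u j).toReal ≤ K * ((1 / 2 : ℝ) ^ j) ^ s := by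
  rw [W.norm_eq_block] at h
  have h1 := ENNReal.toReal_mono ENNReal.ofReal_ne_top ((le_ellNorm hq _ j).trans h)
  rw [ENNReal.toReal_mul, ENNReal.toReal_ofReal (by positivity), ENNReal.toReal_ofReal hK,
    two_rpow_mul_eq, inv_mul_le_iff₀ (by positivity), mul_comm] at h1
  exact h1

section

variable (p q : ℝ) [hp : Fact (1 < p)] [hq : Fact (1 < q)]

/-- The norms of the blocks of wavelet coefficients. -/
def XSpace.block (f : XSpace W p q) (j : ℕ) : ℝ := (W.block p (XSpace.toDistr W p q f) j).toReal

theorem XSpace.block_lt_top (f : XSpace W p q) (j : ℕ) :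
    W.block p (XSpace.toDistr W p q f) j < ⊤ := by
  have h := XSpace.norm_lt_top W p q f
  rw [W.norm_zero_eq_block] at h
  exact (le_ellNorm (by simpa using hq.out.le) _ j).trans_lt h

theorem XSpace.isBlockDecomposition : IsBlockDecomposition q (XSpace.block W p q) where
  nonneg _ _ := ENNReal.toReal_nonneg
  add_smul_le f h t ht j := by
    have h1 := W.block_add_le hp.out.le (XSpace.toDistr W p q f) (t • XSpace.toDistr W p q h) j
    rw [W.block_smul hp.out.le, ← map_smul, ← map_add] at h1
    have hf := XSpace.block_lt_top W p q f j
    have hh := ENNReal.mul_lt_top (enorm_lt_top (x := t)) (XSpace.block_lt_top W p q h j)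
    have h2 := ENNReal.toReal_mono (ENNReal.add_lt_top.2 ⟨hf, hh⟩).ne h1
    rw [ENNReal.toReal_add hf.ne hh.ne, ENNReal.toReal_mul, toReal_enorm,
      Real.norm_of_nonneg ht] at h2
    exact h2
  hasSum f := by
    have hq0 : 0 < q := by linarith [hq.out]
    have h := XSpace.ofReal_norm_eq W p q f
    rw [W.norm_zero_eq_block] at h
    have h1 : ∑' j, W.block p (XSpace.toDistr W p q f) j ^ q = ENNReal.ofReal (‖f‖ ^ q) := by
      rw [← ENNReal.ofReal_rpow_of_nonneg (norm_nonneg _) hq0.le, h, ellNorm_rpow hq0,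
        div_self hq0.ne', ENNReal.rpow_one]
    have h0 := h1.trans_ne ENNReal.ofReal_ne_top
    have h2 := ENNReal.hasSum_toReal h0
    rw [← ENNReal.tsum_toReal_eq (ENNReal.ne_top_of_tsum_ne_top h0), h1,
      ENNReal.toReal_ofReal (by positivity)] at h2
    simpa only [XSpace.block, ENNReal.toReal_rpow] using h2

theorem XSpace.exists_block_le_of_besovNorm_le {s : ℝ} (hs : |s| < σ) : ∃ C : ℝ, 0 < C ∧
    ∀ (f : XSpace W p q) (ϱ : ℝ), 0 ≤ ϱ → besovNorm s p ⊤ (XSpace.coeff f) ≤ ENNReal.ofReal ϱ →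
      ∀ j : ℕ, XSpace.block W p q f j ≤ C * ϱ * ((1 / 2 : ℝ) ^ j) ^ s := by
  obtain ⟨C, hC, h⟩ := W.norm_equiv s p ⊤ hs hp.out le_top
  refine ⟨C, hC, fun f ϱ hϱ hf j => W.toReal_block_le le_top (by positivity) ?_ j⟩
  rw [ENNReal.ofReal_mul hC.le]
  exact (h _).1.trans (by gcongr; exact hf)

/-- The blocks are ℓ^p norms, so the passage from 2 to p is made on the Fourier side, where L²
dominates L^p on a space of measure one; the wavelet equivalence is then used in B^{-a}_{p,2}, and
no power of 2^j is lost. -/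
theorem XSpace.exists_block_le_of_sobolevNorm_le (hp2 : p ≤ 2) {a : ℝ} (ha : |a| < σ) :
    ∃ C : ℝ, 0 < C ∧ ∀ (f : XSpace W p q) (e : ℝ), 0 ≤ e →
      besovNorm (-a) 2 2 (XSpace.coeff f) ≤ ENNReal.ofReal e →
        ∀ j : ℕ, XSpace.block W p q f j ≤ ((1 / 2 : ℝ) ^ j) ^ (-a) * (C * e) := by
  obtain ⟨C, hC, h⟩ := W.norm_equiv (-a) p 2 (by rwa [abs_neg]) hp.out (by norm_num)
  refine ⟨C, hC, fun f e he hf j => ?_⟩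
  rw [mul_comm]
  refine W.toReal_block_le (q := 2) (by norm_num) (by positivity) ?_ j
  rw [ENNReal.ofReal_mul hC.le]
  refine (h _).1.trans ?_
  gcongr
  exact (besovNorm_exponent_mono (-a) hp2 2 _).trans hf

/-- The norm of `B^{-a}_{2,2}` as a seminorm on `B^0_{p,q}`. -/
theorem XSpace.exists_sobolevSeminorm (hp2 : p ≤ 2) {a : ℝ} (ha : d / p - d / 2 < a)
    (haσ : a < σ) : ∃ E : Seminorm ℝ (XSpace W p q), (∃ C : ℝ, ∀ f, E f ≤ C * ‖f‖) ∧
      ∀ f, besovNorm (-a) 2 2 (XSpace.coeff f) = ENNReal.ofReal (E f) := by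
  obtain ⟨C, hC, h⟩ := XSpace.exists_besovNorm_le W p q hp2 ha haσ
  have hfin : ∀ f : XSpace W p q, besovNorm (-a) 2 2 (XSpace.coeff f) ≠ ⊤ := fun f =>
    ((h f).trans_lt ENNReal.ofReal_lt_top).ne
  refine ⟨Seminorm.of (fun f => (besovNorm (-a) 2 2 (XSpace.coeff f)).toReal) (fun f g => ?_)
    fun t f => ?_, ⟨C, fun f => ?_⟩, fun f => ?_⟩
  · rw [← ENNReal.toReal_add (hfin f) (hfin g), XSpace.coeff_add]
    exact ENNReal.toReal_mono (ENNReal.add_ne_top.2 ⟨hfin f, hfin g⟩) (besovNorm_add_le _ _ _)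
  · rw [XSpace.coeff_smul, besovNorm_smul, ENNReal.toReal_mul, toReal_enorm, Complex.norm_real]
  · exact ENNReal.toReal_le_of_le_ofReal (by positivity) (h f)
  · exact (ENNReal.ofReal_toReal (hfin f)).symm

end

end BesovTikhonov

end

/-! ### Assembly of the theorem -/

theorem mainTheorem4 {d σ : ℕ} (hd : 1 ≤ d) (W : BesovTikhonov.WaveletSystem d σ)
    (p q : ℝ) [Fact (1 < p)] [Fact (1 < q)] (hp : p ≤ 2)
    (a s L : ℝ) (ha : d / p - d / 2 < a) (hL : 0 < L) (hs : 0 < s) (hsa : s < a / (q - 1))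
    (haσ : a < σ) (hsσ : s < σ)
    (D : Set (BesovTikhonov.XSpace W p q)) (hDclosed : IsClosed D) (hDconvex : Convex ℝ D)
    (F : BesovTikhonov.XSpace W p q → BesovTikhonov.YSpace d)
    (hF : BesovTikhonov.IsSmoothing a L D F)
    (R : BesovTikhonov.XSpace W p q → ℝ)
    (hR : R = BesovTikhonov.penalty (max 2 (max p q))) :
    ∃ c c' : ℝ, 0 < c ∧ 0 < c' ∧
      ∀ (ϱ : ℝ), 0 < ϱ → ∀ f₀ ∈ D,
        BesovTikhonov.besovNorm s p ⊤ (BesovTikhonov.XSpace.coeff f₀) ≤ ENNReal.ofReal ϱ →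
        -- the variational source condition
        ((BesovTikhonov.subdiff R f₀).Nonempty ∧
          ∀ fs ∈ BesovTikhonov.subdiff R f₀,
            BesovTikhonov.VSC D F R f₀ fs (BesovTikhonov.indexFun a s q c ϱ)) ∧
        ∀ (δ : ℝ), 0 < δ → ∀ gobs : BesovTikhonov.YSpace d, ‖gobs - F f₀‖ ≤ δ →
          -- existence, and uniqueness for linear operators, of the Tikhonov minimizer
          (∀ α : ℝ, 0 < α →
            (∃ f, BesovTikhonov.IsTikhonovMinimizer D F R gobs α f) ∧
            ((∃ A : BesovTikhonov.XSpace W p q →ₗ[ℝ] BesovTikhonov.YSpace d, ∀ f ∈ D, F f = A f) →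
              ∃! f, BesovTikhonov.IsTikhonovMinimizer D F R gobs α f)) ∧
          -- the convergence rate under the a-priori rule
          (∃ α, BesovTikhonov.IsAPrioriChoice (BesovTikhonov.indexFun a s q c ϱ) δ α) ∧
          ∀ α, BesovTikhonov.IsAPrioriChoice (BesovTikhonov.indexFun a s q c ϱ) δ α →
            ∀ f, BesovTikhonov.IsTikhonovMinimizer D F R gobs α f →
              ‖f - f₀‖ ≤ c' * BesovTikhonov.rate a s q ϱ δ := by
  
  have hp1 : 1 < p := Fact.out
  have hq1 : 1 < q := Fact.out
  have ha0 : 0 < a := lt_of_le_of_lt (sub_nonneg.2 (by gcongr)) ha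
  have hsa' : s * (q - 1) < a := (lt_div_iff₀ (by linarith)).1 hsa
  have hrq : max 2 (max p q) = max 2 q := by rw [← max_assoc, max_eq_left hp]
  obtain ⟨κ, hκ, hconv⟩ := BesovTikhonov.XSpace.norm_convex W p q hp
  rw [hrq] at hR hconv
  obtain ⟨r, hr⟩ : ∃ r, r = max 2 q := ⟨_, rfl⟩
  rw [← hr] at hR hconv
  subst hR
  have hqr : q ≤ r := hr ▸ le_max_right _ _
  have hr1 : 1 < r := hq1.trans_le hqr
  have hr0 : 0 < r := by linarith
  have huc : BesovTikhonov.IsUniformlyConvex (κ / r) r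
      (BesovTikhonov.penalty r : BesovTikhonov.XSpace W p q → ℝ) := fun f g => by
    have h := mul_le_mul_of_nonneg_left (hconv f g) (one_div_pos.2 hr0).le
    unfold BesovTikhonov.penalty
    calc _ = 1 / r * (‖(1 / 2 : ℝ) • (f + g)‖ ^ r + κ * ‖f - g‖ ^ r) := by ring
      _ ≤ _ := h
      _ = _ := by ring
  have hcr : 0 < κ / r := by positivity
  obtain ⟨hν, hμ, hrate⟩ := BesovTikhonov.exponents_eq hq1 hs ha0 hr
  set s' := s * (q - 1) / (r - 1) with hs'
  have hs'0 : 0 < s' := div_pos (mul_pos hs (by linarith)) (by linarith)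
  have has : 0 < a + s' := by linarith
  set ν := BesovTikhonov.expNu a s q
  set μ := BesovTikhonov.expMu a s q
  have hμ0 : 0 < μ := by rw [hμ]; positivity
  -- The claim amounts to (r−2)s' ≤ 2a, and (r−1)s' = s(q−1) < a.
  have hμ1 : μ ≤ 1 := by
    have h1 : s' * (r - 1) = s * (q - 1) := by
      rw [hs']; field_simp [sub_ne_zero.2 hr1.ne']
    rw [hμ, div_div, div_le_one (by positivity)]
    nlinarith
  have hblk := BesovTikhonov.XSpace.isBlockDecomposition W p q
  -- The coefficient κ/r of ‖h‖^r is half the one in `IsUniformlyConvex.le_bregman`, so this term is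
  -- at most half the Bregman distance.
  obtain ⟨C₀, hC₀, hvsc⟩ := hblk.exists_vsc_bound hq1 hqr hs hsa' hcr
  obtain ⟨C₁, hC₁, hsmooth⟩ := BesovTikhonov.XSpace.exists_block_le_of_besovNorm_le W p q
    (s := s) (by rwa [abs_of_pos hs])
  obtain ⟨C₂, hC₂, hweak⟩ := BesovTikhonov.XSpace.exists_block_le_of_sobolevNorm_le W p q hp
    (a := a) (by rwa [abs_of_pos ha0])
  obtain ⟨E, ⟨CE, hCE⟩, hE⟩ := BesovTikhonov.XSpace.exists_sobolevSeminorm W p q hp ha haσ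
  have hcomplete := BesovTikhonov.XSpace.completeSpace W p q hp ha haσ
  -- The source bound is applied with K = C₁ϱ and G = C₂L‖F f₀ − F f‖; the constant collects their
  -- powers, the exponent of G being 2μ.
  set c : ℝ := C₀ * (C₁ ^ ν * (C₂ * L) ^ (2 * μ)) with hc
  have hc0 : 0 < c := by positivity
  refine ⟨c, (c / (κ / r) * 4 ^ μ) ^ (1 / r), hc0, by positivity,
    fun ϱ hϱ f₀ hf₀ hf₀ϱ => ?_⟩
  have hk : 0 < c * ϱ ^ ν := by positivity
  have hV : ∀ fs ∈ BesovTikhonov.subdiff (BesovTikhonov.penalty r) f₀,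
      BesovTikhonov.VSC D F (BesovTikhonov.penalty r) f₀ fs
        (BesovTikhonov.indexFun a s q c ϱ) := by
    intro fs hfs
    refine ⟨BesovTikhonov.isConcaveIndexFunction_rpow hk hμ0 hμ1, fun f hf => ?_⟩
    have hinv := hF.inverse_lipschitz f₀ hf₀ f hf
    rw [← ofReal_norm, ← ENNReal.ofReal_mul hL.le] at hinv
    have h1 := hvsc f₀ (f₀ - f) fs (C₁ * ϱ) (C₂ * (L * ‖F f₀ - F f‖)) hfs (by positivity)
      (by positivity) (hsmooth f₀ ϱ hϱ.le hf₀ϱ) (hweak _ _ (by positivity) hinv)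
    have h2 := huc.le_bregman hfs f
    rw [norm_sub_rev] at h2
    have h3 : C₀ * ((C₁ * ϱ) ^ (r * a / (a + s')) *
        (C₂ * (L * ‖F f₀ - F f‖)) ^ (r * s' / (a + s'))) =
        BesovTikhonov.indexFun a s q c ϱ (‖F f₀ - F f‖ ^ 2) := by
      have h4 : r * s' / (a + s') = 2 * μ := by rw [hμ]; ring
      change _ = c * ϱ ^ ν * (‖F f₀ - F f‖ ^ 2) ^ μ
      rw [← hν, h4, ← Real.rpow_natCast, ← Real.rpow_mul (norm_nonneg _), ← mul_assoc C₂,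
        Real.mul_rpow hC₁.le hϱ.le, Real.mul_rpow (by positivity) (norm_nonneg _), hc]
      push_cast
      ring
    rw [h3] at h1
    linarith
  refine ⟨⟨BesovTikhonov.subdiff_penalty_nonempty hr1 f₀, hV⟩, fun δ hδ gobs hg => ⟨fun α hα => ?_,
    BesovTikhonov.exists_isAPrioriChoice_rpow hk hμ0 hμ1 hδ, fun α hα f hf => ?_⟩⟩
  · have hex : ∃ f, BesovTikhonov.IsTikhonovMinimizer D F (BesovTikhonov.penalty r) gobs α f := by
      refine BesovTikhonov.exists_isTikhonovMinimizer hcr hr0 huc hDclosed hDconvex ⟨f₀, hf₀⟩ E hCE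
        (fun B f hf => ?_) hL (fun f₁ h₁ f₂ h₂ => ?_) gobs hα
      · obtain ⟨φ, hφ, h⟩ := BesovTikhonov.XSpace.exists_subseq_cauchy W p q hp ha haσ f hf
        refine ⟨φ, hφ, fun ε hε => (h ε hε).imp fun N hN m hm n hn => ?_⟩
        have := hN m hm n hn
        rwa [hE, ENNReal.ofReal_le_ofReal_iff hε.le] at this
      · have := hF.lipschitz_L2 f₁ h₁ f₂ h₂
        rwa [hE, ← ofReal_norm, ← ENNReal.ofReal_mul hL.le,
          ENNReal.ofReal_le_ofReal_iff (mul_nonneg hL.le (apply_nonneg E _))] at this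
    refine ⟨hex, fun ⟨A, hA⟩ => ?_⟩
    obtain ⟨f, hf⟩ := hex
    refine ⟨f, hf, fun f' hf' => sub_eq_zero.1 ?_⟩
    exact BesovTikhonov.XSpace.eq_zero_of_norm_eq_zero W p q hp ha haσ
      (huc.norm_sub_eq_zero hcr hr0 hDconvex hA hα hf' hf)
  · obtain ⟨fs, hfs⟩ := BesovTikhonov.subdiff_penalty_nonempty hr1 f₀
    have h1 := (hV fs hfs).bregman_le hf₀ hg hα hf
    have h2 := huc.le_bregman hfs f
    have h3 : BesovTikhonov.indexFun a s q c ϱ (2 * 2 * δ ^ 2) =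
        c * ϱ ^ ν * (4 ^ μ * δ ^ (2 * μ)) := by
      change c * ϱ ^ ν * (2 * 2 * δ ^ 2) ^ μ = _
      rw [Real.mul_rpow (by norm_num) (by positivity), ← Real.rpow_natCast δ 2,
        ← Real.rpow_mul hδ.le]
      norm_num
    have h4 : ‖f - f₀‖ ^ r ≤ c / (κ / r) * 4 ^ μ * (ϱ ^ ν * δ ^ (2 * μ)) := by
      rw [h3] at h1
      have h5 : c / (κ / r) * 4 ^ μ * (ϱ ^ ν * δ ^ (2 * μ)) =
          c * ϱ ^ ν * (4 ^ μ * δ ^ (2 * μ)) / (κ / r) := by ring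
      rw [h5, le_div_iff₀ hcr]
      linarith
    have h5 := Real.rpow_le_rpow (by positivity) h4 (one_div_pos.2 hr0).le
    rw [← Real.rpow_mul (norm_nonneg _), mul_one_div_cancel hr0.ne', Real.rpow_one,
      Real.mul_rpow (by positivity) (by positivity),
      Real.mul_rpow (x := ϱ ^ ν) (by positivity) (by positivity),
      ← Real.rpow_mul hϱ.le, ← Real.rpow_mul hδ.le] at h5
    have h6 : ν * (1 / r) = a / (a + s') := by rw [hν]; field_simp
    have h7 : 2 * μ * (1 / r) = s' / (a + s') := by rw [hμ]; field_simp
    rw [h6, h7] at h5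
    rw [hrate]
    exact h5
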